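/- \textbf{Setting.} Let $n\ge 0$, $t\ge 1$, $\mathbf s=(s_1,\dots,s_t)$ and $\mathbf k=(k_1,\dots,k_t)$ be vectors of nonnegative integers with $k_1\ge k_2\ge\cdots\ge k_t$ and $s:=\sum_i s_i\le n$. In the $(\mathbf s,\mathbf k,t)$ asymmetric document exchange (DE) problem Alice has $x\in\{0,1\}^n$ and Bob has $y\in\{0,1\}^n$ together with pairwise disjoint sets $S_1,\dots,S_t\subseteq[n]$, $|S_i|=s_i$, such that $x$ and $y$ differ only in positions of $\bigcup_i S_i$, and in at most $k_i$ positions of $S_i$ for every $i$. Both know $n,t,\mathbf s,\mathbf k$ and share a string of independent uniformly random bits; Bob has to learn $x$. A protocol must work for every such $x,y,S_1,\dots,S_t$ (fixed independently of the random bits); its error probability is the probability over the shared random bits that Bob does not output $x$, maximized over all such inputs, and its communication complexity is the largest number of bits exchanged. Put $$\mathsf H(\mathbf s,\mathbf k)=\sum_{i=1}^t\log_2\Big(\sum_{j=0}^{k_i}\binom{s_i}{j}\Big).$$ \textbf{Corollary.} For every constant $a>0$ there are constants $C,c,K>0$ and $b\in\mathbb N$ and two fixed programs for Alice and Bob on a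 random access machine with logarithmic cost such that, for all $n,t,\mathbf s,\mathbf k$ as above with $s_i\ge 2k_i$ for all $i$, the following hold. (1) The programs form a one-round protocol: Alice sends Bob a single message, computed from $x,n,t,\mathbf s,\mathbf k$ and the shared random bits, and Bob then outputs a string. The message has at most $C\,t^2\,\mathsf H(\mathbf s,\mathbf k)$ bits, both programs always halt in time at most $C(n+2)\log^b(n+2)=\widetilde O(n)$, and the error probability is at most $$2^{-c\,k_t}+s^{-a}.$$ (2) For constant $t$ the communication is asymptotically optimal: if some randomized protocol for the same problem (shared randomness, any number of rounds, unbounded computation) exchanges at most $D$ bits and lets Bob learn $x$ with probability at least $1/2$ on every input, then $C\,t^2\,\mathsf H(\mathbf s,\mathbf k)\le K\,t^2 D$. -/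

import Mathlib

open MeasureTheory

/-! ### A logarithmic-cost random access machine

Programs manipulate natural numbers stored in registers and in arrays. The cost of every
elementary step is the total bit length of the numbers it handles (logarithmic cost criterion),
so large numbers are never handled for free. -/

/-- Elementary arithmetic and comparison instructions. -/
inductive ArithOp where
  | add | sub | mul | div | mod | lt | eq

/-- Truncated subtraction, division by zero gives zero, comparisons give `0` or `1`. -/
def ArithOp.eval : ArithOp → ℕ → ℕ → ℕ
  | .add, a, b => a + b
  | .sub, a, b => a - b
  | .mul, a, b => a * b
  | .div, a, b => a / b
  | .mod, a, b => a % b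
  | .lt, a, b => if a < b then 1 else 0
  | .eq, a, b => if a = b then 1 else 0

/-- Expressions: constants, registers, array cells with computed address, arithmetic. -/
inductive RamExpr where
  | const (c : ℕ)
  | reg (v : ℕ)
  | cell (arr : ℕ) (idx : RamExpr)
  | op (o : ArithOp) (e₁ e₂ : RamExpr)

/-- Contents of the registers and of the arrays, and the number of coins consumed so far. -/
structure RamState where
  reg : ℕ → ℕ
  arr : ℕ → ℕ → ℕ
  pos : ℕ

def RamExpr.eval (σ : RamState) : RamExpr → ℕ
  | .const c => c
  | .reg v => σ.reg v
  | .cell a i => σ.arr a (i.eval σ)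
  | .op o e₁ e₂ => o.eval (e₁.eval σ) (e₂.eval σ)

/-- Logarithmic cost of evaluating an expression: each node of the expression costs one plus the
bit length of its value (`Nat.size`). In particular a memory access is charged for the address and
for the contents, and an arithmetic instruction for both operands and for the result. -/
def RamExpr.cost (σ : RamState) : RamExpr → ℕ
  | .const c => 1 + c.size
  | .reg v => 1 + (σ.reg v).size
  | .cell a i => i.cost σ + (1 + (σ.arr a (i.eval σ)).size)
  | .op o e₁ e₂ => e₁.cost σ + e₂.cost σ + (1 + (o.eval (e₁.eval σ) (e₂.eval σ)).size)

/-- Programs. `coin v` puts the next bit of the random tape into register `v`. -/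
inductive RamProg where
  | skip
  | assign (v : ℕ) (e : RamExpr)
  | write (arr : ℕ) (idx e : RamExpr)
  | coin (v : ℕ)
  | seq (p q : RamProg)
  | branch (e : RamExpr) (p q : RamProg)
  | loop (e : RamExpr) (p : RamProg)

def RamState.setReg (σ : RamState) (v a : ℕ) : RamState :=
  { σ with reg := Function.update σ.reg v a }

def RamState.setCell (σ : RamState) (b i a : ℕ) : RamState :=
  { σ with arr := Function.update σ.arr b (Function.update (σ.arr b) i a) }

/-- `RamExec ω p σ τ T`: with random tape `ω`, program `p` started in state `σ` halts in state `τ`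
at total cost `T`. -/
inductive RamExec (ω : ℕ → Bool) : RamProg → RamState → RamState → ℕ → Prop where
  | skip (σ : RamState) : RamExec ω .skip σ σ 1
  | assign (v : ℕ) (e : RamExpr) (σ : RamState) :
      RamExec ω (.assign v e) σ (σ.setReg v (e.eval σ)) (1 + e.cost σ)
  | write (b : ℕ) (i e : RamExpr) (σ : RamState) :
      RamExec ω (.write b i e) σ (σ.setCell b (i.eval σ) (e.eval σ)) (1 + i.cost σ + e.cost σ)
  | coin (v : ℕ) (σ : RamState) :
      RamExec ω (.coin v) σ { σ.setReg v (ω σ.pos).toNat with pos := σ.pos + 1 } 1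
  | seq {p q : RamProg} {σ τ ρ : RamState} {T U : ℕ} :
      RamExec ω p σ τ T → RamExec ω q τ ρ U → RamExec ω (.seq p q) σ ρ (T + U)
  | branch_true {e : RamExpr} {p q : RamProg} {σ τ : RamState} {T : ℕ} :
      e.eval σ ≠ 0 → RamExec ω p σ τ T → RamExec ω (.branch e p q) σ τ (1 + e.cost σ + T)
  | branch_false {e : RamExpr} {p q : RamProg} {σ τ : RamState} {T : ℕ} :
      e.eval σ = 0 → RamExec ω q σ τ T → RamExec ω (.branch e p q) σ τ (1 + e.cost σ + T)
  | loop_done {e : RamExpr} {p : RamProg} {σ : RamState} :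
      e.eval σ = 0 → RamExec ω (.loop e p) σ σ (1 + e.cost σ)
  | loop_step {e : RamExpr} {p : RamProg} {σ τ ρ : RamState} {T U : ℕ} :
      e.eval σ ≠ 0 → RamExec ω p σ τ T → RamExec ω (.loop e p) τ ρ U →
        RamExec ω (.loop e p) σ ρ (1 + e.cost σ + T + U)

/-- Execution is deterministic once the random tape is fixed: final state and cost are unique. -/
theorem RamExec.unique {ω : ℕ → Bool} {p : RamProg} {σ τ τ' : RamState} {T T' : ℕ}
    (h : RamExec ω p σ τ T) (h' : RamExec ω p σ τ' T') : τ = τ' ∧ T = T' := by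
  induction h generalizing τ' T' with
  | skip => cases h'; exact ⟨rfl, rfl⟩
  | assign => cases h'; exact ⟨rfl, rfl⟩
  | write => cases h'; exact ⟨rfl, rfl⟩
  | coin => cases h'; exact ⟨rfl, rfl⟩
  | seq _ _ ih₁ ih₂ =>
    cases h' with
    | seq h₁ h₂ =>
      obtain ⟨rfl, rfl⟩ := ih₁ h₁
      obtain ⟨rfl, rfl⟩ := ih₂ h₂
      exact ⟨rfl, rfl⟩
  | branch_true he _ ih =>
    cases h' with
    | branch_true _ h₁ => obtain ⟨rfl, rfl⟩ := ih h₁; exact ⟨rfl, rfl⟩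
    | branch_false he' _ => exact absurd he' he
  | branch_false he _ ih =>
    cases h' with
    | branch_true he' _ => exact absurd he he'
    | branch_false _ h₁ => obtain ⟨rfl, rfl⟩ := ih h₁; exact ⟨rfl, rfl⟩
  | loop_done he =>
    cases h' with
    | loop_done _ => exact ⟨rfl, rfl⟩
    | loop_step he' _ _ => exact absurd he he'
  | loop_step he _ _ ih₁ ih₂ =>
    cases h' with
    | loop_done he' => exact absurd he' he
    | loop_step _ h₁ h₂ =>
      obtain ⟨rfl, rfl⟩ := ih₁ h₁
      obtain ⟨rfl, rfl⟩ := ih₂ h₂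
      exact ⟨rfl, rfl⟩

/-! ### Asymmetric document exchange -/

/-- `H(s, k) = ∑ i, log₂ (∑_{j ≤ k i} (s i choose j))`. -/
noncomputable def entropyH {t : ℕ} (s k : Fin t → ℕ) : ℝ :=
  ∑ i, Real.logb 2 (∑ j ∈ Finset.range (k i + 1), ((s i).choose j : ℝ))

/-- Alice's string `x`, Bob's string `y` and Bob's sets `S` are a possible input: the sets are
disjoint and have the prescribed sizes, `x` and `y` differ only inside these sets, and in at most
`k i` positions of the `i`-th set. -/
structure DEConsistent {n t : ℕ} (s k : Fin t → ℕ) (x y : Fin n → Bool)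
    (S : Fin t → Finset (Fin n)) : Prop where
  disjoint : ∀ i j, i ≠ j → Disjoint (S i) (S j)
  card_eq : ∀ i, (S i).card = s i
  dist_le : ∀ i, ((S i).filter fun j => x j ≠ y j).card ≤ k i
  diff_subset : ∀ j, x j ≠ y j → ∃ i, j ∈ S i

/-- The array whose first cells are the entries of `l` and whose other cells are zero. -/
def listArray (l : List ℕ) : ℕ → ℕ := fun i => l.getD i 0

def bitArray {n : ℕ} (x : Fin n → Bool) : ℕ → ℕ :=
  listArray (List.ofFn fun j => (x j).toNat)

/-- The elements of `S 0` in increasing order, followed by those of `S 1`, and so on. -/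
def setsArray {n t : ℕ} (S : Fin t → Finset (Fin n)) : ℕ → ℕ :=
  listArray ((List.ofFn fun i => ((S i).sort (· ≤ ·)).map Fin.val).flatten)

/-- Alice starts with `n`, `t` in registers `0`, `1`, and with `x`, `s`, `k` in arrays
`0`, `1`, `2`. -/
def aliceStart {n t : ℕ} (s k : Fin t → ℕ) (x : Fin n → Bool) : RamState where
  reg
    | 0 => n
    | 1 => t
    | _ => 0
  arr
    | 0 => bitArray x
    | 1 => listArray (List.ofFn s)
    | 2 => listArray (List.ofFn k)
    | _ => fun _ => 0
  pos := 0

/-- Alice's message is left in array `4`, its length in register `2`. -/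
def RamState.message (σ : RamState) : List Bool :=
  (List.range (σ.reg 2)).map fun j => decide (σ.arr 4 j ≠ 0)

/-- Bob starts with `n`, `t` and the length of the message in registers `0`, `1`, `2`, and with
`y`, `s`, `k`, his sets and the message in arrays `0`, `1`, `2`, `3`, `4`. -/
def bobStart {n t : ℕ} (s k : Fin t → ℕ) (y : Fin n → Bool) (S : Fin t → Finset (Fin n))
    (msg : List Bool) : RamState where
  reg
    | 0 => n
    | 1 => t
    | 2 => msg.length
    | _ => 0
  arr
    | 0 => bitArray y
    | 1 => listArray (List.ofFn s)
    | 2 => listArray (List.ofFn k)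
    | 3 => setsArray S
    | 4 => listArray (msg.map Bool.toNat)
    | _ => fun _ => 0
  pos := 0

/-- With shared random tape `ω`, Alice sends `msg` after time `T`. -/
def AliceSends {n t : ℕ} (alice : RamProg) (s k : Fin t → ℕ) (x : Fin n → Bool) (ω : ℕ → Bool)
    (msg : List Bool) (T : ℕ) : Prop :=
  ∃ τ, RamExec ω alice (aliceStart s k x) τ T ∧ msg = τ.message

/-- With shared random tape `ω` and received message `msg`, Bob halts after time `T` with `z` in
array `5`. -/
def BobOutputs {n t : ℕ} (bob : RamProg) (s k : Fin t → ℕ) (y : Fin n → Bool)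
    (S : Fin t → Finset (Fin n)) (msg : List Bool) (ω : ℕ → Bool) (z : Fin n → ℕ) (T : ℕ) : Prop :=
  ∃ τ, RamExec ω bob (bobStart s k y S msg) τ T ∧ z = fun j : Fin n => τ.arr 5 (j : ℕ)

/-- The law of the shared random tape: independent fair bits. -/
noncomputable def fairCoins : Measure (ℕ → Bool) :=
  Measure.infinitePi fun _ => (PMF.uniformOfFintype Bool).toMeasure

/-- The one-round protocol given by `alice` and `bob` solves document exchange with parameters
`n`, `s`, `k`: Alice sends one message, of at most `M` bits; on every possible input both
parties run in time at most `T` whatever the random tape, and the probability over the shared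
random tape that Bob does not output Alice's string is at most `err`. -/
structure OneRoundSolves (alice bob : RamProg) (n : ℕ) {t : ℕ} (s k : Fin t → ℕ)
    (M T err : ℝ) : Prop where
  alice_run : ∀ (x : Fin n → Bool) (ω : ℕ → Bool), ∃ msg U,
    AliceSends alice s k x ω msg U ∧ (msg.length : ℝ) ≤ M ∧ (U : ℝ) ≤ T
  bob_run : ∀ (x y : Fin n → Bool) (S : Fin t → Finset (Fin n)), DEConsistent s k x y S →
    ∀ (ω : ℕ → Bool) (msg : List Bool) (U : ℕ), AliceSends alice s k x ω msg U →
      ∃ z V, BobOutputs bob s k y S msg ω z V ∧ (V : ℝ) ≤ T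
  error_le : ∀ (x y : Fin n → Bool) (S : Fin t → Finset (Fin n)), DEConsistent s k x y S →
    fairCoins {ω | ¬ ∃ msg U V, AliceSends alice s k x ω msg U ∧
      BobOutputs bob s k y S msg ω (fun j => (x j).toNat) V} ≤ ENNReal.ofReal err

/-! ### Arbitrary two-party protocols, for comparison -/

/-- Deterministic two-party protocols with any number of rounds and no computational restriction:
at each inner node one party announces a bit that depends on its own input, at a leaf Bob produces
an output that depends on his input. -/
inductive CommTree (X Y Z : Type) where
  | leaf (out : Y → Z)
  | alice (f : X → Bool) (onFalse onTrue : CommTree X Y Z)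
  | bob (g : Y → Bool) (onFalse onTrue : CommTree X Y Z)

/-- Number of bits exchanged in the worst case. -/
def CommTree.depth {X Y Z : Type} : CommTree X Y Z → ℕ
  | .leaf _ => 0
  | .alice _ p q => max p.depth q.depth + 1
  | .bob _ p q => max p.depth q.depth + 1

/-- Bob's output. -/
def CommTree.run {X Y Z : Type} (x : X) (y : Y) : CommTree X Y Z → Z
  | .leaf out => out y
  | .alice f p q => if f x then q.run x y else p.run x y
  | .bob g p q => if g y then q.run x y else p.run x y

/-- `D` bits of communication suffice for some randomized protocol (shared randomness, any number
of rounds, unbounded computation) in which Bob learns Alice's string with probability at least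
`1/2` on every possible input. -/
def RandomizedDEPossible (n : ℕ) {t : ℕ} (s k : Fin t → ℕ) (D : ℕ) : Prop :=
  ∃ (Ω : Type) (_ : MeasurableSpace Ω) (μ : Measure Ω)
    (P : Ω → CommTree (Fin n → Bool) ((Fin n → Bool) × (Fin t → Finset (Fin n))) (Fin n → Bool)),
    IsProbabilityMeasure μ ∧ (∀ ω, (P ω).depth ≤ D) ∧
    ∀ (x y : Fin n → Bool) (S : Fin t → Finset (Fin n)), DEConsistent s k x y S →
      MeasurableSet {ω | (P ω).run x (y, S) = x} ∧ 1 / 2 ≤ μ {ω | (P ω).run x (y, S) = x}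

/-! ### Resource-bounded execution of random access programs -/

/-! Protocol. Levels `2 ^ e` run downwards from the top bit of `k 0`. At a level every position is
hashed by fresh shared coins into each of `d` tables, and a cell holds the parity of Alice's bits
hashed there. Bob adds his current string `z`, so a cell shows the parity of the errors in it. Among
the sets with `k i ≥ 2 ^ e` he flips every position whose cell is odd in more than half of the
tables. A decoded position is then wrong only if it shared its cell with another error in at least
half of the tables (`errSet_decodeLevel`). The invariant `LevelInv` says that few of the decoded
positions are wrong, while the sets not yet decoded contribute fewer than `2 ^ (e + 1)` errors each.
So `O(t * 2 ^ e)` cells per table keep all errors apart up to a small fraction. Once `2 ^ e` is at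
most `lastThr`, the minimum of the smallest nonzero `k i` and the bit length of the total size, all
nontrivial sets are decoded in one last step with `4 * sumSize` tables. If the message would grow
beyond `n` bits, Alice sends the string itself, as a single table with the identity as hash
function.

Error probability. Inside one table the members of a fixed set are exposed one by one. A landing in
an occupied cell is rare, and each landing creates at most two collided members; this gives an
exponential moment (`exists_landings`). Markov's inequality over the independent tables and a union
bound over sets of bad positions yield `card_many_collided`. The positions of the coins read by a
level are fixed in advance, so its coins are fresh relative to the string reached so far
(`fairCoins_fresh'`). Summing over the levels (`fairCoins_decodeRun`, `totalErr_le`) gives `2 ^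
(-k_t) + s ^ (-a)`; if `k_t = 0` the bound is trivial.

Message length. Level `2 ^ e` costs `O(t) * 2 ^ e` times the logarithm of the active size over `2 ^
e`. Since `s i ≥ 2 * k i`, logarithms of sums are at most sums of logarithms, and the resulting sums
over the levels are geometric, of order `k i * log (s i / k i) ≤ log (s i choose k i)`
(`sum_tables_le`). The last level is compared with the entropy in `lastThr_mul_sumSize_le`.

Optimality. For one fixed input of Bob, `2 ^ H` strings of Alice are possible, whereas a protocol of
depth `D` has at most `2 ^ D` outputs (`entropyH_le_of_possible`).

Programs. Both parties run the same program, up to a flag that disables Bob's flips for Alice. Its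
final state is described by the pure recursion `runLevels` (`partyProg_spec`), every number staying
below `numBound`, so that one elementary step costs `O(log n)`. When Bob starts from Alice's final
table array, `runLevels` becomes the probabilistic process `decodeRun` (`runLevels_z`). -/

/-- Number of nodes of an expression. -/
def RamExpr.nodes : RamExpr → ℕ
  | .const _ => 1
  | .reg _ => 1
  | .cell _ i => i.nodes + 1
  | .op _ e₁ e₂ => e₁.nodes + e₂.nodes + 1

/-- Every constant of the expression is at most `N`. -/
def RamExpr.ConstsLE (N : ℕ) : RamExpr → Prop
  | .const c => c ≤ N
  | .reg _ => True
  | .cell _ i => i.ConstsLE N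
  | .op _ e₁ e₂ => e₁.ConstsLE N ∧ e₂.ConstsLE N

/-- All registers and all array cells hold numbers at most `N`. -/
def RamState.Bdd (N : ℕ) (σ : RamState) : Prop :=
  (∀ v, σ.reg v ≤ N) ∧ ∀ b i, σ.arr b i ≤ N

theorem RamExpr.nodes_pos (e : RamExpr) : 1 ≤ e.nodes := by
  cases e <;> simp [RamExpr.nodes]

/-- Multiplication is the worst instruction and adds exponents. The factor `N` contributed by the
node itself pays for addition, since `u + v ≤ u * v * N` when `u, v ≥ 1` and `N ≥ 2`. -/
theorem RamExpr.eval_le_pow {N : ℕ} (hN : 2 ≤ N) {σ : RamState} (hσ : σ.Bdd N) (e : RamExpr)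
    (he : e.ConstsLE N) : e.eval σ ≤ N ^ e.nodes := by
  induction e with
  | const c => simpa [RamExpr.eval, RamExpr.nodes, RamExpr.ConstsLE] using he
  | reg v => simpa [RamExpr.eval, RamExpr.nodes] using hσ.1 v
  | cell b i _ =>
    exact (hσ.2 _ _).trans (Nat.le_self_pow (by simp [RamExpr.nodes]) N)
  | op o e₁ e₂ ih₁ ih₂ =>
    have h₁ := ih₁ he.1
    have h₂ := ih₂ he.2
    have hN1 : 1 ≤ N := by omega
    have p₁ : 1 ≤ N ^ e₁.nodes := Nat.one_le_pow _ _ hN1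
    have p₂ : 1 ≤ N ^ e₂.nodes := Nat.one_le_pow _ _ hN1
    have hpow : N ^ (e₁.nodes + e₂.nodes + 1) = N ^ e₁.nodes * N ^ e₂.nodes * N := by
      rw [pow_succ, pow_add]
    have hge : N ^ e₁.nodes + N ^ e₂.nodes ≤ N ^ e₁.nodes * N ^ e₂.nodes * N := by
      nlinarith [Nat.mul_le_mul p₁ p₂, Nat.mul_le_mul_left (N ^ e₁.nodes * N ^ e₂.nodes) hN,
        Nat.mul_le_mul_left (N ^ e₁.nodes) p₂, Nat.mul_le_mul_right (N ^ e₂.nodes) p₁]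
    have hmul : N ^ e₁.nodes * N ^ e₂.nodes ≤ N ^ e₁.nodes * N ^ e₂.nodes * N :=
      Nat.le_mul_of_pos_right _ hN1
    have hone : 1 ≤ N ^ e₁.nodes * N ^ e₂.nodes * N := by
      have := Nat.mul_le_mul p₁ p₂; omega
    simp only [RamExpr.eval, RamExpr.nodes, hpow]
    cases o <;> simp only [ArithOp.eval]
    · omega
    · omega
    · exact (Nat.mul_le_mul h₁ h₂).trans hmul
    · exact (Nat.div_le_self _ _).trans (by omega)
    · exact (Nat.mod_le _ _).trans (by omega)
    · split_ifs <;> omega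
    · split_ifs <;> omega

theorem Nat.size_pow_le (N m : ℕ) (hm : 1 ≤ m) : (N ^ m).size ≤ m * N.size := by
  rw [Nat.size_le, mul_comm, pow_mul]
  exact Nat.pow_lt_pow_left N.lt_size_self (by omega)

/-- The bound `m` stays fixed while the induction descends, so every node is charged the same price.
-/
theorem RamExpr.cost_le {N : ℕ} (hN : 2 ≤ N) {σ : RamState} (hσ : σ.Bdd N) (e : RamExpr)
    (he : e.ConstsLE N) {m : ℕ} (hm : e.nodes ≤ m) :
    e.cost σ ≤ e.nodes * (1 + m * N.size) := by
  have hs : ∀ e' : RamExpr, e'.ConstsLE N → e'.nodes ≤ m →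
      1 + (e'.eval σ).size ≤ 1 + m * N.size := by
    intro e' h' hm'
    have := Nat.size_le_size (e'.eval_le_pow hN hσ h')
    have h2 := Nat.size_pow_le N e'.nodes e'.nodes_pos
    have h3 := Nat.mul_le_mul_right N.size hm'
    omega
  induction e with
  | const c => simpa [RamExpr.cost, RamExpr.nodes, RamExpr.eval] using hs _ he hm
  | reg v => simpa [RamExpr.cost, RamExpr.nodes, RamExpr.eval] using hs _ he hm
  | cell b i ih =>
    have h0 := hs _ he hm
    simp only [RamExpr.nodes] at hm
    have := ih he (by omega)
    simp only [RamExpr.cost, RamExpr.nodes, RamExpr.eval] at h0 ⊢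
    nlinarith
  | op o e₁ e₂ ih₁ ih₂ =>
    have h0 := hs _ he hm
    simp only [RamExpr.nodes] at hm
    have h1 := ih₁ he.1 (by omega)
    have h2 := ih₂ he.2 (by omega)
    simp only [RamExpr.cost, RamExpr.nodes, RamExpr.eval] at h0 ⊢
    nlinarith

/-- Bound for the cost of one elementary step on numbers at most `N`. -/
def stepUnit (N : ℕ) : ℕ := 300 * (N.size + 1)

/-- An expression that is cheap to evaluate on numbers at most `N`. -/
def RamExpr.Small (N : ℕ) (e : RamExpr) : Prop := e.nodes ≤ 12 ∧ e.ConstsLE N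

theorem RamExpr.Small.cost_le {N : ℕ} (hN : 2 ≤ N) {σ : RamState} (hσ : σ.Bdd N) {e : RamExpr}
    (he : e.Small N) : e.cost σ ≤ 12 * (1 + 12 * N.size) :=
  (RamExpr.cost_le hN hσ e he.2 he.1).trans (Nat.mul_le_mul_right _ he.1)

/-- `p` started in `σ` halts in `τ` at the cost of at most `m` elementary steps on numbers
at most `N`. -/
def Runs (ω : ℕ → Bool) (N : ℕ) (p : RamProg) (σ τ : RamState) (m : ℕ) : Prop :=
  ∃ T, RamExec ω p σ τ T ∧ T ≤ m * stepUnit N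

section
variable {ω : ℕ → Bool} {N : ℕ}

theorem Runs.mono {p : RamProg} {σ τ : RamState} {m m' : ℕ} (h : Runs ω N p σ τ m) (hm : m ≤ m') :
    Runs ω N p σ τ m' := by
  obtain ⟨T, h1, h2⟩ := h
  exact ⟨T, h1, h2.trans (Nat.mul_le_mul_right _ hm)⟩

theorem stepUnit_pos : 1 ≤ stepUnit N := by unfold stepUnit; omega

theorem Runs.skip (σ : RamState) : Runs ω N .skip σ σ 1 :=
  ⟨_, .skip σ, by simpa using stepUnit_pos⟩

theorem Runs.coin (v : ℕ) (σ : RamState) :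
    Runs ω N (.coin v) σ { σ.setReg v (ω σ.pos).toNat with pos := σ.pos + 1 } 1 :=
  ⟨_, .coin v σ, by simpa using stepUnit_pos⟩

theorem Runs.assign (hN : 2 ≤ N) {σ : RamState} (hσ : σ.Bdd N) {v : ℕ} {e : RamExpr}
    (he : e.Small N) : Runs ω N (.assign v e) σ (σ.setReg v (e.eval σ)) 1 := by
  refine ⟨_, .assign v e σ, ?_⟩
  have := he.cost_le hN hσ
  unfold stepUnit; omega

theorem Runs.write (hN : 2 ≤ N) {σ : RamState} (hσ : σ.Bdd N) {b : ℕ} {i e : RamExpr}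
    (hi : i.Small N) (he : e.Small N) :
    Runs ω N (.write b i e) σ (σ.setCell b (i.eval σ) (e.eval σ)) 1 := by
  refine ⟨_, .write b i e σ, ?_⟩
  have := he.cost_le hN hσ
  have := hi.cost_le hN hσ
  -- The most expensive single instruction: two expressions of cost at most `12 + 144 * N.size`
  -- each, plus one, fit into `300 * (N.size + 1)`.
  unfold stepUnit; omega

theorem Runs.seq {p q : RamProg} {σ τ ρ : RamState} {m m' : ℕ} (h : Runs ω N p σ τ m)
    (h' : Runs ω N q τ ρ m') : Runs ω N (.seq p q) σ ρ (m + m') := by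
  obtain ⟨T, h1, h2⟩ := h
  obtain ⟨T', h1', h2'⟩ := h'
  exact ⟨_, .seq h1 h1', by rw [add_mul]; omega⟩

theorem Runs.branch_true (hN : 2 ≤ N) {σ τ : RamState} (hσ : σ.Bdd N) {e : RamExpr}
    (he : e.Small N) {p q : RamProg} {m : ℕ} (h0 : e.eval σ ≠ 0) (h : Runs ω N p σ τ m) :
    Runs ω N (.branch e p q) σ τ (m + 1) := by
  obtain ⟨T, h1, h2⟩ := h
  refine ⟨_, .branch_true h0 h1, ?_⟩
  have := he.cost_le hN hσ
  rw [add_mul]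
  unfold stepUnit at *; omega

theorem Runs.branch_false (hN : 2 ≤ N) {σ τ : RamState} (hσ : σ.Bdd N) {e : RamExpr}
    (he : e.Small N) {p q : RamProg} {m : ℕ} (h0 : e.eval σ = 0) (h : Runs ω N q σ τ m) :
    Runs ω N (.branch e p q) σ τ (m + 1) := by
  obtain ⟨T, h1, h2⟩ := h
  refine ⟨_, .branch_false h0 h1, ?_⟩
  have := he.cost_le hN hσ
  rw [add_mul]
  unfold stepUnit at *; omega

/-- A loop whose body is executed exactly `c` times, with invariant `I`. -/
theorem Runs.loop (hN : 2 ≤ N) {e : RamExpr} (he : e.Small N) {p : RamProg}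
    (I : ℕ → RamState → Prop) (c m : ℕ) (hbdd : ∀ i σ, I i σ → σ.Bdd N)
    (hgo : ∀ i, i < c → ∀ σ, I i σ → e.eval σ ≠ 0)
    (hbody : ∀ i, i < c → ∀ σ, I i σ → ∃ τ, Runs ω N p σ τ m ∧ I (i + 1) τ)
    (hdone : ∀ σ, I c σ → e.eval σ = 0) {σ : RamState} (h0 : I 0 σ) :
    ∃ τ, Runs ω N (.loop e p) σ τ (c * (m + 1) + 1) ∧ I c τ := by
  have key : ∀ r i, i + r = c → ∀ σ, I i σ →
      ∃ τ, Runs ω N (.loop e p) σ τ (r * (m + 1) + 1) ∧ I c τ := by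
    intro r
    induction r with
    | zero =>
      intro i hi σ hI
      obtain rfl : i = c := by omega
      refine ⟨σ, ⟨_, .loop_done (hdone σ hI), ?_⟩, hI⟩
      have := he.cost_le hN (hbdd _ _ hI)
      unfold stepUnit; omega
    | succ r ih =>
      intro i hi σ hI
      obtain ⟨τ, ⟨T, h1, h2⟩, hI'⟩ := hbody i (by omega) σ hI
      obtain ⟨ρ, ⟨U, h3, h4⟩, hI''⟩ := ih (i + 1) (by omega) τ hI'
      refine ⟨ρ, ⟨_, .loop_step (hgo i (by omega) σ hI) h1 h3, ?_⟩, hI''⟩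
      have := he.cost_le hN (hbdd _ _ hI)
      have hu : 1 + e.cost σ ≤ stepUnit N := by unfold stepUnit; omega
      have : ((r + 1) * (m + 1) + 1) * stepUnit N
          = stepUnit N + m * stepUnit N + (r * (m + 1) + 1) * stepUnit N := by ring
      omega
  exact key c 0 (by omega) σ h0

end

/-! ### Frame properties: what a program leaves unchanged -/

/-- Registers that a program may change. -/
def RamProg.modRegs : RamProg → List ℕ
  | .skip => []
  | .assign v _ => [v]
  | .write _ _ _ => []
  | .coin v => [v]
  | .seq p q => p.modRegs ++ q.modRegs
  | .branch _ p q => p.modRegs ++ q.modRegs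
  | .loop _ p => p.modRegs

/-- Arrays that a program may change. -/
def RamProg.modArrs : RamProg → List ℕ
  | .skip => []
  | .assign _ _ => []
  | .write b _ _ => [b]
  | .coin _ => []
  | .seq p q => p.modArrs ++ q.modArrs
  | .branch _ p q => p.modArrs ++ q.modArrs
  | .loop _ p => p.modArrs

/-- The program contains no `coin` instruction. -/
def RamProg.coinFree : RamProg → Bool
  | .skip => true
  | .assign _ _ => true
  | .write _ _ _ => true
  | .coin _ => false
  | .seq p q => p.coinFree && q.coinFree
  | .branch _ p q => p.coinFree && q.coinFree
  | .loop _ p => p.coinFree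

theorem RamExec.reg_eq {ω : ℕ → Bool} {p : RamProg} {σ τ : RamState} {T : ℕ}
    (h : RamExec ω p σ τ T) {v : ℕ} (hv : v ∉ p.modRegs) : τ.reg v = σ.reg v := by
  induction h with
  | seq _ _ ih₁ ih₂ =>
    simp only [RamProg.modRegs, List.mem_append, not_or] at hv
    rw [ih₂ hv.2, ih₁ hv.1]
  | branch_true _ _ ih =>
    simp only [RamProg.modRegs, List.mem_append, not_or] at hv
    exact ih hv.1
  | branch_false _ _ ih =>
    simp only [RamProg.modRegs, List.mem_append, not_or] at hv
    exact ih hv.2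
  | loop_step _ _ _ ih₁ ih₂ => rw [ih₂ hv, ih₁ hv]
  | _ => simp_all [RamState.setReg, RamState.setCell, RamProg.modRegs]

theorem RamExec.arr_eq {ω : ℕ → Bool} {p : RamProg} {σ τ : RamState} {T : ℕ}
    (h : RamExec ω p σ τ T) {b : ℕ} (hb : b ∉ p.modArrs) : τ.arr b = σ.arr b := by
  induction h with
  | seq _ _ ih₁ ih₂ =>
    simp only [RamProg.modArrs, List.mem_append, not_or] at hb
    rw [ih₂ hb.2, ih₁ hb.1]
  | branch_true _ _ ih =>
    simp only [RamProg.modArrs, List.mem_append, not_or] at hb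
    exact ih hb.1
  | branch_false _ _ ih =>
    simp only [RamProg.modArrs, List.mem_append, not_or] at hb
    exact ih hb.2
  | loop_step _ _ _ ih₁ ih₂ => rw [ih₂ hb, ih₁ hb]
  | _ => simp_all [RamState.setReg, RamState.setCell, RamProg.modArrs]

theorem RamExec.pos_eq {ω : ℕ → Bool} {p : RamProg} {σ τ : RamState} {T : ℕ}
    (h : RamExec ω p σ τ T) (hp : p.coinFree = true) : τ.pos = σ.pos := by
  induction h with
  | seq _ _ ih₁ ih₂ =>
    simp only [RamProg.coinFree, Bool.and_eq_true] at hp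
    rw [ih₂ hp.2, ih₁ hp.1]
  | branch_true _ _ ih =>
    simp only [RamProg.coinFree, Bool.and_eq_true] at hp
    exact ih hp.1
  | branch_false _ _ ih =>
    simp only [RamProg.coinFree, Bool.and_eq_true] at hp
    exact ih hp.2
  | loop_step _ _ _ ih₁ ih₂ => rw [ih₂ hp, ih₁ hp]
  | _ => simp_all [RamState.setReg, RamState.setCell, RamProg.coinFree]

section
variable {ω : ℕ → Bool} {N m : ℕ} {p : RamProg} {σ τ : RamState}

theorem Runs.reg_eq (h : Runs ω N p σ τ m) (v : ℕ) (hv : v ∉ p.modRegs) : τ.reg v = σ.reg v :=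
  h.choose_spec.1.reg_eq hv

theorem Runs.arr_eq (h : Runs ω N p σ τ m) (b : ℕ) (hb : b ∉ p.modArrs) : τ.arr b = σ.arr b :=
  h.choose_spec.1.arr_eq hb

theorem Runs.pos_eq (h : Runs ω N p σ τ m) (hp : p.coinFree = true) : τ.pos = σ.pos :=
  h.choose_spec.1.pos_eq hp

end

theorem RamState.Bdd.setReg {N : ℕ} {σ : RamState} (h : σ.Bdd N) {v a : ℕ} (ha : a ≤ N) :
    (σ.setReg v a).Bdd N := by
  refine ⟨fun u => ?_, h.2⟩
  by_cases hu : u = v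
  · subst hu; simpa [RamState.setReg] using ha
  · simpa [RamState.setReg, hu] using h.1 u

theorem RamState.Bdd.setCell {N : ℕ} {σ : RamState} (h : σ.Bdd N) {b i a : ℕ} (ha : a ≤ N) :
    (σ.setCell b i a).Bdd N := by
  refine ⟨h.1, fun b' i' => ?_⟩
  by_cases hb : b' = b
  · subst hb
    by_cases hi : i' = i
    · subst hi; simpa [RamState.setCell] using ha
    · simpa [RamState.setCell, hi] using h.2 b' i'
  · simpa [RamState.setCell, hb] using h.2 b' i'

section
variable {ω : ℕ → Bool} {N : ℕ}

/-- A loop whose body is executed exactly `c` times; the invariant need not mention what the body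
does not change. -/
theorem Runs.loop_frame (hN : 2 ≤ N) {e : RamExpr} (he : e.Small N) {p : RamProg}
    {σ₀ : RamState} (hσ₀ : σ₀.Bdd N) (I : ℕ → RamState → Prop) (c m : ℕ)
    (hgo : ∀ i, i < c → ∀ σ, σ.Bdd N → (∀ v, v ∉ p.modRegs → σ.reg v = σ₀.reg v) →
      (∀ b, b ∉ p.modArrs → σ.arr b = σ₀.arr b) → I i σ →
      e.eval σ ≠ 0 ∧ ∃ τ, Runs ω N p σ τ m ∧ τ.Bdd N ∧ I (i + 1) τ)
    (hdone : ∀ σ, σ.Bdd N → (∀ v, v ∉ p.modRegs → σ.reg v = σ₀.reg v) →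
      (∀ b, b ∉ p.modArrs → σ.arr b = σ₀.arr b) → I c σ → e.eval σ = 0) (h0 : I 0 σ₀) :
    ∃ τ, Runs ω N (.loop e p) σ₀ τ (c * (m + 1) + 1) ∧ τ.Bdd N ∧ I c τ := by
  obtain ⟨τ, h1, h2, -, -, h3⟩ := Runs.loop hN he (ω := ω) (p := p)
    (fun i σ => σ.Bdd N ∧ (∀ v, v ∉ p.modRegs → σ.reg v = σ₀.reg v) ∧
      (∀ b, b ∉ p.modArrs → σ.arr b = σ₀.arr b) ∧ I i σ) c m (fun i σ h => h.1)
    (fun i hi σ h => (hgo i hi σ h.1 h.2.1 h.2.2.1 h.2.2.2).1)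
    (fun i hi σ h => by
      obtain ⟨-, τ, h1, h2, h3⟩ := hgo i hi σ h.1 h.2.1 h.2.2.1 h.2.2.2
      refine ⟨τ, h1, h2, fun v hv => ?_, fun b hb => ?_, h3⟩
      · rw [h1.reg_eq v hv, h.2.1 v hv]
      · rw [h1.arr_eq b hb, h.2.2.1 b hb])
    (fun σ h => hdone σ h.1 h.2.1 h.2.2.1 h.2.2.2)
    ⟨hσ₀, fun _ _ => rfl, fun _ _ => rfl, h0⟩
  exact ⟨τ, h1, h2, h3⟩

/-- The second program receives the run of the first and not only its postcondition, so that the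
frame properties remain available. -/
theorem Runs.bind {p q : RamProg} {σ : RamState} {m m' : ℕ} {P Q : RamState → Prop}
    (h : ∃ τ, Runs ω N p σ τ m ∧ τ.Bdd N ∧ P τ)
    (h' : ∀ τ, Runs ω N p σ τ m → τ.Bdd N → P τ → ∃ ρ, Runs ω N q τ ρ m' ∧ ρ.Bdd N ∧ Q ρ) :
    ∃ ρ, Runs ω N (.seq p q) σ ρ (m + m') ∧ ρ.Bdd N ∧ Q ρ := by
  obtain ⟨τ, h1, h2, h3⟩ := h
  obtain ⟨ρ, h4, h5, h6⟩ := h' τ h1 h2 h3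
  exact ⟨ρ, h1.seq h4, h5, h6⟩

theorem Runs.weaken {p : RamProg} {σ : RamState} {m m' : ℕ} {P Q : RamState → Prop}
    (h : ∃ τ, Runs ω N p σ τ m ∧ τ.Bdd N ∧ P τ) (hm : m ≤ m')
    (h' : ∀ τ, Runs ω N p σ τ m → τ.Bdd N → P τ → Q τ) :
    ∃ τ, Runs ω N p σ τ m' ∧ τ.Bdd N ∧ Q τ := by
  obtain ⟨τ, h1, h2, h3⟩ := h
  exact ⟨τ, h1.mono hm, h2, h' τ h1 h2 h3⟩

theorem Runs.assign_spec (hN : 2 ≤ N) {σ : RamState} (hσ : σ.Bdd N) {v : ℕ} {e : RamExpr}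
    (he : e.Small N) (hle : e.eval σ ≤ N) {P : RamState → Prop}
    (h : P (σ.setReg v (e.eval σ))) : ∃ τ, Runs ω N (.assign v e) σ τ 1 ∧ τ.Bdd N ∧ P τ :=
  ⟨_, Runs.assign hN hσ he, hσ.setReg hle, h⟩

theorem Runs.write_spec (hN : 2 ≤ N) {σ : RamState} (hσ : σ.Bdd N) {b : ℕ} {i e : RamExpr}
    (hi : i.Small N) (he : e.Small N) (hle : e.eval σ ≤ N) {P : RamState → Prop}
    (h : P (σ.setCell b (i.eval σ) (e.eval σ))) :
    ∃ τ, Runs ω N (.write b i e) σ τ 1 ∧ τ.Bdd N ∧ P τ :=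
  ⟨_, Runs.write hN hσ hi he, hσ.setCell hle, h⟩

/-! ### Arithmetic subroutines -/

/-- `dst := Nat.size e`; register 22 is scratch. -/
def sizeProg (e : RamExpr) (dst : ℕ) : RamProg :=
  .seq (.assign 22 e) (.seq (.assign dst (.const 0))
    (.loop (.reg 22) (.seq (.assign 22 (.op .div (.reg 22) (.const 2)))
      (.assign dst (.op .add (.reg dst) (.const 1))))))

/-- `dst := 2 ^ e`; register 22 is scratch. -/
def powProg (e : RamExpr) (dst : ℕ) : RamProg :=
  .seq (.assign 22 e) (.seq (.assign dst (.const 1))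
    (.loop (.reg 22) (.seq (.assign dst (.op .mul (.const 2) (.reg dst)))
      (.assign 22 (.op .sub (.reg 22) (.const 1))))))

theorem Nat.size_le_self (m : ℕ) : m.size ≤ m := by
  rw [Nat.size_le]; exact Nat.lt_two_pow_self

/-- Halving `u` reaches zero for the first time after exactly `u.size` steps. -/
theorem sizeProg_spec (hN : 2 ≤ N) {σ : RamState} (hσ : σ.Bdd N) {e : RamExpr} (he : e.Small N)
    (hle : e.eval σ ≤ N) {dst : ℕ} (hd : dst ≠ 22) :
    ∃ τ, Runs ω N (sizeProg e dst) σ τ (1 + (1 + ((e.eval σ).size * 3 + 1))) ∧ τ.Bdd N ∧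
      τ.reg dst = (e.eval σ).size := by
  set u := e.eval σ with hu
  refine Runs.bind (P := fun τ => τ.reg 22 = u) (Runs.assign_spec hN hσ he hle
    (by simp [RamState.setReg, hu])) fun τ _ hτ h22 => ?_
  refine Runs.bind (P := fun τ => τ.reg 22 = u ∧ τ.reg dst = 0) (Runs.assign_spec hN hτ
    ⟨by simp [RamExpr.nodes], by simp [RamExpr.ConstsLE]⟩ (by simp [RamExpr.eval])
    (by simp [RamState.setReg, RamExpr.eval, Function.update, h22, Ne.symm hd]))
    fun τ _ hτ h => ?_
  refine Runs.weaken (Runs.loop_frame hN ⟨by simp [RamExpr.nodes], by simp [RamExpr.ConstsLE]⟩ hτ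
    (fun i σ => σ.reg 22 = u / 2 ^ i ∧ σ.reg dst = i) u.size 2 ?_ ?_ (by simpa using h)) (by omega)
    fun τ _ _ h => h.2
  · rintro i hi σ hσ - - ⟨h1, h2⟩
    have hi2 := (Nat.lt_size.1 hi)
    have hsz := u.size_le_self
    refine ⟨?_, ?_⟩
    · simp only [RamExpr.eval, h1]
      exact (Nat.div_pos hi2 (by positivity)).ne'
    refine Runs.bind (m := 1) (m' := 1)
      (P := fun τ => τ.reg 22 = u / 2 ^ (i + 1) ∧ τ.reg dst = i)
      (Runs.assign_spec hN hσ
      ⟨by simp [RamExpr.nodes], by simp [RamExpr.ConstsLE, hN]⟩ ?_ ?_) fun τ _ hτ h => ?_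
    · exact (Nat.div_le_self _ _).trans (hσ.1 22)
    · simp [RamState.setReg, RamExpr.eval, ArithOp.eval, Function.update, hd, h1, h2,
        Nat.div_div_eq_div_mul, pow_succ]
    refine Runs.assign_spec hN hτ
      ⟨by simp [RamExpr.nodes], by simp [RamExpr.ConstsLE]; omega⟩ ?_ ?_
    · simp [RamExpr.eval, ArithOp.eval, h.2]; omega
    · simp [RamState.setReg, RamExpr.eval, ArithOp.eval, Function.update, Ne.symm hd, h]
  · rintro σ hσ - - ⟨h1, h2⟩
    simp only [RamExpr.eval, h1]
    exact Nat.div_eq_of_lt u.lt_size_self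

theorem powProg_spec (hN : 2 ≤ N) {σ : RamState} (hσ : σ.Bdd N) {e : RamExpr} (he : e.Small N)
    (hle : 2 ^ e.eval σ ≤ N) {dst : ℕ} (hd : dst ≠ 22) :
    ∃ τ, Runs ω N (powProg e dst) σ τ (1 + (1 + ((e.eval σ) * 3 + 1))) ∧ τ.Bdd N ∧
      τ.reg dst = 2 ^ e.eval σ := by
  set u := e.eval σ with hu
  have huN : u ≤ N := Nat.lt_two_pow_self.le.trans hle
  refine Runs.bind (P := fun τ => τ.reg 22 = u) (Runs.assign_spec hN hσ he huN
    (by simp [RamState.setReg, hu])) fun τ _ hτ h22 => ?_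
  refine Runs.bind (P := fun τ => τ.reg 22 = u ∧ τ.reg dst = 1) (Runs.assign_spec hN hτ
    ⟨by simp [RamExpr.nodes], by simp [RamExpr.ConstsLE]; omega⟩ (by simp [RamExpr.eval]; omega)
    (by simp [RamState.setReg, RamExpr.eval, Function.update, h22, Ne.symm hd]))
    fun τ _ hτ h => ?_
  refine Runs.weaken (Runs.loop_frame hN ⟨by simp [RamExpr.nodes], by simp [RamExpr.ConstsLE]⟩ hτ
    (fun i σ => σ.reg 22 = u - i ∧ σ.reg dst = 2 ^ i) u 2 ?_ ?_ (by simpa using h)) (by omega)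
    fun τ _ _ h => h.2
  · rintro i hi σ hσ - - ⟨h1, h2⟩
    refine ⟨?_, ?_⟩
    · simp only [RamExpr.eval, h1]; omega
    have hpow : 2 ^ (i + 1) ≤ N := (Nat.pow_le_pow_right (by norm_num) hi).trans hle
    refine Runs.bind (m := 1) (m' := 1)
      (P := fun τ => τ.reg 22 = u - i ∧ τ.reg dst = 2 ^ (i + 1))
      (Runs.assign_spec hN hσ
      ⟨by simp [RamExpr.nodes], by simp [RamExpr.ConstsLE, hN]⟩ ?_ ?_) fun τ _ hτ h => ?_
    · simp only [RamExpr.eval, ArithOp.eval, h2]; rw [pow_succ] at hpow; omega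
    · simp [RamState.setReg, RamExpr.eval, ArithOp.eval, Function.update, Ne.symm hd, h1, h2,
        pow_succ, mul_comm]
    refine Runs.assign_spec hN hτ
      ⟨by simp [RamExpr.nodes], by simp [RamExpr.ConstsLE]; omega⟩ ?_ ?_
    · simp [RamExpr.eval, ArithOp.eval, h.1]; omega
    · simp [RamState.setReg, RamExpr.eval, ArithOp.eval, Function.update, hd, h]; omega
  · rintro σ hσ - - ⟨h1, h2⟩
    simp [RamExpr.eval, h1]

/-- The number of leading entries of `k` that are at least `q`. -/
noncomputable def actCount (k : ℕ → ℕ) (q : ℕ) : ℕ := sInf {i | k i < q}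

/-- The sum of the leading entries of `s` whose companions in `k` are at least `q`. -/
noncomputable def actSum (s k : ℕ → ℕ) (q : ℕ) : ℕ := ∑ i ∈ Finset.range (actCount k q), s i

/-- `i := actCount k q` and `acc := actSum s k q` for `q` in register 8. -/
def scanProg (i acc : ℕ) : RamProg :=
  .seq (.assign i (.const 0)) (.seq (.assign acc (.const 0))
    (.loop (.op .lt (.reg 8) (.op .add (.cell 2 (.reg i)) (.const 1)))
      (.seq (.assign acc (.op .add (.reg acc) (.cell 1 (.reg i))))
        (.assign i (.op .add (.reg i) (.const 1))))))

/-- The test `q < k i + 1` means `q ≤ k i`. By `hz` the infimum in `actCount` is attained, so the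
scan stops there; partial sums are bounded by the final one and stay below `N`. -/
theorem scanProg_spec (hN : 2 ≤ N) {σ : RamState} (hσ : σ.Bdd N) {i acc : ℕ} (hia : i ≠ acc)
    (hi8 : i ≠ 8) (ha8 : acc ≠ 8) (hz : ∃ j, σ.arr 2 j < σ.reg 8)
    (hc : actCount (σ.arr 2) (σ.reg 8) ≤ N) (hs : actSum (σ.arr 1) (σ.arr 2) (σ.reg 8) ≤ N) :
    ∃ τ, Runs ω N (scanProg i acc) σ τ (1 + (1 + (actCount (σ.arr 2) (σ.reg 8) * 3 + 1))) ∧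
      τ.Bdd N ∧ τ.reg i = actCount (σ.arr 2) (σ.reg 8) ∧
      τ.reg acc = actSum (σ.arr 1) (σ.arr 2) (σ.reg 8) := by
  set q := σ.reg 8 with hq
  set k := σ.arr 2 with hk
  set s := σ.arr 1 with hss
  refine Runs.bind (P := fun τ => τ.reg i = 0 ∧ τ.reg 8 = q ∧ τ.arr 2 = k ∧ τ.arr 1 = s)
    (Runs.assign_spec hN hσ
    ⟨by simp [RamExpr.nodes], by simp [RamExpr.ConstsLE]⟩ (by simp [RamExpr.eval])
    (by simp [RamState.setReg, RamExpr.eval, Function.update, Ne.symm hi8, hq, hk, hss]))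
    fun τ _ hτ h => ?_
  refine Runs.bind
    (P := fun τ => τ.reg acc = 0 ∧ τ.reg i = 0 ∧ τ.reg 8 = q ∧ τ.arr 2 = k ∧ τ.arr 1 = s)
    (Runs.assign_spec hN hτ
    ⟨by simp [RamExpr.nodes], by simp [RamExpr.ConstsLE]⟩ (by simp [RamExpr.eval])
    (by simp [RamState.setReg, RamExpr.eval, Function.update, Ne.symm ha8, hia, h]))
    fun τ _ hτ h => ?_
  obtain ⟨h1, h2, h3, h4, h5⟩ := h
  refine Runs.weaken (Runs.loop_frame hN
    ⟨by simp [RamExpr.nodes], by simp [RamExpr.ConstsLE]; omega⟩ hτ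
    (fun j σ => σ.reg i = j ∧ σ.reg acc = ∑ l ∈ Finset.range j, s l) (actCount k q) 2 ?_ ?_
    (by simp [h1, h2])) (by omega) fun τ _ _ h => h
  · rintro j hj σ hσ hr ha ⟨g1, g2⟩
    have e8 : σ.reg 8 = q := by
      rw [hr 8 (by simp [RamProg.modRegs, Ne.symm hi8, Ne.symm ha8]), h3]
    have e2 : σ.arr 2 = k := by rw [ha 2 (by simp [RamProg.modArrs]), h4]
    have e1 : σ.arr 1 = s := by rw [ha 1 (by simp [RamProg.modArrs]), h5]
    have hkj : q ≤ k j := by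
      by_contra hlt
      exact absurd (Nat.sInf_le (s := {i | k i < q}) (by simpa using hlt)) (not_le.2 hj)
    have hsum : ∑ l ∈ Finset.range (j + 1), s l ≤ N :=
      (Finset.sum_le_sum_of_subset (Finset.range_mono hj)).trans hs
    refine ⟨by simp only [RamExpr.eval, ArithOp.eval, e8, e2, g1]; rw [if_pos] <;> omega, ?_⟩
    refine Runs.bind (m := 1) (m' := 1)
      (P := fun τ => τ.reg acc = ∑ l ∈ Finset.range (j + 1), s l ∧ τ.reg i = j)
      (Runs.assign_spec hN hσ
      ⟨by simp [RamExpr.nodes], by simp [RamExpr.ConstsLE]⟩ ?_ ?_) fun τ _ hτ h => ?_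
    · rw [Finset.sum_range_succ] at hsum
      simpa [RamExpr.eval, ArithOp.eval, g1, g2, e1] using hsum
    · simp [RamState.setReg, RamExpr.eval, ArithOp.eval, Function.update, hia, g1, g2, e1,
        Finset.sum_range_succ]
    refine Runs.assign_spec hN hτ
      ⟨by simp [RamExpr.nodes], by simp [RamExpr.ConstsLE]; omega⟩ ?_ ?_
    · simp [RamExpr.eval, ArithOp.eval, h.2]; omega
    · simp [RamState.setReg, RamExpr.eval, ArithOp.eval, Function.update, Ne.symm hia, h]
  · rintro σ hσ hr ha ⟨g1, g2⟩
    have e8 : σ.reg 8 = q := by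
      rw [hr 8 (by simp [RamProg.modRegs, Ne.symm hi8, Ne.symm ha8]), h3]
    have e2 : σ.arr 2 = k := by rw [ha 2 (by simp [RamProg.modArrs]), h4]
    have : k (actCount k q) < q := Nat.sInf_mem (s := {i | k i < q}) hz
    simp only [RamExpr.eval, ArithOp.eval, e8, e2, g1]
    rw [if_neg]; omega

end

/-! ### One table -/

/-- The number whose binary digits are the `b` bits of the tape from position `p` on. -/
def coinNum (ω : ℕ → Bool) (p : ℕ) : ℕ → ℕ
  | 0 => 0
  | b + 1 => 2 * coinNum ω p b + (ω (p + b)).toNat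

theorem coinNum_lt (ω : ℕ → Bool) (p b : ℕ) : coinNum ω p b < 2 ^ b := by
  induction b with
  | zero => simp [coinNum]
  | succ b ih =>
    have := Bool.toNat_le (ω (p + b))
    simp only [coinNum, pow_succ]; omega

/-- The cell assigned to position `j`: `b` fresh coins in mode `0`; `j` itself in mode `1`, where
`b = 0`. -/
def hashVal (ω : ℕ → Bool) (b mode p j : ℕ) : ℕ := 2 ^ b * (mode * j) + coinNum ω (p + j * b) b

/-- Contents of the table array after the entries of `z` have been added, modulo two, to the cells
assigned to them. -/
def toggle (ω : ℕ → Bool) (n off b mode p : ℕ) (z A : ℕ → ℕ) : ℕ → ℕ := fun c =>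
  (A c + ∑ j ∈ Finset.range n, if off + hashVal ω b mode p j = c then z j else 0) % 2

/-- Register 19 starts at `mode * j` and is doubled with a fresh coin added, once per bit. The same
loop thus produces both the random hash and, with `b = 0` and `mode = 1`, the identity. -/
def hashProg : RamProg :=
  .seq (.assign 19 (.op .mul (.reg 16) (.reg 18))) (.seq (.assign 20 (.reg 15))
    (.loop (.reg 20) (.seq (.coin 21)
      (.seq (.assign 19 (.op .add (.op .mul (.const 2) (.reg 19)) (.reg 21)))
        (.assign 20 (.op .sub (.reg 20) (.const 1)))))))

/-- Array 7 remembers the cell of each position, so the later count consumes no coins. -/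
def rowProg : RamProg :=
  .seq hashProg (.seq (.write 7 (.reg 18) (.reg 19))
    (.seq (.write 4 (.op .add (.reg 2) (.reg 19))
      (.op .mod (.op .add (.cell 4 (.op .add (.reg 2) (.reg 19))) (.cell 0 (.reg 18))) (.const 2)))
    (.assign 18 (.op .add (.reg 18) (.const 1)))))

def toggleProg : RamProg :=
  .seq (.assign 18 (.const 0)) (.loop (.op .lt (.reg 18) (.reg 0)) rowProg)

/-- A separate pass is needed because the parity of a cell is final only after all positions have
been added. -/
def countProg : RamProg :=
  .seq (.assign 18 (.const 0)) (.loop (.op .lt (.reg 18) (.reg 0))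
    (.seq (.write 6 (.reg 18) (.op .add (.cell 6 (.reg 18))
        (.cell 4 (.op .add (.reg 2) (.cell 7 (.reg 18))))))
      (.assign 18 (.op .add (.reg 18) (.const 1)))))

def clearProg : RamProg :=
  .seq (.assign 18 (.const 0)) (.loop (.op .lt (.reg 18) (.reg 0))
    (.seq (.write 6 (.reg 18) (.const 0)) (.assign 18 (.op .add (.reg 18) (.const 1)))))

def tableProg : RamProg :=
  .seq toggleProg (.seq countProg (.seq (.assign 2 (.op .add (.reg 2) (.reg 14)))
    (.assign 17 (.op .sub (.reg 17) (.const 1)))))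

section
variable {ω : ℕ → Bool} {N : ℕ}

theorem hashProg_spec (hN : 2 ≤ N) {σ : RamState} (hσ : σ.Bdd N)
    (hb : 2 ^ σ.reg 15 * (σ.reg 16 * σ.reg 18) + 2 ^ σ.reg 15 ≤ N) :
    ∃ τ, Runs ω N hashProg σ τ (1 + (1 + (σ.reg 15 * 4 + 1))) ∧ τ.Bdd N ∧
      (τ.reg 19 = 2 ^ σ.reg 15 * (σ.reg 16 * σ.reg 18) + coinNum ω σ.pos (σ.reg 15) ∧
      τ.pos = σ.pos + σ.reg 15) := by
  set b := σ.reg 15 with hb15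
  set x := σ.reg 16 * σ.reg 18 with hx
  have hxN : x ≤ N := by
    have : x ≤ 2 ^ b * x := Nat.le_mul_of_pos_left _ (by positivity)
    exact this.trans ((Nat.le_add_right _ _).trans hb)
  refine Runs.bind (P := fun τ => τ.reg 19 = x ∧ τ.reg 15 = b ∧ τ.pos = σ.pos)
    (Runs.assign_spec hN hσ
    ⟨by simp [RamExpr.nodes], by simp [RamExpr.ConstsLE]⟩ (by simpa [RamExpr.eval, ArithOp.eval] using hxN)
    (by simp [RamState.setReg, RamExpr.eval, Function.update, ArithOp.eval, ← hb15, ← hx]))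
    fun τ _ hτ h => ?_
  refine Runs.bind (P := fun τ => τ.reg 19 = x ∧ τ.reg 20 = b ∧ τ.pos = σ.pos)
    (Runs.assign_spec hN hτ
    ⟨by simp [RamExpr.nodes], by simp [RamExpr.ConstsLE]⟩ (by simpa [RamExpr.eval] using hτ.1 15)
    (by simp [RamState.setReg, RamExpr.eval, Function.update, h]))
    fun τ _ hτ h => ?_
  refine Runs.weaken (Runs.loop_frame hN ⟨by simp [RamExpr.nodes], by simp [RamExpr.ConstsLE]⟩ hτ
    (fun i τ => τ.reg 19 = 2 ^ i * x + coinNum ω σ.pos i ∧ τ.reg 20 = b - i ∧ τ.pos = σ.pos + i)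
    b 3 ?_ ?_ (by simpa [coinNum] using h)) (by omega) fun τ _ _ h => ⟨h.1, h.2.2⟩
  · rintro i hi σ' hσ' - - ⟨h1, h2, h3⟩
    have hlt := coinNum_lt ω σ.pos (i + 1)
    have hle : 2 ^ (i + 1) * x + 2 ^ (i + 1) ≤ N := by
      have h2 : 2 ^ (i + 1) ≤ 2 ^ b := Nat.pow_le_pow_right (by norm_num) hi
      have := Nat.mul_le_mul_right x h2
      omega
    refine ⟨by simp only [RamExpr.eval, h2]; omega, ?_⟩
    have hc := Bool.toNat_le (ω σ'.pos)
    refine Runs.bind (m := 1) (m' := 2) (P := fun τ => τ.reg 19 = 2 ^ i * x + coinNum ω σ.pos i ∧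
        τ.reg 20 = b - i ∧ τ.pos = σ.pos + (i + 1) ∧ τ.reg 21 = (ω (σ.pos + i)).toNat)
      ⟨_, Runs.coin 21 σ', hσ'.setReg (hc.trans (by omega)), ?_⟩ fun τ _ hτ h => ?_
    · simp [RamState.setReg, Function.update, h1, h2, h3, add_assoc]
    obtain ⟨h1, h2, h3, h4⟩ := h
    have e : 2 * τ.reg 19 + τ.reg 21 = 2 ^ (i + 1) * x + coinNum ω σ.pos (i + 1) := by
      rw [h1, h4, coinNum, pow_succ]; ring
    refine Runs.bind (m := 1) (m' := 1) (P := fun τ => τ.reg 19 = 2 ^ (i + 1) * x +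
        coinNum ω σ.pos (i + 1) ∧ τ.reg 20 = b - i ∧ τ.pos = σ.pos + (i + 1))
      (Runs.assign_spec hN hτ ⟨by simp [RamExpr.nodes], by simp [RamExpr.ConstsLE, hN]⟩ ?_ ?_)
      fun τ _ hτ h => ?_
    · simp only [RamExpr.eval, ArithOp.eval, e]; omega
    · simp [RamState.setReg, RamExpr.eval, ArithOp.eval, Function.update, e, h2, h3]
    refine Runs.assign_spec hN hτ
      ⟨by simp [RamExpr.nodes], by simp [RamExpr.ConstsLE]; omega⟩ ?_ ?_
    · simp only [RamExpr.eval, ArithOp.eval]; have := hτ.1 20; omega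
    · simp [RamState.setReg, RamExpr.eval, ArithOp.eval, Function.update, h]; omega
  · rintro σ hσ - - ⟨h1, h2, -⟩
    simp [RamExpr.eval, h2]

theorem toggleProg_spec (hN : 2 ≤ N) {σ : RamState} (hσ : σ.Bdd N)
    (hb : ∀ j < σ.reg 0, 2 ^ σ.reg 15 * (σ.reg 16 * j) + 2 ^ σ.reg 15 ≤ N)
    (hA : ∀ c, σ.arr 4 c < 2) :
    ∃ τ, Runs ω N toggleProg σ τ (1 + (σ.reg 0 * (4 * σ.reg 15 + 7) + 1)) ∧ τ.Bdd N ∧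
      (τ.pos = σ.pos + σ.reg 0 * σ.reg 15 ∧
      (∀ j < σ.reg 0, τ.arr 7 j = hashVal ω (σ.reg 15) (σ.reg 16) σ.pos j) ∧
      τ.arr 4 = toggle ω (σ.reg 0) (σ.reg 2) (σ.reg 15) (σ.reg 16) σ.pos (σ.arr 0) (σ.arr 4)) := by
  set b := σ.reg 15 with hb15
  set mode := σ.reg 16 with h16
  set n := σ.reg 0 with hn0
  set off := σ.reg 2 with hoff
  set z := σ.arr 0 with hz
  set A := σ.arr 4 with hA4
  set p := σ.pos with hp
  refine Runs.bind (P := fun τ => τ.reg 18 = 0 ∧ τ.arr 4 = A ∧ τ.reg 15 = b ∧ τ.reg 16 = mode ∧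
      τ.reg 0 = n ∧ τ.reg 2 = off ∧ τ.arr 0 = z ∧ τ.pos = p)
    (Runs.assign_spec hN hσ
    ⟨by simp [RamExpr.nodes], by simp [RamExpr.ConstsLE]⟩ (by simp [RamExpr.eval])
    (by simp [RamState.setReg, RamExpr.eval, Function.update, ← hb15, ← h16, ← hn0, ← hoff, ← hz,
      ← hA4, ← hp])) fun τ₀ _ hτ₀ h => ?_
  obtain ⟨a1, a2, a3, a4, a5, a6, a7, a8⟩ := h
  have hnN : n ≤ N := hσ.1 0
  refine Runs.weaken (Runs.loop_frame hN ⟨by simp [RamExpr.nodes], by simp [RamExpr.ConstsLE]⟩ hτ₀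
    (fun i τ => τ.reg 18 = i ∧ τ.pos = p + i * b ∧
      (∀ j < i, τ.arr 7 j = hashVal ω b mode p j) ∧ τ.arr 4 = toggle ω i off b mode p z A)
    n (4 * b + 6) ?_ ?_ ?_) le_rfl
    fun τ _ _ h => ⟨h.2.1, h.2.2⟩
  · rintro i hi σ₁ hσ₁ hr ha ⟨h1, h2, h3, h4⟩
    have e15 : σ₁.reg 15 = b := by rw [hr 15 (by decide), a3]
    have e16 : σ₁.reg 16 = mode := by rw [hr 16 (by decide), a4]
    have e0 : σ₁.reg 0 = n := by rw [hr 0 (by decide), a5]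
    have e2 : σ₁.reg 2 = off := by rw [hr 2 (by decide), a6]
    have ez : σ₁.arr 0 = z := by rw [ha 0 (by decide), a7]
    refine ⟨by simp [RamExpr.eval, ArithOp.eval, e0, h1, hi], ?_⟩
    obtain ⟨τ, g1, g2, g3, g4⟩ := hashProg_spec (ω := ω) hN hσ₁
      (by rw [e15, e16, h1]; exact hb i hi)
    rw [e15, e16, h1, h2] at g3
    rw [e15, h2] at g4
    rw [e15] at g1
    have g3' : τ.reg 19 = hashVal ω b mode p i := by rw [g3, hashVal]
    have k18 : τ.reg 18 = i := by rw [g1.reg_eq 18 (by decide), h1]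
    have k2 : τ.reg 2 = off := by rw [g1.reg_eq 2 (by decide), e2]
    have kz : τ.arr 0 = z := by rw [g1.arr_eq 0 (by decide), ez]
    have k4 : τ.arr 4 = toggle ω i off b mode p z A := by rw [g1.arr_eq 4 (by decide), h4]
    have k7 : τ.arr 7 = σ₁.arr 7 := g1.arr_eq 7 (by decide)
    refine Runs.weaken (Runs.bind (P := fun ρ => ρ = τ) ⟨τ, g1, g2, rfl⟩ (m' := 3)
      fun ρ _ _ hρ => ?_) (by omega) fun τ _ _ h => h
    subst hρ
    refine Runs.bind (m := 1) (m' := 2) (P := fun τ => τ.reg 19 = hashVal ω b mode p i ∧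
        τ.reg 18 = i ∧ τ.reg 2 = off ∧ τ.arr 0 = z ∧ τ.arr 4 = toggle ω i off b mode p z A ∧
        τ.pos = p + i * b + b ∧ ∀ j < i + 1, τ.arr 7 j = hashVal ω b mode p j)
      (Runs.write_spec hN g2 ⟨by simp [RamExpr.nodes], by simp [RamExpr.ConstsLE]⟩
        ⟨by simp [RamExpr.nodes], by simp [RamExpr.ConstsLE]⟩ (by simpa [RamExpr.eval] using g2.1 19) ?_) fun τ _ hτ h => ?_
    · refine ⟨g3', k18, k2, by simp [RamState.setCell, kz], by simp [RamState.setCell, k4], g4, ?_⟩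
      intro j hj
      simp only [RamState.setCell, RamExpr.eval, k18, Function.update_self]
      by_cases hji : j = i
      · subst hji; simp [g3']
      · rw [Function.update_of_ne hji, k7, h3 j (by omega)]
    obtain ⟨f1, f2, f3, f4, f5, f6, f7⟩ := h
    refine Runs.bind (m := 1) (m' := 1) (P := fun τ => τ.reg 18 = i ∧
        τ.arr 4 = toggle ω (i + 1) off b mode p z A ∧
        τ.pos = p + i * b + b ∧ ∀ j < i + 1, τ.arr 7 j = hashVal ω b mode p j)
      (Runs.write_spec hN hτ ⟨by simp [RamExpr.nodes], by simp [RamExpr.ConstsLE]⟩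
        ⟨by simp [RamExpr.nodes], by simp [RamExpr.ConstsLE, hN]⟩ ?_ ?_) fun τ _ hτ h => ?_
    · simp only [RamExpr.eval, ArithOp.eval]
      exact (Nat.mod_lt _ (by norm_num)).le.trans hN
    · refine ⟨f2, ?_, f6, by simpa [RamState.setCell] using f7⟩
      funext c
      simp only [RamState.setCell, RamExpr.eval, ArithOp.eval, f1, f2, f3, f4, f5,
        Function.update_self, toggle, Finset.sum_range_succ]
      by_cases hc : c = off + hashVal ω b mode p i
      · subst hc
        simp only [Function.update_self, if_true]
        omega
      · rw [Function.update_of_ne hc, if_neg (Ne.symm hc)]; simp [toggle]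
    · refine Runs.assign_spec hN hτ
        ⟨by simp [RamExpr.nodes], by simp [RamExpr.ConstsLE]; omega⟩ ?_ ?_
      · simp only [RamExpr.eval, ArithOp.eval, h.1]; omega
      · simp only [RamState.setReg, RamExpr.eval, ArithOp.eval, Function.update_self, h]
        exact ⟨trivial, by ring, h.2.2.2, trivial⟩
  · rintro σ₁ hσ₁ hr ha ⟨h1, -⟩
    have e0 : σ₁.reg 0 = n := by rw [hr 0 (by decide), a5]
    simp [RamExpr.eval, ArithOp.eval, e0, h1]
  -- With no row processed, `toggle` reads `A c % 2`, which is `A c` because the array holds bits.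
  · refine ⟨a1, by simp [a8], by simp, ?_⟩
    rw [a2]; funext c
    simp [toggle, Nat.mod_eq_of_lt (hA c)]

theorem countProg_spec (hN : 2 ≤ N) {σ : RamState} (hσ : σ.Bdd N) {D : ℕ} (hD : D < N)
    (hA : ∀ c, σ.arr 4 c < 2) (hc : ∀ j < σ.reg 0, σ.arr 6 j ≤ D) :
    ∃ τ, Runs ω N countProg σ τ (1 + (σ.reg 0 * 3 + 1)) ∧ τ.Bdd N ∧
      ∀ j < σ.reg 0, τ.arr 6 j = σ.arr 6 j + σ.arr 4 (σ.reg 2 + σ.arr 7 j) := by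
  set n := σ.reg 0 with hn0
  refine Runs.bind (P := fun τ => τ.reg 18 = 0 ∧ τ.arr 4 = σ.arr 4 ∧ τ.arr 6 = σ.arr 6 ∧
      τ.arr 7 = σ.arr 7 ∧ τ.reg 0 = n ∧ τ.reg 2 = σ.reg 2)
    (Runs.assign_spec hN hσ
    ⟨by simp [RamExpr.nodes], by simp [RamExpr.ConstsLE]⟩ (by simp [RamExpr.eval])
    (by simp [RamState.setReg, RamExpr.eval, Function.update, ← hn0])) fun τ₀ _ hτ₀ h => ?_
  obtain ⟨a1, a2, a3, a4, a5, a6⟩ := h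
  have hnN : n ≤ N := hσ.1 0
  refine Runs.weaken (Runs.loop_frame hN ⟨by simp [RamExpr.nodes], by simp [RamExpr.ConstsLE]⟩ hτ₀
    (fun i τ => τ.reg 18 = i ∧ ∀ j, τ.arr 6 j = σ.arr 6 j +
      if j < i then σ.arr 4 (σ.reg 2 + σ.arr 7 j) else 0)
    n 2 ?_ ?_ ?_) (by omega) fun τ _ _ h j hj => by rw [h.2 j, if_pos hj]
  · rintro i hi σ₁ hσ₁ hr ha ⟨h1, h2⟩
    have e0 : σ₁.reg 0 = n := by rw [hr 0 (by decide), a5]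
    have e2 : σ₁.reg 2 = σ.reg 2 := by rw [hr 2 (by decide), a6]
    have e4 : σ₁.arr 4 = σ.arr 4 := by rw [ha 4 (by decide), a2]
    have e7 : σ₁.arr 7 = σ.arr 7 := by rw [ha 7 (by decide), a4]
    refine ⟨by simp [RamExpr.eval, ArithOp.eval, e0, h1, hi], ?_⟩
    refine Runs.bind (m := 1) (m' := 1) (P := fun τ => τ.reg 18 = i ∧ ∀ j, τ.arr 6 j = σ.arr 6 j +
      if j < i + 1 then σ.arr 4 (σ.reg 2 + σ.arr 7 j) else 0)
      (Runs.write_spec hN hσ₁ ⟨by simp [RamExpr.nodes], by simp [RamExpr.ConstsLE]⟩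
        ⟨by simp [RamExpr.nodes], by simp [RamExpr.ConstsLE]⟩ ?_ ?_) fun τ _ hτ h => ?_
    · simp only [RamExpr.eval, ArithOp.eval, h1, h2, e2, e4, e7, lt_irrefl, if_false]
      have := hc i hi
      have := hA (σ.reg 2 + σ.arr 7 i)
      omega
    · refine ⟨h1, fun j => ?_⟩
      simp only [RamState.setCell, RamExpr.eval, ArithOp.eval, h1, e2, e4, e7,
        Function.update_self]
      by_cases hj : j = i
      · subst hj; simp [h2]
      · rw [Function.update_of_ne hj, h2]
        simp only [show j < i + 1 ↔ j < i by omega]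
    · refine Runs.assign_spec hN hτ
        ⟨by simp [RamExpr.nodes], by simp [RamExpr.ConstsLE]; omega⟩ ?_ ?_
      · simp only [RamExpr.eval, ArithOp.eval, h.1]; omega
      · simpa [RamState.setReg, RamExpr.eval, ArithOp.eval, h.1] using h.2
  · rintro σ₁ hσ₁ hr ha ⟨h1, -⟩
    have e0 : σ₁.reg 0 = n := by rw [hr 0 (by decide), a5]
    simp [RamExpr.eval, ArithOp.eval, e0, h1]
  · exact ⟨a1, by simp [a3]⟩

theorem clearProg_spec (hN : 2 ≤ N) {σ : RamState} (hσ : σ.Bdd N) :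
    ∃ τ, Runs ω N clearProg σ τ (1 + (σ.reg 0 * 3 + 1)) ∧ τ.Bdd N ∧
      ∀ j < σ.reg 0, τ.arr 6 j = 0 := by
  set n := σ.reg 0 with hn0
  refine Runs.bind (P := fun τ => τ.reg 18 = 0 ∧ τ.reg 0 = n)
    (Runs.assign_spec hN hσ
    ⟨by simp [RamExpr.nodes], by simp [RamExpr.ConstsLE]⟩ (by simp [RamExpr.eval])
    (by simp [RamState.setReg, RamExpr.eval, Function.update, ← hn0])) fun τ₀ _ hτ₀ h => ?_
  obtain ⟨a1, a5⟩ := h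
  have hnN : n ≤ N := hσ.1 0
  refine Runs.weaken (Runs.loop_frame hN ⟨by simp [RamExpr.nodes], by simp [RamExpr.ConstsLE]⟩ hτ₀
    (fun i τ => τ.reg 18 = i ∧ ∀ j < i, τ.arr 6 j = 0)
    n 2 ?_ ?_ ⟨a1, by simp⟩) (by omega) fun τ _ _ h => h.2
  · rintro i hi σ₁ hσ₁ hr ha ⟨h1, h2⟩
    have e0 : σ₁.reg 0 = n := by rw [hr 0 (by decide), a5]
    refine ⟨by simp [RamExpr.eval, ArithOp.eval, e0, h1, hi], ?_⟩
    refine Runs.bind (m := 1) (m' := 1) (P := fun τ => τ.reg 18 = i ∧ ∀ j < i + 1, τ.arr 6 j = 0)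
      (Runs.write_spec hN hσ₁ ⟨by simp [RamExpr.nodes], by simp [RamExpr.ConstsLE]⟩
        ⟨by simp [RamExpr.nodes], by simp [RamExpr.ConstsLE]⟩ (by simp [RamExpr.eval]) ?_)
      fun τ _ hτ h => ?_
    · refine ⟨h1, fun j hj => ?_⟩
      simp only [RamState.setCell, RamExpr.eval, h1, Function.update_self]
      by_cases hji : j = i
      · subst hji; simp
      · rw [Function.update_of_ne hji, h2 j (by omega)]
    · refine Runs.assign_spec hN hτ
        ⟨by simp [RamExpr.nodes], by simp [RamExpr.ConstsLE]; omega⟩ ?_ ?_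
      · simp only [RamExpr.eval, ArithOp.eval, h.1]; omega
      · simpa [RamState.setReg, RamExpr.eval, ArithOp.eval, h.1] using h.2
  · rintro σ₁ hσ₁ hr ha ⟨h1, -⟩
    have e0 : σ₁.reg 0 = n := by rw [hr 0 (by decide), a5]
    simp [RamExpr.eval, ArithOp.eval, e0, h1]

theorem toggle_lt_two (n off b mode p : ℕ) (z A : ℕ → ℕ) (c : ℕ) :
    toggle ω n off b mode p z A c < 2 := Nat.mod_lt _ (by norm_num)

end

/-! ### One level -/

/-- The table array after `τ` tables of width `w`. -/
def tableSeq (ω : ℕ → Bool) (n w b mode off p : ℕ) (z A : ℕ → ℕ) : ℕ → ℕ → ℕ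
  | 0 => A
  | τ + 1 => toggle ω n (off + τ * w) b mode (p + τ * (n * b)) z
      (tableSeq ω n w b mode off p z A τ)

/-- The number of tables among the first `d` in which the cell of `j` is odd. -/
def oddCount (ω : ℕ → Bool) (n w b mode off p : ℕ) (z A : ℕ → ℕ) (d j : ℕ) : ℕ :=
  ∑ τ ∈ Finset.range d, tableSeq ω n w b mode off p z A (τ + 1)
    (off + τ * w + hashVal ω b mode (p + τ * (n * b)) j)

open Classical in
/-- Flip the listed positions whose cells are odd in more than half of the `d` tables. -/
noncomputable def flipBits (S : ℕ → ℕ) (m d : ℕ) (cnt z : ℕ → ℕ) : ℕ → ℕ := fun j =>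
  if (∃ i < m, S i = j) ∧ d < 2 * cnt j then 1 - z j else z j

def tablesProg : RamProg :=
  .seq clearProg (.seq (.assign 17 (.reg 13)) (.loop (.reg 17) tableProg))

/-- Only `flag = 1` changes anything. -/
def flipProg (flag : ℕ) : RamProg :=
  .seq (.assign 23 (.const 0))
    (.loop (.op .lt (.reg 23) (.op .mul (.reg 12) (.const flag)))
      (.seq (.branch (.op .lt (.reg 13) (.op .mul (.const 2) (.cell 6 (.cell 3 (.reg 23)))))
        (.seq (.write 0 (.cell 3 (.reg 23)) (.op .sub (.const 1) (.cell 0 (.cell 3 (.reg 23)))))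
          (.write 6 (.cell 3 (.reg 23)) (.const 0)))
        .skip)
      (.assign 23 (.op .add (.reg 23) (.const 1)))))

section
variable {ω : ℕ → Bool} {N : ℕ}

theorem tableSeq_lt_two {n w b mode off p : ℕ} {z A : ℕ → ℕ} (hA : ∀ c, A c < 2) (τ c : ℕ) :
    tableSeq ω n w b mode off p z A τ c < 2 := by
  cases τ with
  | zero => exact hA c
  | succ τ => exact toggle_lt_two _ _ _ _ _ _ _ _

theorem oddCount_le {n w b mode off p : ℕ} {z A : ℕ → ℕ} (hA : ∀ c, A c < 2) (d j : ℕ) :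
    oddCount ω n w b mode off p z A d j ≤ d := by
  unfold oddCount
  calc _ ≤ ∑ _τ ∈ Finset.range d, 1 :=
        Finset.sum_le_sum fun τ _ => Nat.le_of_lt_succ (tableSeq_lt_two hA _ _)
    _ = d := by simp

theorem tablesProg_spec (hN : 2 ≤ N) {σ : RamState} (hσ : σ.Bdd N)
    (hb : ∀ j < σ.reg 0, 2 ^ σ.reg 15 * (σ.reg 16 * j) + 2 ^ σ.reg 15 ≤ N)
    (hA : ∀ c, σ.arr 4 c < 2) (hoff : σ.reg 2 + σ.reg 13 * σ.reg 14 ≤ N) :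
    ∃ τ, Runs ω N tablesProg σ τ
        (1 + (σ.reg 0 * 3 + 1) + (1 + (σ.reg 13 * (σ.reg 0 * (4 * σ.reg 15 + 10) + 7) + 1))) ∧
      τ.Bdd N ∧ (τ.pos = σ.pos + σ.reg 13 * (σ.reg 0 * σ.reg 15) ∧
      τ.reg 2 = σ.reg 2 + σ.reg 13 * σ.reg 14 ∧
      τ.arr 4 = tableSeq ω (σ.reg 0) (σ.reg 14) (σ.reg 15) (σ.reg 16) (σ.reg 2) σ.pos (σ.arr 0)
        (σ.arr 4) (σ.reg 13) ∧
      ∀ j < σ.reg 0, τ.arr 6 j = oddCount ω (σ.reg 0) (σ.reg 14) (σ.reg 15) (σ.reg 16) (σ.reg 2)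
        σ.pos (σ.arr 0) (σ.arr 4) (σ.reg 13) j) := by
  refine Runs.bind (clearProg_spec hN hσ) fun τ₁ r₁ hτ₁ c₁ => ?_
  have c0 : τ₁.reg 0 = σ.reg 0 := r₁.reg_eq 0 (by decide)
  have c2 : τ₁.reg 2 = σ.reg 2 := r₁.reg_eq 2 (by decide)
  have c13 : τ₁.reg 13 = σ.reg 13 := r₁.reg_eq 13 (by decide)
  have c14 : τ₁.reg 14 = σ.reg 14 := r₁.reg_eq 14 (by decide)
  have c15 : τ₁.reg 15 = σ.reg 15 := r₁.reg_eq 15 (by decide)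
  have c16 : τ₁.reg 16 = σ.reg 16 := r₁.reg_eq 16 (by decide)
  have ca0 : τ₁.arr 0 = σ.arr 0 := r₁.arr_eq 0 (by decide)
  have ca4 : τ₁.arr 4 = σ.arr 4 := r₁.arr_eq 4 (by decide)
  have cp : τ₁.pos = σ.pos := r₁.pos_eq (by decide)
  set n := σ.reg 0
  set off := σ.reg 2
  set d := σ.reg 13 with hd
  set w := σ.reg 14
  set b := σ.reg 15
  set mode := σ.reg 16
  set z := σ.arr 0
  set A := σ.arr 4
  set p := σ.pos
  have hdN : d ≤ N := hσ.1 13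
  refine Runs.bind (P := fun τ => τ.reg 17 = d ∧ τ.reg 0 = n ∧ τ.reg 2 = off ∧ τ.reg 14 = w ∧
      τ.reg 15 = b ∧ τ.reg 16 = mode ∧ τ.arr 0 = z ∧ τ.arr 4 = A ∧ τ.pos = p ∧
      ∀ j < n, τ.arr 6 j = 0) (Runs.assign_spec hN hτ₁
      ⟨by simp [RamExpr.nodes], by simp [RamExpr.ConstsLE]⟩
      (by simpa [RamExpr.eval] using hτ₁.1 13) ?_) fun τ₂ _ hτ₂ h => ?_
  · simp [RamState.setReg, RamExpr.eval, Function.update, c0, c2, c13, c14, c15, c16, ca0, ca4, cp]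
    exact c₁
  obtain ⟨h17, h0, h2, h14, h15, h16, ha0, ha4, hp, h6⟩ := h
  refine Runs.weaken (Runs.loop_frame hN ⟨by simp [RamExpr.nodes], by simp [RamExpr.ConstsLE]⟩ hτ₂
    (fun i τ => τ.reg 17 = d - i ∧ τ.pos = p + i * (n * b) ∧ τ.reg 2 = off + i * w ∧
      τ.arr 4 = tableSeq ω n w b mode off p z A i ∧
      ∀ j < n, τ.arr 6 j = oddCount ω n w b mode off p z A i j)
    d (n * (4 * b + 10) + 6) ?_ ?_ ?_) le_rfl fun τ _ _ h => h.2
  · rintro i hi σ₁ hσ₁ hr ha ⟨g17, gp, g2, g4, g6⟩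
    have e0 : σ₁.reg 0 = n := by rw [hr 0 (by decide), h0]
    have e14 : σ₁.reg 14 = w := by rw [hr 14 (by decide), h14]
    have e15 : σ₁.reg 15 = b := by rw [hr 15 (by decide), h15]
    have e16 : σ₁.reg 16 = mode := by rw [hr 16 (by decide), h16]
    have ez : σ₁.arr 0 = z := by rw [ha 0 (by decide), ha0]
    refine ⟨by simp only [RamExpr.eval, g17]; omega, ?_⟩
    obtain ⟨τ, f1, f2, fp, f7, f4⟩ := toggleProg_spec (ω := ω) hN hσ₁
      (by rw [e0, e15, e16]; exact hb) (by rw [g4]; exact tableSeq_lt_two hA i)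
    rw [e0, e15] at f1 fp
    rw [e0, e15, e16] at f7
    rw [e0, e15, e16, g2, gp, g4, ez] at f4
    have f4' : τ.arr 4 = tableSeq ω n w b mode off p z A (i + 1) := f4
    rw [gp] at fp f7
    have k0 : τ.reg 0 = n := by rw [f1.reg_eq 0 (by decide), e0]
    have k2 : τ.reg 2 = off + i * w := by rw [f1.reg_eq 2 (by decide), g2]
    have k14 : τ.reg 14 = w := by rw [f1.reg_eq 14 (by decide), e14]
    have k17 : τ.reg 17 = d - i := by rw [f1.reg_eq 17 (by decide), g17]
    have k6 : τ.arr 6 = σ₁.arr 6 := f1.arr_eq 6 (by decide)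
    have hstep : off + i * w + w ≤ N := by
      have h1 : (i + 1) * w ≤ d * w := Nat.mul_le_mul_right w hi
      rw [add_mul, one_mul] at h1
      omega
    refine Runs.weaken (Runs.bind (P := fun ρ => ρ = τ) ⟨τ, f1, f2, rfl⟩
      (m' := n * 3 + 4) fun ρ _ _ hρ => ?_) ?_ fun τ _ _ h => h
    · subst hρ
      obtain ⟨τ', y1, y2, y3⟩ := countProg_spec (ω := ω) hN f2 (D := i) (by omega)
        (by rw [f4']; exact tableSeq_lt_two hA _)
        (by rw [k0, k6]; intro j hj; rw [g6 j hj]; exact oddCount_le hA _ _)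
      rw [k0] at y1 y3
      have l2 : τ'.reg 2 = off + i * w := by rw [y1.reg_eq 2 (by decide), k2]
      have l14 : τ'.reg 14 = w := by rw [y1.reg_eq 14 (by decide), k14]
      have l17 : τ'.reg 17 = d - i := by rw [y1.reg_eq 17 (by decide), k17]
      have l4 : τ'.arr 4 = tableSeq ω n w b mode off p z A (i + 1) := by
        rw [y1.arr_eq 4 (by decide), f4']
      have lp : τ'.pos = p + (i + 1) * (n * b) := by
        rw [y1.pos_eq (by decide), fp]; ring
      have l6 : ∀ j < n, τ'.arr 6 j = oddCount ω n w b mode off p z A (i + 1) j := by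
        intro j hj
        -- Array 7 holds the hash values of the table just filled, so the cell read is exactly the
        -- next summand of `oddCount`.
        rw [y3 j hj, k6, g6 j hj, f4', k2, f7 j hj, oddCount, oddCount, Finset.sum_range_succ]
      refine Runs.weaken (Runs.bind (P := fun ρ => ρ = τ') ⟨τ', y1, y2, rfl⟩
        (m' := 2) fun ρ _ _ hρ => ?_) (by omega) fun τ _ _ h => h
      subst hρ
      refine Runs.bind (m := 1) (m' := 1) (P := fun τ => τ.reg 17 = d - i ∧
        τ.pos = p + (i + 1) * (n * b) ∧
        τ.reg 2 = off + (i + 1) * w ∧ τ.arr 4 = tableSeq ω n w b mode off p z A (i + 1) ∧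
        ∀ j < n, τ.arr 6 j = oddCount ω n w b mode off p z A (i + 1) j)
        (Runs.assign_spec hN y2
        ⟨by simp [RamExpr.nodes], by simp [RamExpr.ConstsLE]⟩ ?_ ?_) fun τ _ hτ h => ?_
      · simp only [RamExpr.eval, ArithOp.eval, l2, l14]; exact hstep
      · refine ⟨by simp [RamState.setReg, l17], lp, ?_, l4, l6⟩
        simp [RamState.setReg, RamExpr.eval, ArithOp.eval, l2, l14]; ring
      · refine Runs.assign_spec hN hτ
          ⟨by simp [RamExpr.nodes], by simp [RamExpr.ConstsLE]; omega⟩ ?_ ?_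
        · simp only [RamExpr.eval, ArithOp.eval, h.1]; omega
        · refine ⟨?_, h.2.1, ?_, h.2.2.2.1, h.2.2.2.2⟩
          · simp [RamState.setReg, RamExpr.eval, ArithOp.eval, h.1]; omega
          · simp [RamState.setReg, h.2.2.1]
    · have : n * (4 * b + 10) = n * (4 * b + 7) + n * 3 := by ring
      omega
  · rintro σ₁ hσ₁ hr ha ⟨h1, -⟩
    simp [RamExpr.eval, h1]
  · exact ⟨by simpa using h17, by simpa using hp, by simpa using h2, by simpa [tableSeq] using ha4,
      by simpa [oddCount] using h6⟩

theorem flipProg_spec (hN : 2 ≤ N) {σ : RamState} (hσ : σ.Bdd N) {flag : ℕ} (hf : flag ≤ 1) :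
    ∃ τ, Runs ω N (flipProg flag) σ τ (1 + (σ.reg 12 * flag * 5 + 1)) ∧ τ.Bdd N ∧
      τ.arr 0 = flipBits (σ.arr 3) (σ.reg 12 * flag) (σ.reg 13) (σ.arr 6) (σ.arr 0) := by
  set sig := σ.reg 12 with hs12
  set d := σ.reg 13 with hd13
  set S := σ.arr 3 with hS
  set cnt := σ.arr 6 with hcnt
  set z := σ.arr 0 with hz
  have hsN : sig ≤ N := hσ.1 12
  have hsf : sig * flag ≤ N := (Nat.mul_le_mul_left _ hf).trans (by simpa using hsN)
  refine Runs.bind (P := fun τ => τ.reg 23 = 0 ∧ τ.reg 12 = sig ∧ τ.reg 13 = d ∧ τ.arr 3 = S ∧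
      τ.arr 6 = cnt ∧ τ.arr 0 = z)
    (Runs.assign_spec hN hσ
    ⟨by simp [RamExpr.nodes], by simp [RamExpr.ConstsLE]⟩ (by simp [RamExpr.eval])
    (by simp [RamState.setReg, RamExpr.eval, Function.update, ← hs12, ← hd13, ← hS, ← hcnt,
      ← hz])) fun τ₀ _ hτ₀ h => ?_
  obtain ⟨a23, a12, a13, a3, a6, a0⟩ := h
  classical
  refine Runs.weaken (Runs.loop_frame hN
    ⟨by simp [RamExpr.nodes], by simp [RamExpr.ConstsLE]; omega⟩ hτ₀
    (fun i τ => τ.reg 23 = i ∧ τ.arr 0 = flipBits S i d cnt z ∧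
      τ.arr 6 = fun j => if (∃ i' < i, S i' = j) ∧ d < 2 * cnt j then 0 else cnt j)
    (sig * flag) 4 ?_ ?_ ?_) (by omega) fun τ _ _ h => h.2.1
  · rintro i hi σ₁ hσ₁ hr ha ⟨h1, h2, h3⟩
    have e12 : σ₁.reg 12 = sig := by rw [hr 12 (by decide), a12]
    have e13 : σ₁.reg 13 = d := by rw [hr 13 (by decide), a13]
    have eS : σ₁.arr 3 = S := by rw [ha 3 (by decide), a3]
    refine ⟨by simp [RamExpr.eval, ArithOp.eval, e12, h1, hi], ?_⟩
    have hbr : (RamExpr.op .lt (.reg 13) (.op .mul (.const 2)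
        (.cell 6 (.cell 3 (.reg 23))))).eval σ₁ = if d < 2 * σ₁.arr 6 (S i) then 1 else 0 := by
      simp [RamExpr.eval, ArithOp.eval, e13, eS, h1]
    refine Runs.bind (m := 3) (m' := 1) (P := fun τ => τ.reg 23 = i ∧
        τ.arr 0 = flipBits S (i + 1) d cnt z ∧
        τ.arr 6 = fun j => if (∃ i' < i + 1, S i' = j) ∧ d < 2 * cnt j then 0 else cnt j)
        ?_ fun τ _ hτ h => ?_
    · have hex : ∀ j, j ≠ S i → ((∃ i' < i + 1, S i' = j) ↔ ∃ i' < i, S i' = j) := by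
        intro j hj
        constructor
        · rintro ⟨i', hi', rfl⟩
          refine ⟨i', ?_, rfl⟩
          have : i' ≠ i := fun h => hj (by rw [h])
          omega
        · rintro ⟨i', hi', rfl⟩
          exact ⟨i', by omega, rfl⟩
      have hex' : ∃ i' < i + 1, S i' = S i := ⟨i, by omega, rfl⟩
      by_cases hc : d < 2 * σ₁.arr 6 (S i)
      -- A repeated entry either had its counter cleared at the first flip or never passes the test.
      -- Hence no position is flipped twice and the list need not be free of repetitions.
      · have hnew : ¬ ∃ i' < i, S i' = S i := by
          intro hcon
          rw [h3] at hc
          simp only [hcon, true_and] at hc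
          split_ifs at hc <;> omega
        have hd : d < 2 * cnt (S i) := by
          rw [h3] at hc
          simpa only [hnew, false_and, if_false] using hc
        have hw := Runs.write (ω := ω) (b := 0) (i := .cell 3 (.reg 23))
          (e := .op .sub (.const 1) (.cell 0 (.cell 3 (.reg 23)))) hN hσ₁
          ⟨by simp [RamExpr.nodes], by simp [RamExpr.ConstsLE]⟩
          ⟨by simp [RamExpr.nodes], by simp [RamExpr.ConstsLE]; omega⟩
        have hev : (RamExpr.op .sub (.const 1) (.cell 0 (.cell 3 (.reg 23)))).eval σ₁
            = 1 - σ₁.arr 0 (S i) := by simp [RamExpr.eval, ArithOp.eval, eS, h1]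
        have hix : (RamExpr.cell 3 (.reg 23)).eval σ₁ = S i := by
          simp [RamExpr.eval, eS, h1]
        rw [hev, hix] at hw
        have hB : (σ₁.setCell 0 (S i) (1 - σ₁.arr 0 (S i))).Bdd N := hσ₁.setCell (by omega)
        have hw' := Runs.write (ω := ω) (b := 6) (i := .cell 3 (.reg 23))
          (e := .const 0) hN hB
          ⟨by simp [RamExpr.nodes], by simp [RamExpr.ConstsLE]⟩
          ⟨by simp [RamExpr.nodes], by simp [RamExpr.ConstsLE]⟩
        have hix' : (RamExpr.cell 3 (.reg 23)).eval (σ₁.setCell 0 (S i) (1 - σ₁.arr 0 (S i)))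
            = S i := by
          simp [RamExpr.eval, RamState.setCell, eS, h1]
        rw [hix'] at hw'
        refine ⟨_, Runs.mono (Runs.branch_true hN hσ₁ ⟨by simp [RamExpr.nodes],
          by simp [RamExpr.ConstsLE, hN]⟩ (by rw [hbr, if_pos hc]; norm_num) (hw.seq hw'))
          (by omega), hB.setCell (by simp [RamExpr.eval]), by simp [RamState.setCell, h1], ?_, ?_⟩
        · funext j
          by_cases hj : j = S i
          · subst hj
            simp [RamState.setCell, h2, flipBits, hnew, hex', hd, -Order.lt_add_one_iff]
          · simp [RamState.setCell, h2, flipBits, hj, hex j hj, -Order.lt_add_one_iff]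
        · funext j
          by_cases hj : j = S i
          · subst hj
            simp [RamState.setCell, hex', hd, RamExpr.eval, -Order.lt_add_one_iff]
          · simp [RamState.setCell, h3, hj, hex j hj, -Order.lt_add_one_iff]
      · refine ⟨σ₁, Runs.mono (Runs.branch_false hN hσ₁ ⟨by simp [RamExpr.nodes],
          by simp [RamExpr.ConstsLE, hN]⟩ (by rw [hbr, if_neg hc]) (Runs.skip σ₁)) (by omega),
          hσ₁, h1, ?_, ?_⟩
        · rw [h2]
          funext j
          by_cases hj : j = S i
          · subst hj
            rw [h3] at hc
            by_cases hold : ∃ i' < i, S i' = S i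
            · simp [flipBits, hold, hex', -Order.lt_add_one_iff]
            · have : ¬ d < 2 * cnt (S i) := by simpa [hold] using hc
              simp [flipBits, this]
          · simp [flipBits, hex j hj, -Order.lt_add_one_iff]
        · rw [h3]
          funext j
          by_cases hj : j = S i
          · subst hj
            rw [h3] at hc
            by_cases hold : ∃ i' < i, S i' = S i
            · simp [hold, hex', -Order.lt_add_one_iff]
            · have : ¬ d < 2 * cnt (S i) := by simpa [hold] using hc
              simp [this]
          · simp [hex j hj, -Order.lt_add_one_iff]
    · refine Runs.assign_spec hN hτ
        ⟨by simp [RamExpr.nodes], by simp [RamExpr.ConstsLE]; omega⟩ ?_ ?_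
      · simp only [RamExpr.eval, ArithOp.eval, h.1]; omega
      · simpa [RamState.setReg, RamExpr.eval, ArithOp.eval, h.1] using h.2
  · rintro σ₁ hσ₁ hr ha ⟨h1, -⟩
    have e12 : σ₁.reg 12 = sig := by rw [hr 12 (by decide), a12]
    simp [RamExpr.eval, ArithOp.eval, e12, h1]
  · exact ⟨a23, by rw [a0]; funext j; simp [flipBits], by rw [a6]; simp⟩

end

/-! ### The protocol -/

/-- Bit length of the total size of the sets. -/
noncomputable def sumSize (s k : ℕ → ℕ) : ℕ := (actSum s k 1).size

/-- Error levels up to this threshold are treated in one last step. -/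
noncomputable def lastThr (s k : ℕ → ℕ) : ℕ := min (k (actCount k 1 - 1)) (sumSize s k)

/-- Parameters of one level: `d` tables of width `w` with `b` coins for every position; `sig` is
the number of listed positions that are decoded and `q` the error level aimed at. -/
structure LevelPar where
  d : ℕ
  w : ℕ
  b : ℕ
  mode : ℕ
  sig : ℕ
  q : ℕ

/-- Number of tables at level `2 ^ e`. -/
noncomputable def tableCount (s k : ℕ → ℕ) (e : ℕ) : ℕ :=
  4 * if lastThr s k < 2 ^ e then (actSum s k (2 ^ e) / 2 ^ e).size else sumSize s k

/-- Bit length of a cell number at level `2 ^ e`. -/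
noncomputable def cellBits (B : ℕ) (k : ℕ → ℕ) (e : ℕ) : ℕ := B + (actCount k 1).size + e

open Classical in
/-- The parameters of level `2 ^ e`; if the message would become longer than `n`, the remaining
part of it is the string itself. -/
noncomputable def levelPar (B n : ℕ) (s k : ℕ → ℕ) (off e : ℕ) : LevelPar :=
  if n < off + tableCount s k e * 2 ^ cellBits B k e then ⟨1, n, 0, 1, actSum s k 1, 0⟩
  else ⟨tableCount s k e, 2 ^ cellBits B k e, cellBits B k e, 0, actSum s k (2 ^ e), 2 ^ e⟩

/-- State of a party between two levels: message length, coins used, current string, table array. -/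
structure PState where
  off : ℕ
  pos : ℕ
  z : ℕ → ℕ
  A : ℕ → ℕ

noncomputable def stepLevel (ω : ℕ → Bool) (flag n : ℕ) (S : ℕ → ℕ) (P : LevelPar) (st : PState) :
    PState where
  off := st.off + P.d * P.w
  pos := st.pos + P.d * (n * P.b)
  z := flipBits S (P.sig * flag) P.d
    (oddCount ω n P.w P.b P.mode st.off st.pos st.z st.A P.d) st.z
  A := tableSeq ω n P.w P.b P.mode st.off st.pos st.z st.A P.d

open Classical in
/-- All levels from `2 ^ e` downwards. -/
noncomputable def runLevels (ω : ℕ → Bool) (flag B n : ℕ) (s k S : ℕ → ℕ) : ℕ → PState → PState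
  | 0, st => stepLevel ω flag n S (levelPar B n s k st.off 0) st
  | e + 1, st =>
    if lastThr s k < (levelPar B n s k st.off (e + 1)).q then
      runLevels ω flag B n s k S e (stepLevel ω flag n S (levelPar B n s k st.off (e + 1)) st)
    else stepLevel ω flag n S (levelPar B n s k st.off (e + 1)) st

/-- One table of width `n` with the identity as hash function transmits the whole string; the level
`0` written to register 8 makes the loop stop afterwards. -/
def fallbackProg : RamProg :=
  .seq (.assign 16 (.const 1)) (.seq (.assign 13 (.const 1)) (.seq (.assign 14 (.reg 0))
    (.seq (.assign 15 (.const 0)) (.seq (.assign 12 (.reg 3)) (.assign 8 (.const 0))))))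

def paramProg (B : ℕ) : RamProg :=
  .seq (powProg (.reg 9) 8) (.seq (scanProg 11 12)
  (.seq (.branch (.op .lt (.reg 7) (.reg 8)) (sizeProg (.op .div (.reg 12) (.reg 8)) 13)
    (.assign 13 (.reg 4)))
  (.seq (.assign 13 (.op .mul (.const 4) (.reg 13)))
  (.seq (.assign 15 (.op .add (.op .add (.const B) (.reg 6)) (.reg 9)))
  (.seq (powProg (.reg 15) 14)
  (.seq (.assign 16 (.const 0))
    (.branch (.op .lt (.reg 0) (.op .add (.reg 2) (.op .mul (.reg 13) (.reg 14))))
      fallbackProg .skip)))))))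

/-- Register 10 is the loop flag. It is cleared both after a level at or below the threshold and
after the fallback, where `q = 0`. -/
def levelProg (B flag : ℕ) : RamProg :=
  .seq (paramProg B) (.seq tablesProg (.seq (flipProg flag)
    (.branch (.op .lt (.reg 7) (.reg 8)) (.assign 9 (.op .sub (.reg 9) (.const 1)))
      (.assign 10 (.const 0)))))

/-- Register 1 is recomputed as the number of sets with `k i ≥ 1`. It also initialises the loop
flag, so the loop is skipped when there is nothing to correct. -/
def setupProg : RamProg :=
  .seq (.assign 8 (.const 1)) (.seq (scanProg 1 3) (.seq (sizeProg (.reg 3) 4)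
  (.seq (sizeProg (.reg 1) 6) (.seq (.assign 7 (.cell 2 (.op .sub (.reg 1) (.const 1))))
  (.seq (.branch (.op .lt (.reg 4) (.reg 7)) (.assign 7 (.reg 4)) .skip)
  (.seq (sizeProg (.cell 2 (.const 0)) 9) (.seq (.assign 9 (.op .sub (.reg 9) (.const 1)))
    (.assign 10 (.reg 1)))))))))

def copyProg : RamProg :=
  .seq (.assign 18 (.const 0)) (.loop (.op .lt (.reg 18) (.reg 0))
    (.seq (.write 5 (.reg 18) (.cell 0 (.reg 18))) (.assign 18 (.op .add (.reg 18) (.const 1)))))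

/-- The program of Alice (`flag = 0`) and of Bob (`flag = 1`). -/
def partyProg (B flag : ℕ) : RamProg :=
  .seq (.assign 2 (.const 0)) (.seq (.assign 1 (.const 0))
    (.seq setupProg (.seq (.loop (.reg 10) (levelProg B flag)) copyProg)))

/-- What the programs need to know about `n`, `s`, `k` in order to halt quickly. -/
structure ParamBounds (n : ℕ) (s k : ℕ → ℕ) : Prop where
  zero : ∃ j, k j = 0
  sum_le : actSum s k 1 ≤ n
  count_le : actCount k 1 ≤ n
  head_le : k 0 ≤ n

/-- A bound for all numbers handled by the programs. -/
def numBound (B n : ℕ) : ℕ := 2 ^ (B + 2 * n.size + 6)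

theorem actCount_le_one {k : ℕ → ℕ} (h : ∃ j, k j = 0) {q : ℕ} (hq : 1 ≤ q) :
    actCount k q ≤ actCount k 1 := by
  apply Nat.sInf_le
  have : k (actCount k 1) < 1 := Nat.sInf_mem (s := {i | k i < 1}) (by
    obtain ⟨j, hj⟩ := h; exact ⟨j, by simp [hj]⟩)
  simp only [Set.mem_ofPred_eq]; omega

theorem actSum_le_one (s : ℕ → ℕ) {k : ℕ → ℕ} (h : ∃ j, k j = 0) {q : ℕ} (hq : 1 ≤ q) :
    actSum s k q ≤ actSum s k 1 :=
  Finset.sum_le_sum_of_subset (Finset.range_mono (actCount_le_one h hq))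

section
variable {ω : ℕ → Bool} {N : ℕ}

theorem fallbackProg_spec (hN : 2 ≤ N) {σ : RamState} (hσ : σ.Bdd N) :
    ∃ τ, Runs ω N fallbackProg σ τ 6 ∧ τ.Bdd N ∧ (τ.reg 13 = 1 ∧ τ.reg 14 = σ.reg 0 ∧
      τ.reg 15 = 0 ∧ τ.reg 16 = 1 ∧ τ.reg 12 = σ.reg 3 ∧ τ.reg 8 = 0) := by
  have h1 := Runs.assign (ω := ω) (v := 16) (e := .const 1) hN hσ
    ⟨by simp [RamExpr.nodes], by simp [RamExpr.ConstsLE]; omega⟩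
  have b1 := hσ.setReg (v := 16) (a := 1) (by omega)
  have h2 := Runs.assign (ω := ω) (v := 13) (e := .const 1) hN b1
    ⟨by simp [RamExpr.nodes], by simp [RamExpr.ConstsLE]; omega⟩
  have b2 := b1.setReg (v := 13) (a := 1) (by omega)
  have h3 := Runs.assign (ω := ω) (v := 14) (e := .reg 0) hN b2
    ⟨by simp [RamExpr.nodes], by simp [RamExpr.ConstsLE]⟩
  have b3 := b2.setReg (v := 14) (b2.1 0)
  have h4 := Runs.assign (ω := ω) (v := 15) (e := .const 0) hN b3
    ⟨by simp [RamExpr.nodes], by simp [RamExpr.ConstsLE]⟩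
  have b4 := b3.setReg (v := 15) (a := 0) (by omega)
  have h5 := Runs.assign (ω := ω) (v := 12) (e := .reg 3) hN b4
    ⟨by simp [RamExpr.nodes], by simp [RamExpr.ConstsLE]⟩
  have b5 := b4.setReg (v := 12) (b4.1 3)
  have h6 := Runs.assign (ω := ω) (v := 8) (e := .const 0) hN b5
    ⟨by simp [RamExpr.nodes], by simp [RamExpr.ConstsLE]⟩
  refine ⟨_, (h1.seq (h2.seq (h3.seq (h4.seq (h5.seq h6))))).mono (by omega),
    b5.setReg (v := 8) (a := 0) (by omega), ?_⟩
  simp [RamState.setReg, RamExpr.eval, Function.update]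

/-- The registers and arrays between two levels. -/
structure LevelView (n : ℕ) (s k S : ℕ → ℕ) (st : PState) (σ : RamState) : Prop where
  r0 : σ.reg 0 = n
  r2 : σ.reg 2 = st.off
  r3 : σ.reg 3 = actSum s k 1
  r4 : σ.reg 4 = sumSize s k
  r6 : σ.reg 6 = (actCount k 1).size
  r7 : σ.reg 7 = lastThr s k
  a0 : σ.arr 0 = st.z
  a1 : σ.arr 1 = s
  a2 : σ.arr 2 = k
  a3 : σ.arr 3 = S
  a4 : σ.arr 4 = st.A
  pos : σ.pos = st.pos

theorem four_mul_size_le (B n : ℕ) {m : ℕ} (hm : m ≤ n) : 4 * m.size ≤ numBound B n := by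
  have h1 : m.size ≤ n.size := Nat.size_le_size hm
  have h2 : n.size ≤ 2 ^ n.size := Nat.lt_two_pow_self.le
  have h3 : 2 ^ 2 * 2 ^ n.size ≤ numBound B n := by
    rw [← pow_add]; exact Nat.pow_le_pow_right (by norm_num) (by omega)
  omega

theorem two_mul_le_numBound (B n : ℕ) : 2 * n + 2 ≤ numBound B n := by
  have h2 : n < 2 ^ n.size := n.lt_size_self
  have h3 : 2 ^ 1 * 2 ^ n.size ≤ numBound B n := by
    rw [← pow_add]; exact Nat.pow_le_pow_right (by norm_num) (by omega)
  omega

/-- Both the number of active sets and `2 ^ e` are at most `n`, and each adds at most `n.size` to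
the exponent; hence the `2 * n.size` in `numBound`. -/
theorem two_pow_cellBits_le (B : ℕ) {n : ℕ} {s k : ℕ → ℕ} (hp : ParamBounds n s k) {e : ℕ}
    (he : 2 ^ e ≤ n) : 2 ^ cellBits B k e ≤ numBound B n := by
  have h1 := Nat.size_le_size hp.count_le
  have h2 := Nat.lt_size.2 he
  exact Nat.pow_le_pow_right (by norm_num) (by unfold cellBits; omega)

/-- Number of elementary steps for the parameters of one level. -/
def paramSteps (B n : ℕ) : ℕ := 3 * n + 15 * (n.size + B) + 40

theorem paramProg_spec {B n : ℕ} {s k S : ℕ → ℕ} {st : PState} (hp : ParamBounds n s k)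
    {σ : RamState} (hσ : σ.Bdd (numBound B n)) (hv : LevelView n s k S st σ) {e : ℕ}
    (h9 : σ.reg 9 = e) (he : 2 ^ e ≤ n) :
    ∃ τ, Runs ω (numBound B n) (paramProg B) σ τ (paramSteps B n) ∧ τ.Bdd (numBound B n) ∧
      (τ.reg 13 = (levelPar B n s k st.off e).d ∧ τ.reg 14 = (levelPar B n s k st.off e).w ∧
      τ.reg 15 = (levelPar B n s k st.off e).b ∧ τ.reg 16 = (levelPar B n s k st.off e).mode ∧
      τ.reg 12 = (levelPar B n s k st.off e).sig ∧ τ.reg 8 = (levelPar B n s k st.off e).q) := by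
  set N := numBound B n with hNdef
  have hnN : 2 * n + 2 ≤ N := two_mul_le_numBound B n
  have hN : 2 ≤ N := by omega
  have h1e : 1 ≤ 2 ^ e := Nat.one_le_two_pow
  have hes : e < n.size := Nat.lt_size.2 he
  have hac := (actCount_le_one hp.zero h1e).trans hp.count_le
  have has := (actSum_le_one s hp.zero h1e).trans hp.sum_le
  have hBN : B ≤ N := by
    have h2 : B < 2 ^ B := Nat.lt_two_pow_self
    have h3 : 2 ^ B ≤ N := Nat.pow_le_pow_right (by norm_num) (by omega)
    omega
  have hcs : (actCount k 1).size ≤ n.size := Nat.size_le_size hp.count_le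
  obtain ⟨τ₁, x₁, y₁, z₁⟩ := powProg_spec (ω := ω) (e := .reg 9) (dst := 8) hN hσ
    ⟨by simp [RamExpr.nodes], by simp [RamExpr.ConstsLE]⟩
    (by simp only [RamExpr.eval, h9]; omega) (by norm_num)
  simp only [RamExpr.eval, h9] at x₁ z₁
  have a1 : τ₁.arr 1 = s := by rw [x₁.arr_eq 1 (by decide), hv.a1]
  have a2 : τ₁.arr 2 = k := by rw [x₁.arr_eq 2 (by decide), hv.a2]
  obtain ⟨τ₂, x₂, y₂, z₂, w₂⟩ := scanProg_spec (ω := ω) (i := 11) (acc := 12) hN y₁ (by norm_num)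
    (by norm_num) (by norm_num)
    (by rw [a2, z₁]; obtain ⟨j, hj⟩ := hp.zero; exact ⟨j, by omega⟩)
    (by rw [a2, z₁]; omega) (by rw [a1, a2, z₁]; omega)
  rw [a2, z₁] at x₂ z₂ w₂
  rw [a1] at w₂
  have b8 : τ₂.reg 8 = 2 ^ e := by rw [x₂.reg_eq 8 (by decide), z₁]
  have b7 : τ₂.reg 7 = lastThr s k := by
    rw [x₂.reg_eq 7 (by decide), x₁.reg_eq 7 (by decide), hv.r7]
  have b4 : τ₂.reg 4 = sumSize s k := by
    rw [x₂.reg_eq 4 (by decide), x₁.reg_eq 4 (by decide), hv.r4]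
  have hdiv : actSum s k (2 ^ e) / 2 ^ e ≤ n := (Nat.div_le_self _ _).trans has
  have hdsz : (actSum s k (2 ^ e) / 2 ^ e).size ≤ n.size := Nat.size_le_size hdiv
  have hbr : ∃ τ, Runs ω N (.branch (.op .lt (.reg 7) (.reg 8))
      (sizeProg (.op .div (.reg 12) (.reg 8)) 13) (.assign 13 (.reg 4))) τ₂ τ (3 * n.size + 4) ∧
      τ.Bdd N ∧ 4 * τ.reg 13 = tableCount s k e := by
    by_cases hq : lastThr s k < 2 ^ e
    · have hev : (RamExpr.op .div (.reg 12) (.reg 8)).eval τ₂ = actSum s k (2 ^ e) / 2 ^ e := by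
        simp [RamExpr.eval, ArithOp.eval, w₂, b8]
      obtain ⟨τ, x, y, z⟩ := sizeProg_spec (ω := ω) (e := .op .div (.reg 12) (.reg 8)) (dst := 13)
        hN y₂ ⟨by simp [RamExpr.nodes], by simp [RamExpr.ConstsLE]⟩
        (by rw [hev]; omega) (by norm_num)
      rw [hev] at x z
      refine ⟨τ, Runs.mono (Runs.branch_true hN y₂ ⟨by simp [RamExpr.nodes],
        by simp [RamExpr.ConstsLE]⟩ ?_ x) (by omega), y, by rw [z, tableCount, if_pos hq]⟩
      simp [RamExpr.eval, ArithOp.eval, b7, b8, hq]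
    · refine ⟨_, Runs.mono (Runs.branch_false hN y₂ ⟨by simp [RamExpr.nodes],
        by simp [RamExpr.ConstsLE]⟩ ?_ (Runs.assign hN y₂ ⟨by simp [RamExpr.nodes],
        by simp [RamExpr.ConstsLE]⟩)) (by omega), y₂.setReg (y₂.1 4), ?_⟩
      · simp only [RamExpr.eval, ArithOp.eval, b7, b8]; rw [if_neg hq]
      · simp [RamState.setReg, RamExpr.eval, b4, tableCount, if_neg hq]
  obtain ⟨τ₃, x₃, y₃, z₃⟩ := hbr
  have hd4 : tableCount s k e ≤ N := by
    unfold tableCount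
    split_ifs
    · exact four_mul_size_le B n hdiv
    · exact four_mul_size_le B n hp.sum_le
  have x₄ := Runs.assign (ω := ω) (v := 13) (e := .op .mul (.const 4) (.reg 13)) hN y₃
    ⟨by simp [RamExpr.nodes], by
      simp only [RamExpr.ConstsLE, and_true]
      exact (Nat.le_mul_of_pos_right 4 (m := 2 ^ 4) (by norm_num)).trans
        (by rw [show 4 * 2 ^ 4 = 2 ^ 6 by norm_num]
            exact Nat.pow_le_pow_right (by norm_num) (by omega))⟩
  have e4 : (RamExpr.op .mul (.const 4) (.reg 13)).eval τ₃ = tableCount s k e := by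
    simpa [RamExpr.eval, ArithOp.eval] using z₃
  rw [e4] at x₄
  have y₄ := y₃.setReg (v := 13) hd4
  set τ₄ := τ₃.setReg 13 (tableCount s k e) with hτ₄
  have c6 : τ₄.reg 6 = (actCount k 1).size := by
    rw [x₄.reg_eq 6 (by decide), x₃.reg_eq 6 (by decide), x₂.reg_eq 6 (by decide),
      x₁.reg_eq 6 (by decide), hv.r6]
  have c9 : τ₄.reg 9 = e := by
    rw [x₄.reg_eq 9 (by decide), x₃.reg_eq 9 (by decide), x₂.reg_eq 9 (by decide),
      x₁.reg_eq 9 (by decide), h9]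
  have x₅ := Runs.assign (ω := ω) (v := 15)
    (e := .op .add (.op .add (.const B) (.reg 6)) (.reg 9)) hN y₄
    ⟨by simp [RamExpr.nodes], by simp [RamExpr.ConstsLE, hBN]⟩
  have e5 : (RamExpr.op .add (.op .add (.const B) (.reg 6)) (.reg 9)).eval τ₄
      = cellBits B k e := by
    simp [RamExpr.eval, ArithOp.eval, c6, c9, cellBits]
  have hpw := two_pow_cellBits_le B hp he
  have hcb : cellBits B k e ≤ N := Nat.lt_two_pow_self.le.trans hpw
  rw [e5] at x₅
  have y₅ := y₄.setReg (v := 15) hcb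
  set τ₅ := τ₄.setReg 15 (cellBits B k e) with hτ₅
  have d15 : τ₅.reg 15 = cellBits B k e := by simp [hτ₅, RamState.setReg]
  obtain ⟨τ₆, x₆, y₆, z₆⟩ := powProg_spec (ω := ω) (e := .reg 15) (dst := 14) hN y₅
    ⟨by simp [RamExpr.nodes], by simp [RamExpr.ConstsLE]⟩
    (by simp only [RamExpr.eval, d15]; exact hpw) (by norm_num)
  simp only [RamExpr.eval, d15] at x₆ z₆
  have x₇ := Runs.assign (ω := ω) (v := 16) (e := .const 0) hN y₆
    ⟨by simp [RamExpr.nodes], by simp [RamExpr.ConstsLE]⟩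
  have y₇ := y₆.setReg (v := 16) (a := 0) (by omega)
  simp only [RamExpr.eval] at x₇
  set τ₇ := τ₆.setReg 16 0 with hτ₇
  have f0 : τ₇.reg 0 = n := by
    rw [x₇.reg_eq 0 (by decide), x₆.reg_eq 0 (by decide), x₅.reg_eq 0 (by simp [RamProg.modRegs]),
      x₄.reg_eq 0 (by decide), x₃.reg_eq 0 (by decide), x₂.reg_eq 0 (by decide),
      x₁.reg_eq 0 (by decide), hv.r0]
  have f2 : τ₇.reg 2 = st.off := by
    rw [x₇.reg_eq 2 (by decide), x₆.reg_eq 2 (by decide), x₅.reg_eq 2 (by simp [RamProg.modRegs]),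
      x₄.reg_eq 2 (by decide), x₃.reg_eq 2 (by decide), x₂.reg_eq 2 (by decide),
      x₁.reg_eq 2 (by decide), hv.r2]
  have f3 : τ₇.reg 3 = actSum s k 1 := by
    rw [x₇.reg_eq 3 (by decide), x₆.reg_eq 3 (by decide), x₅.reg_eq 3 (by simp [RamProg.modRegs]),
      x₄.reg_eq 3 (by decide), x₃.reg_eq 3 (by decide), x₂.reg_eq 3 (by decide),
      x₁.reg_eq 3 (by decide), hv.r3]
  have f8 : τ₇.reg 8 = 2 ^ e := by
    rw [x₇.reg_eq 8 (by decide), x₆.reg_eq 8 (by decide), x₅.reg_eq 8 (by simp [RamProg.modRegs]),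
      x₄.reg_eq 8 (by decide), x₃.reg_eq 8 (by decide), b8]
  have f12 : τ₇.reg 12 = actSum s k (2 ^ e) := by
    rw [x₇.reg_eq 12 (by decide), x₆.reg_eq 12 (by decide), x₅.reg_eq 12 (by simp [RamProg.modRegs]),
      x₄.reg_eq 12 (by decide), x₃.reg_eq 12 (by decide), w₂]
  have f13 : τ₇.reg 13 = tableCount s k e := by
    rw [x₇.reg_eq 13 (by decide), x₆.reg_eq 13 (by decide), x₅.reg_eq 13 (by simp [RamProg.modRegs])]
    simp [hτ₄, RamState.setReg]
  have f14 : τ₇.reg 14 = 2 ^ cellBits B k e := by rw [x₇.reg_eq 14 (by decide), z₆]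
  have f15 : τ₇.reg 15 = cellBits B k e := by
    rw [x₇.reg_eq 15 (by decide), x₆.reg_eq 15 (by decide), d15]
  have f16 : τ₇.reg 16 = 0 := by simp [hτ₇, RamState.setReg]
  have hlast : ∃ τ, Runs ω N (.branch (.op .lt (.reg 0)
      (.op .add (.reg 2) (.op .mul (.reg 13) (.reg 14)))) fallbackProg .skip) τ₇ τ 7 ∧ τ.Bdd N ∧
      (τ.reg 13 = (levelPar B n s k st.off e).d ∧ τ.reg 14 = (levelPar B n s k st.off e).w ∧
      τ.reg 15 = (levelPar B n s k st.off e).b ∧ τ.reg 16 = (levelPar B n s k st.off e).mode ∧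
      τ.reg 12 = (levelPar B n s k st.off e).sig ∧ τ.reg 8 = (levelPar B n s k st.off e).q) := by
    by_cases hfb : n < st.off + tableCount s k e * 2 ^ cellBits B k e
    · obtain ⟨τ, x, y, z⟩ := fallbackProg_spec (ω := ω) hN y₇
      rw [f0, f3] at z
      refine ⟨τ, Runs.branch_true hN y₇ ⟨by simp [RamExpr.nodes],
        by simp [RamExpr.ConstsLE]⟩ ?_ x, y, ?_⟩
      · simp [RamExpr.eval, ArithOp.eval, f0, f2, f13, f14, hfb]
      · rw [levelPar, if_pos hfb]; exact z
    · refine ⟨_, Runs.mono (Runs.branch_false hN y₇ ⟨by simp [RamExpr.nodes],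
        by simp [RamExpr.ConstsLE]⟩ ?_ (Runs.skip _)) (by omega), y₇, ?_⟩
      · simp only [RamExpr.eval, ArithOp.eval, f0, f2, f13, f14]; rw [if_neg hfb]
      · rw [levelPar, if_neg hfb]; exact ⟨f13, f14, f15, f16, f12, f8⟩
  obtain ⟨τ₈, x₈, y₈, z₈⟩ := hlast
  refine ⟨τ₈, (x₁.seq (x₂.seq (x₃.seq (x₄.seq (x₅.seq (x₆.seq (x₇.seq x₈))))))).mono ?_, y₈, z₈⟩
  unfold paramSteps cellBits
  omega

end

/-! ### One level, the loop over the levels and the whole program -/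

theorem flipBits_congr {S : ℕ → ℕ} {m n d : ℕ} {c c' z : ℕ → ℕ} (hS : ∀ i < m, S i < n)
    (h : ∀ j < n, c j = c' j) : flipBits S m d c z = flipBits S m d c' z := by
  funext j
  unfold flipBits
  by_cases hj : ∃ i < m, S i = j
  · obtain ⟨i, hi, rfl⟩ := hj
    rw [h _ (hS i hi)]
  · simp [hj]

theorem flipBits_lt_two {S : ℕ → ℕ} {m d : ℕ} {c z : ℕ → ℕ} (hz : ∀ j, z j < 2) (j : ℕ) :
    flipBits S m d c z j < 2 := by
  unfold flipBits
  have := hz j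
  split_ifs <;> omega

theorem levelPar_cases (B n : ℕ) (s k : ℕ → ℕ) (off e : ℕ) :
    (n < off + tableCount s k e * 2 ^ cellBits B k e ∧
      levelPar B n s k off e = ⟨1, n, 0, 1, actSum s k 1, 0⟩) ∨
    (off + tableCount s k e * 2 ^ cellBits B k e ≤ n ∧ levelPar B n s k off e =
      ⟨tableCount s k e, 2 ^ cellBits B k e, cellBits B k e, 0, actSum s k (2 ^ e), 2 ^ e⟩) := by
  unfold levelPar
  split_ifs with h
  · exact .inl ⟨h, rfl⟩
  · exact .inr ⟨not_lt.1 h, rfl⟩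

theorem tableCount_le {n : ℕ} {s k : ℕ → ℕ} (hp : ParamBounds n s k) (e : ℕ) :
    tableCount s k e ≤ 4 * n.size := by
  have has := (actSum_le_one s hp.zero (Nat.one_le_two_pow (n := e))).trans hp.sum_le
  unfold tableCount
  split_ifs
  · have := Nat.size_le_size ((Nat.div_le_self _ (2 ^ e)).trans has); omega
  · have := Nat.size_le_size hp.sum_le; unfold sumSize; omega

theorem modRegs_paramProg (B : ℕ) : (paramProg B).modRegs =
    [22, 8, 8, 22, 11, 12, 12, 11, 22, 13, 22, 13, 13, 13, 15, 22, 14, 14, 22, 16, 16, 13, 14, 15, 12,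
      8] := rfl

theorem modArrs_paramProg (B : ℕ) : (paramProg B).modArrs = [] := rfl

theorem modRegs_flipProg (flag : ℕ) : (flipProg flag).modRegs = [23, 23] := rfl

theorem modArrs_flipProg (flag : ℕ) : (flipProg flag).modArrs = [0, 6] := rfl

/-- Number of elementary steps for one level. -/
def levelSteps (B n : ℕ) : ℕ :=
  paramSteps B n + ((4 * n.size + 1) * (n * (4 * (B + 2 * n.size) + 10) + 7)) + 8 * n + 8

section
variable {ω : ℕ → Bool} {N : ℕ}

theorem levelProg_spec {B n flag : ℕ} (hf : flag ≤ 1) {s k S : ℕ → ℕ} {st : PState}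
    (hp : ParamBounds n s k) {σ : RamState} (hσ : σ.Bdd (numBound B n))
    (hv : LevelView n s k S st σ) {e : ℕ} (h9 : σ.reg 9 = e) (h10 : σ.reg 10 ≠ 0) (he : 2 ^ e ≤ n)
    (hoff : st.off ≤ n) (hA : ∀ c, st.A c < 2) (hS : ∀ i < actSum s k 1, S i < n) :
    ∃ τ, Runs ω (numBound B n) (levelProg B flag) σ τ (levelSteps B n) ∧ τ.Bdd (numBound B n) ∧
      (LevelView n s k S (stepLevel ω flag n S (levelPar B n s k st.off e) st) τ ∧
      (lastThr s k < (levelPar B n s k st.off e).q → τ.reg 9 = e - 1 ∧ τ.reg 10 ≠ 0) ∧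
      (¬ lastThr s k < (levelPar B n s k st.off e).q → τ.reg 10 = 0)) := by
  set N := numBound B n with hNdef
  have hnN : 2 * n + 2 ≤ N := two_mul_le_numBound B n
  have hN : 2 ≤ N := by omega
  have hpw := two_pow_cellBits_le B hp he
  obtain ⟨τ₁, x₁, y₁, p13, p14, p15, p16, p12, p8⟩ := paramProg_spec (ω := ω) hp hσ hv h9 he
  set P := levelPar B n s k st.off e with hP
  have hcase := levelPar_cases B n s k st.off e
  have hes : e < n.size := Nat.lt_size.2 he
  have hdle : P.d ≤ 4 * n.size + 1 := by
    have := tableCount_le hp e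
    rcases hcase with ⟨-, h⟩ | ⟨-, h⟩ <;> rw [hP, h] <;> simp only <;> omega
  have hble : P.b ≤ B + 2 * n.size := by
    have h1 := Nat.size_le_size hp.count_le
    rcases hcase with ⟨-, h⟩ | ⟨-, h⟩ <;> rw [hP, h] <;> simp only [cellBits] <;> omega
  have hsle : P.sig ≤ actSum s k 1 := by
    rcases hcase with ⟨-, h⟩ | ⟨-, h⟩ <;> rw [hP, h]
    exact actSum_le_one s hp.zero Nat.one_le_two_pow
  have hdw : st.off + P.d * P.w ≤ N := by
    rcases hcase with ⟨-, h⟩ | ⟨h', h⟩ <;> rw [hP, h] <;> simp only <;> omega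
  have hhash : ∀ j < n, 2 ^ P.b * (P.mode * j) + 2 ^ P.b ≤ N := by
    intro j hj
    rcases hcase with ⟨-, h⟩ | ⟨h', h⟩ <;> rw [hP, h] <;> simp only
    · rw [pow_zero]; omega
    · simpa using hpw
  have q0 : τ₁.reg 0 = n := by rw [x₁.reg_eq 0 (by rw [modRegs_paramProg]; decide), hv.r0]
  have q2 : τ₁.reg 2 = st.off := by rw [x₁.reg_eq 2 (by rw [modRegs_paramProg]; decide), hv.r2]
  have q3 := (x₁.reg_eq 3 (by rw [modRegs_paramProg]; decide)).trans hv.r3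
  have q4 := (x₁.reg_eq 4 (by rw [modRegs_paramProg]; decide)).trans hv.r4
  have q6 := (x₁.reg_eq 6 (by rw [modRegs_paramProg]; decide)).trans hv.r6
  have q7 := (x₁.reg_eq 7 (by rw [modRegs_paramProg]; decide)).trans hv.r7
  have q9 := (x₁.reg_eq 9 (by rw [modRegs_paramProg]; decide)).trans h9
  have q10 := x₁.reg_eq 10 (by rw [modRegs_paramProg]; decide)
  have qa0 := (x₁.arr_eq 0 (by rw [modArrs_paramProg]; decide)).trans hv.a0
  have qa1 := (x₁.arr_eq 1 (by rw [modArrs_paramProg]; decide)).trans hv.a1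
  have qa2 := (x₁.arr_eq 2 (by rw [modArrs_paramProg]; decide)).trans hv.a2
  have qa3 := (x₁.arr_eq 3 (by rw [modArrs_paramProg]; decide)).trans hv.a3
  have qa4 := (x₁.arr_eq 4 (by rw [modArrs_paramProg]; decide)).trans hv.a4
  have qp : τ₁.pos = st.pos := (x₁.pos_eq (by rfl)).trans hv.pos
  obtain ⟨τ₂, x₂, y₂, r1, r2, r3, r4⟩ := tablesProg_spec (ω := ω) hN y₁
    (by rw [q0, p15, p16]; exact hhash) (by rw [qa4]; exact hA) (by rw [q2, p13, p14]; exact hdw)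
  rw [q0, p13, p15] at x₂
  rw [q0, p13, p15, qp] at r1
  rw [q2, p13, p14] at r2
  rw [q0, q2, p13, p14, p15, p16, qp, qa0, qa4] at r3 r4
  obtain ⟨τ₃, x₃, y₃, t0⟩ := flipProg_spec (ω := ω) hN y₂ hf
  have u12 : τ₂.reg 12 = P.sig := (x₂.reg_eq 12 (by decide)).trans p12
  have u13 : τ₂.reg 13 = P.d := (x₂.reg_eq 13 (by decide)).trans p13
  have ua3 : τ₂.arr 3 = S := (x₂.arr_eq 3 (by decide)).trans qa3
  have ua0 : τ₂.arr 0 = st.z := (x₂.arr_eq 0 (by decide)).trans qa0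
  have hsf : P.sig * flag ≤ P.sig := by simpa using Nat.mul_le_mul_left P.sig hf
  rw [u12] at x₃
  -- The counters are known only below `n`; this suffices because all listed positions are below
  -- `n`.
  rw [u12, u13, ua3, ua0, flipBits_congr (fun i hi => hS i (by omega)) r4] at t0
  have hv3 : LevelView n s k S (stepLevel ω flag n S P st) τ₃ :=
    { r0 := by rw [x₃.reg_eq 0 (by rw [modRegs_flipProg]; decide), x₂.reg_eq 0 (by decide), q0]
      r2 := by rw [x₃.reg_eq 2 (by rw [modRegs_flipProg]; decide), r2]; rfl
      r3 := by rw [x₃.reg_eq 3 (by rw [modRegs_flipProg]; decide), x₂.reg_eq 3 (by decide), q3]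
      r4 := by rw [x₃.reg_eq 4 (by rw [modRegs_flipProg]; decide), x₂.reg_eq 4 (by decide), q4]
      r6 := by rw [x₃.reg_eq 6 (by rw [modRegs_flipProg]; decide), x₂.reg_eq 6 (by decide), q6]
      r7 := by rw [x₃.reg_eq 7 (by rw [modRegs_flipProg]; decide), x₂.reg_eq 7 (by decide), q7]
      a0 := t0
      a1 := by rw [x₃.arr_eq 1 (by rw [modArrs_flipProg]; decide), x₂.arr_eq 1 (by decide), qa1]
      a2 := by rw [x₃.arr_eq 2 (by rw [modArrs_flipProg]; decide), x₂.arr_eq 2 (by decide), qa2]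
      a3 := by rw [x₃.arr_eq 3 (by rw [modArrs_flipProg]; decide), ua3]
      a4 := by rw [x₃.arr_eq 4 (by rw [modArrs_flipProg]; decide), r3]; rfl
      pos := by rw [x₃.pos_eq (by rfl), r1]; rfl }
  have t8 : τ₃.reg 8 = P.q := by
    rw [x₃.reg_eq 8 (by rw [modRegs_flipProg]; decide), x₂.reg_eq 8 (by decide), p8]
  have t9 : τ₃.reg 9 = e := by
    rw [x₃.reg_eq 9 (by rw [modRegs_flipProg]; decide), x₂.reg_eq 9 (by decide), q9]
  have t10 : τ₃.reg 10 ≠ 0 := by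
    rw [x₃.reg_eq 10 (by rw [modRegs_flipProg]; decide), x₂.reg_eq 10 (by decide), q10]; exact h10
  have hsteps : paramSteps B n + (1 + (n * 3 + 1) + (1 + (P.d * (n * (4 * P.b + 10) + 7) + 1)) +
      (1 + (P.sig * flag * 5 + 1) + 2)) ≤ levelSteps B n := by
    have h1 : P.d * (n * (4 * P.b + 10) + 7) ≤
        (4 * n.size + 1) * (n * (4 * (B + 2 * n.size) + 10) + 7) := by gcongr
    have h2 := hp.sum_le
    unfold levelSteps
    omega
  have hsm : (RamExpr.op .lt (.reg 7) (.reg 8)).Small N :=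
    ⟨by simp [RamExpr.nodes], by simp [RamExpr.ConstsLE]⟩
  have hcond : (RamExpr.op .lt (.reg 7) (.reg 8)).eval τ₃ = if lastThr s k < P.q then 1 else 0 := by
    simp [RamExpr.eval, ArithOp.eval, hv3.r7, t8]
  by_cases hq : lastThr s k < P.q
  · have x₄ := Runs.assign (ω := ω) (v := 9) (e := .op .sub (.reg 9) (.const 1)) hN y₃
      ⟨by simp [RamExpr.nodes], by simp [RamExpr.ConstsLE]; omega⟩
    have e4 : (RamExpr.op .sub (.reg 9) (.const 1)).eval τ₃ = e - 1 := by
      simp [RamExpr.eval, ArithOp.eval, t9]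
    rw [e4] at x₄
    have x₅ := Runs.branch_true (q := .assign 10 (.const 0)) hN y₃ hsm
      (by rw [hcond, if_pos hq]; norm_num) x₄
    refine ⟨_, (x₁.seq (x₂.seq (x₃.seq x₅))).mono hsteps, y₃.setReg ?_, ?_, ?_, fun h => absurd hq h⟩
    · have := y₃.1 9; omega
    · obtain ⟨b0, b2, b3, b4, b6, b7, c0, c1, c2, c3, c4, cp⟩ := hv3
      constructor <;> simpa [RamState.setReg]
    · intro _
      simpa [RamState.setReg] using t10
  · have x₄ := Runs.assign (ω := ω) (v := 10) (e := .const 0) hN y₃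
      ⟨by simp [RamExpr.nodes], by simp [RamExpr.ConstsLE]⟩
    have x₅ := Runs.branch_false (p := .assign 9 (.op .sub (.reg 9) (.const 1))) hN y₃ hsm
      (by rw [hcond, if_neg hq]) x₄
    refine ⟨_, (x₁.seq (x₂.seq (x₃.seq x₅))).mono hsteps, y₃.setReg (by simp [RamExpr.eval]), ?_,
      fun h => absurd h hq, ?_⟩
    · obtain ⟨b0, b2, b3, b4, b6, b7, c0, c1, c2, c3, c4, cp⟩ := hv3
      constructor <;> simpa [RamState.setReg]
    · intro _
      simp [RamState.setReg, RamExpr.eval]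

/-- Induction on `e`, as the number of rounds is not fixed in advance. Since `lastThr ≥ 1`, level `2
^ 0` is always final, so `e + 1` rounds suffice. A level after which the loop continues was not a
fallback, hence the offset is still at most `n`. -/
theorem levelsLoop_spec {B n flag : ℕ} (hf : flag ≤ 1) {s k S : ℕ → ℕ}
    (hp : ParamBounds n s k) (hS : ∀ i < actSum s k 1, S i < n) (hthr : 1 ≤ lastThr s k) (e : ℕ) :
    ∀ (st : PState) (σ : RamState), σ.Bdd (numBound B n) → LevelView n s k S st σ →
      σ.reg 9 = e → σ.reg 10 ≠ 0 → 2 ^ e ≤ n → st.off ≤ n → (∀ c, st.A c < 2) →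
    ∃ τ, Runs ω (numBound B n) (.loop (.reg 10) (levelProg B flag)) σ τ
        ((e + 1) * (levelSteps B n + 1) + 1) ∧ τ.Bdd (numBound B n) ∧
      LevelView n s k S (runLevels ω flag B n s k S e st) τ := by
  have hN : 2 ≤ numBound B n := by have := two_mul_le_numBound B n; omega
  have hsm : (RamExpr.reg 10).Small (numBound B n) :=
    ⟨by simp [RamExpr.nodes], by simp [RamExpr.ConstsLE]⟩
  have hcons : ∀ (σ τ ρ : RamState) (m : ℕ), σ.Bdd (numBound B n) → σ.reg 10 ≠ 0 →
      Runs ω (numBound B n) (levelProg B flag) σ τ (levelSteps B n) →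
      Runs ω (numBound B n) (.loop (.reg 10) (levelProg B flag)) τ ρ m →
      Runs ω (numBound B n) (.loop (.reg 10) (levelProg B flag)) σ ρ (levelSteps B n + 1 + m) := by
    rintro σ τ ρ m hσ h10 ⟨T, h1, h2⟩ ⟨U, h3, h4⟩
    refine ⟨_, .loop_step h10 h1 h3, ?_⟩
    have := hsm.cost_le hN hσ
    have hu : 1 + (RamExpr.reg 10).cost σ ≤ stepUnit (numBound B n) := by unfold stepUnit; omega
    rw [add_mul, add_mul, one_mul]
    omega
  have hnil : ∀ σ : RamState, σ.Bdd (numBound B n) → σ.reg 10 = 0 →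
      Runs ω (numBound B n) (.loop (.reg 10) (levelProg B flag)) σ σ 1 := by
    intro σ hσ h10
    refine ⟨_, .loop_done h10, ?_⟩
    have := hsm.cost_le hN hσ
    unfold stepUnit; omega
  induction e with
  | zero =>
    intro st σ hσ hv h9 h10 he hoff hA
    obtain ⟨τ, x, y, z, -, w⟩ := levelProg_spec (ω := ω) hf hp hσ hv h9 h10 he hoff hA hS
    have hq : ¬ lastThr s k < (levelPar B n s k st.off 0).q := by
      rcases levelPar_cases B n s k st.off 0 with ⟨-, h⟩ | ⟨-, h⟩ <;> rw [h] <;> simp only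
      · omega
      · rw [pow_zero]; omega
    exact ⟨τ, (hcons _ _ _ _ hσ h10 x (hnil _ y (w hq))).mono (by omega), y, z⟩
  | succ e ih =>
    intro st σ hσ hv h9 h10 he hoff hA
    obtain ⟨τ, x, y, z, w1, w2⟩ := levelProg_spec (ω := ω) hf hp hσ hv h9 h10 he hoff hA hS
    rw [runLevels]
    by_cases hq : lastThr s k < (levelPar B n s k st.off (e + 1)).q
    · rw [if_pos hq]
      have hoff' : (stepLevel ω flag n S (levelPar B n s k st.off (e + 1)) st).off ≤ n := by
        rcases levelPar_cases B n s k st.off (e + 1) with ⟨-, h⟩ | ⟨h', h⟩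
        · rw [h] at hq; simp only at hq; omega
        · rw [h]; exact h'
      obtain ⟨τ', x', y', z'⟩ := ih _ τ y z (w1 hq).1 (w1 hq).2
        ((Nat.pow_le_pow_right (by norm_num) (Nat.le_succ e)).trans he) hoff'
        (fun c => tableSeq_lt_two hA _ _)
      refine ⟨τ', (hcons _ _ _ _ hσ h10 x x').mono ?_, y', z'⟩
      rw [add_mul (e + 1)]; omega
    · rw [if_neg hq]
      refine ⟨τ, (hcons _ _ _ _ hσ h10 x (hnil _ y (w2 hq))).mono ?_, y, z⟩
      rw [add_mul]; omega

theorem copyProg_spec (hN : 2 ≤ N) {σ : RamState} (hσ : σ.Bdd N) :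
    ∃ τ, Runs ω N copyProg σ τ (1 + (σ.reg 0 * 3 + 1)) ∧ τ.Bdd N ∧
      ∀ j < σ.reg 0, τ.arr 5 j = σ.arr 0 j := by
  set n := σ.reg 0 with hn0
  refine Runs.bind (P := fun τ => τ.reg 18 = 0 ∧ τ.reg 0 = n ∧ τ.arr 0 = σ.arr 0)
    (Runs.assign_spec hN hσ
    ⟨by simp [RamExpr.nodes], by simp [RamExpr.ConstsLE]⟩ (by simp [RamExpr.eval])
    (by simp [RamState.setReg, RamExpr.eval, Function.update, ← hn0])) fun τ₀ _ hτ₀ h => ?_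
  obtain ⟨a1, a5, a0⟩ := h
  have hnN : n ≤ N := hσ.1 0
  refine Runs.weaken (Runs.loop_frame hN ⟨by simp [RamExpr.nodes], by simp [RamExpr.ConstsLE]⟩ hτ₀
    (fun i τ => τ.reg 18 = i ∧ ∀ j < i, τ.arr 5 j = σ.arr 0 j)
    n 2 ?_ ?_ ⟨a1, by simp⟩) (by omega) fun τ _ _ h => h.2
  · rintro i hi σ₁ hσ₁ hr ha ⟨h1, h2⟩
    have e0 : σ₁.reg 0 = n := by rw [hr 0 (by decide), a5]
    have ez : σ₁.arr 0 = σ.arr 0 := by rw [ha 0 (by decide), a0]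
    refine ⟨by simp [RamExpr.eval, ArithOp.eval, e0, h1, hi], ?_⟩
    refine Runs.bind (m := 1) (m' := 1)
      (P := fun τ => τ.reg 18 = i ∧ ∀ j < i + 1, τ.arr 5 j = σ.arr 0 j)
      (Runs.write_spec hN hσ₁ ⟨by simp [RamExpr.nodes], by simp [RamExpr.ConstsLE]⟩
        ⟨by simp [RamExpr.nodes], by simp [RamExpr.ConstsLE]⟩
        (by simpa [RamExpr.eval] using hσ₁.2 0 _) ?_)
      fun τ _ hτ h => ?_
    · refine ⟨h1, fun j hj => ?_⟩
      simp only [RamState.setCell, RamExpr.eval, h1, Function.update_self]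
      by_cases hji : j = i
      · subst hji; simp [ez]
      · rw [Function.update_of_ne hji, h2 j (by omega)]
    · refine Runs.assign_spec hN hτ
        ⟨by simp [RamExpr.nodes], by simp [RamExpr.ConstsLE]; omega⟩ ?_ ?_
      · simp only [RamExpr.eval, ArithOp.eval, h.1]; omega
      · simpa [RamState.setReg, RamExpr.eval, ArithOp.eval, h.1] using h.2
  · rintro σ₁ hσ₁ hr ha ⟨h1, -⟩
    have e0 : σ₁.reg 0 = n := by rw [hr 0 (by decide), a5]
    simp [RamExpr.eval, ArithOp.eval, e0, h1]

theorem setupProg_spec (hN : 2 ≤ N) {σ : RamState} (hσ : σ.Bdd N) {n : ℕ} {s k : ℕ → ℕ}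
    (hp : ParamBounds n s k) (h1 : σ.arr 1 = s) (h2 : σ.arr 2 = k) (hnN : n ≤ N) :
    ∃ τ, Runs ω N setupProg σ τ (6 * n + 6 * n.size + 40) ∧ τ.Bdd N ∧
      (τ.reg 3 = actSum s k 1 ∧ τ.reg 4 = sumSize s k ∧ τ.reg 6 = (actCount k 1).size ∧
      τ.reg 7 = lastThr s k ∧ τ.reg 9 = (k 0).size - 1 ∧ τ.reg 10 = actCount k 1) := by
  have x₁ := Runs.assign (ω := ω) (v := 8) (e := .const 1) hN hσ
    ⟨by simp [RamExpr.nodes], by simp [RamExpr.ConstsLE]; omega⟩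
  simp only [RamExpr.eval] at x₁
  have y₁ := hσ.setReg (v := 8) (a := 1) (by omega)
  set τ₁ := σ.setReg 8 1 with hτ₁
  have a1 : τ₁.arr 1 = s := h1
  have a2 : τ₁.arr 2 = k := h2
  have a8 : τ₁.reg 8 = 1 := by simp [hτ₁, RamState.setReg]
  have hc := hp.count_le
  have hs := hp.sum_le
  have hk := hp.head_le
  obtain ⟨τ₂, x₂, y₂, z₂, w₂⟩ := scanProg_spec (ω := ω) (i := 1) (acc := 3) hN y₁ (by norm_num)
    (by norm_num) (by norm_num)
    (by rw [a2, a8]; obtain ⟨j, hj⟩ := hp.zero; exact ⟨j, by omega⟩)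
    (by rw [a2, a8]; omega) (by rw [a1, a2, a8]; omega)
  rw [a2, a8] at x₂ z₂ w₂
  rw [a1] at w₂
  obtain ⟨τ₃, x₃, y₃, z₃⟩ := sizeProg_spec (ω := ω) (e := .reg 3) (dst := 4)
    hN y₂ ⟨by simp [RamExpr.nodes], by simp [RamExpr.ConstsLE]⟩ (y₂.1 3) (by norm_num)
  simp only [RamExpr.eval, w₂] at x₃ z₃
  have b1 : τ₃.reg 1 = actCount k 1 := by rw [x₃.reg_eq 1 (by decide), z₂]
  obtain ⟨τ₄, x₄, y₄, z₄⟩ := sizeProg_spec (ω := ω) (e := .reg 1) (dst := 6)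
    hN y₃ ⟨by simp [RamExpr.nodes], by simp [RamExpr.ConstsLE]⟩ (y₃.1 1) (by norm_num)
  simp only [RamExpr.eval, b1] at x₄ z₄
  have x₅ := Runs.assign (ω := ω) (v := 7) (e := .cell 2 (.op .sub (.reg 1) (.const 1))) hN y₄
    ⟨by simp [RamExpr.nodes], by simp [RamExpr.ConstsLE]; omega⟩
  have c1 : τ₄.reg 1 = actCount k 1 := by rw [x₄.reg_eq 1 (by decide), b1]
  have c2 : τ₄.arr 2 = k := by
    rw [x₄.arr_eq 2 (by decide), x₃.arr_eq 2 (by decide), x₂.arr_eq 2 (by decide), a2]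
  have e5 : (RamExpr.cell 2 (.op .sub (.reg 1) (.const 1))).eval τ₄ = k (actCount k 1 - 1) := by
    simp [RamExpr.eval, ArithOp.eval, c1, c2]
  rw [e5] at x₅
  have hkk : k (actCount k 1 - 1) ≤ N := by rw [← c2]; exact y₄.2 2 _
  have y₅ := y₄.setReg (v := 7) hkk
  set τ₅ := τ₄.setReg 7 (k (actCount k 1 - 1)) with hτ₅
  have d7 : τ₅.reg 7 = k (actCount k 1 - 1) := by simp [hτ₅, RamState.setReg]
  have d4 : τ₅.reg 4 = sumSize s k := by
    rw [x₅.reg_eq 4 (by decide), x₄.reg_eq 4 (by decide), z₃]; rfl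
  have hbr : ∃ τ, Runs ω N (.branch (.op .lt (.reg 4) (.reg 7)) (.assign 7 (.reg 4)) .skip) τ₅ τ 2 ∧
      τ.Bdd N ∧ τ.reg 7 = lastThr s k := by
    have hcond : (RamExpr.op .lt (.reg 4) (.reg 7)).eval τ₅ =
        if sumSize s k < k (actCount k 1 - 1) then 1 else 0 := by
      simp [RamExpr.eval, ArithOp.eval, d4, d7]
    by_cases hlt : sumSize s k < k (actCount k 1 - 1)
    · refine ⟨_, Runs.mono (Runs.branch_true hN y₅ ⟨by simp [RamExpr.nodes],
        by simp [RamExpr.ConstsLE]⟩ (by rw [hcond, if_pos hlt]; norm_num)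
        (Runs.assign hN y₅ ⟨by simp [RamExpr.nodes], by simp [RamExpr.ConstsLE]⟩)) (by omega),
        y₅.setReg (y₅.1 4), ?_⟩
      simp [RamState.setReg, RamExpr.eval, d4, lastThr, min_eq_right hlt.le]
    · refine ⟨_, Runs.mono (Runs.branch_false hN y₅ ⟨by simp [RamExpr.nodes],
        by simp [RamExpr.ConstsLE]⟩ (by rw [hcond, if_neg hlt]) (Runs.skip _)) (by omega), y₅, ?_⟩
      rw [d7, lastThr, min_eq_left (not_lt.1 hlt)]
  obtain ⟨τ₆, x₆, y₆, z₆⟩ := hbr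
  have e2 : τ₆.arr 2 = k := by rw [x₆.arr_eq 2 (by decide), x₅.arr_eq 2 (by decide), c2]
  obtain ⟨τ₇, x₇, y₇, z₇⟩ := sizeProg_spec (ω := ω) (e := .cell 2 (.const 0)) (dst := 9)
    hN y₆ ⟨by simp [RamExpr.nodes], by simp [RamExpr.ConstsLE]⟩ (y₆.2 2 _) (by norm_num)
  simp only [RamExpr.eval, e2] at x₇ z₇
  have x₈ := Runs.assign (ω := ω) (v := 9) (e := .op .sub (.reg 9) (.const 1)) hN y₇
    ⟨by simp [RamExpr.nodes], by simp [RamExpr.ConstsLE]; omega⟩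
  have e8 : (RamExpr.op .sub (.reg 9) (.const 1)).eval τ₇ = (k 0).size - 1 := by
    simp [RamExpr.eval, ArithOp.eval, z₇]
  rw [e8] at x₈
  have y₈ := y₇.setReg (v := 9) (a := (k 0).size - 1) (by have := (k 0).size_le_self; omega)
  set τ₈ := τ₇.setReg 9 ((k 0).size - 1) with hτ₈
  have x₉ := Runs.assign (ω := ω) (v := 10) (e := .reg 1) hN y₈
    ⟨by simp [RamExpr.nodes], by simp [RamExpr.ConstsLE]⟩
  have y₉ := y₈.setReg (v := 10) (y₈.1 1)
  have f1 : τ₈.reg 1 = actCount k 1 := by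
    rw [x₈.reg_eq 1 (by decide), x₇.reg_eq 1 (by decide), x₆.reg_eq 1 (by decide),
      x₅.reg_eq 1 (by decide), c1]
  refine ⟨_, (x₁.seq (x₂.seq (x₃.seq (x₄.seq (x₅.seq (x₆.seq (x₇.seq (x₈.seq x₉)))))))).mono ?_,
    y₉, ?_⟩
  · have h1 := Nat.size_le_size hs
    have h2 := (actCount k 1).size_le_self
    have h3 := Nat.size_le_size hk
    omega
  · have g3 : τ₈.reg 3 = actSum s k 1 := by
      rw [x₈.reg_eq 3 (by decide), x₇.reg_eq 3 (by decide), x₆.reg_eq 3 (by decide),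
        x₅.reg_eq 3 (by decide), x₄.reg_eq 3 (by decide), x₃.reg_eq 3 (by decide), w₂]
    have g4 : τ₈.reg 4 = sumSize s k := by
      rw [x₈.reg_eq 4 (by decide), x₇.reg_eq 4 (by decide), x₆.reg_eq 4 (by decide), d4]
    have g6 : τ₈.reg 6 = (actCount k 1).size := by
      rw [x₈.reg_eq 6 (by decide), x₇.reg_eq 6 (by decide), x₆.reg_eq 6 (by decide),
        x₅.reg_eq 6 (by decide), z₄]
    have g7 : τ₈.reg 7 = lastThr s k := by
      rw [x₈.reg_eq 7 (by decide), x₇.reg_eq 7 (by decide), z₆]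
    have g9 : τ₈.reg 9 = (k 0).size - 1 := by simp [hτ₈, RamState.setReg]
    simp [RamState.setReg, RamExpr.eval, f1, g3, g4, g6, g7, g9]

open Classical in
/-- The state of a party at the end of the protocol. -/
noncomputable def finalState (ω : ℕ → Bool) (flag B n : ℕ) (s k S z A : ℕ → ℕ) : PState :=
  if actCount k 1 = 0 then ⟨0, 0, z, A⟩
  else runLevels ω flag B n s k S ((k 0).size - 1) ⟨0, 0, z, A⟩

/-- Number of elementary steps of the whole protocol. -/
def totalSteps (B n : ℕ) : ℕ :=
  9 * n + 6 * n.size + 60 + (n.size + 1) * (levelSteps B n + 1)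

/-- Boundedness is required only after registers 1 and 2 have been reset: with empty sets allowed,
`t` is not bounded in terms of `n`, and neither is the length of an arbitrary message. -/
theorem partyProg_spec {B n flag : ℕ} (hf : flag ≤ 1) {s k S : ℕ → ℕ} (hp : ParamBounds n s k)
    (hthr : actCount k 1 ≠ 0 → 1 ≤ lastThr s k) (hS : ∀ i < actSum s k 1, S i < n)
    {σ : RamState} (hσ : ((σ.setReg 2 0).setReg 1 0).Bdd (numBound B n)) (h0 : σ.reg 0 = n)
    (h1 : σ.arr 1 = s) (h2 : σ.arr 2 = k) (h3 : σ.arr 3 = S)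
    (hA : ∀ c, σ.arr 4 c < 2) (hpos : σ.pos = 0) :
    ∃ τ, Runs ω (numBound B n) (partyProg B flag) σ τ (totalSteps B n) ∧
      τ.reg 2 = (finalState ω flag B n s k S (σ.arr 0) (σ.arr 4)).off ∧
      τ.arr 4 = (finalState ω flag B n s k S (σ.arr 0) (σ.arr 4)).A ∧
      ∀ j < n, τ.arr 5 j = (finalState ω flag B n s k S (σ.arr 0) (σ.arr 4)).z j := by
  set N := numBound B n with hNdef
  have hnN : 2 * n + 2 ≤ N := two_mul_le_numBound B n
  have hN : 2 ≤ N := by omega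
  -- Before the resets no bound on the registers is available, but assigning a constant reads none
  -- of them.
  have hconst : ∀ (v : ℕ) (σ : RamState), Runs ω N (.assign v (.const 0)) σ (σ.setReg v 0) 1 := by
    intro v σ
    refine ⟨_, .assign v _ σ, ?_⟩
    simp [RamExpr.cost, stepUnit]
    omega
  have x₁ := hconst 2 σ
  have x₂ := hconst 1 (σ.setReg 2 0)
  set τ₂ := (σ.setReg 2 0).setReg 1 0 with hτ₂
  have a0 : τ₂.reg 0 = n := by simp [hτ₂, RamState.setReg, h0]
  have a2 : τ₂.reg 2 = 0 := by simp [hτ₂, RamState.setReg]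
  obtain ⟨τ₃, x₃, y₃, b3, b4, b6, b7, b9, b10⟩ := setupProg_spec (ω := ω) hN hσ hp
    (by simpa [hτ₂, RamState.setReg] using h1) (by simpa [hτ₂, RamState.setReg] using h2)
    (by omega)
  have hv : LevelView n s k S ⟨0, 0, σ.arr 0, σ.arr 4⟩ τ₃ :=
    { r0 := by rw [x₃.reg_eq 0 (by decide), a0]
      r2 := by rw [x₃.reg_eq 2 (by decide), a2]
      r3 := b3
      r4 := b4
      r6 := b6
      r7 := b7
      a0 := by rw [x₃.arr_eq 0 (by decide)]; rfl
      a1 := by rw [x₃.arr_eq 1 (by decide)]; exact h1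
      a2 := by rw [x₃.arr_eq 2 (by decide)]; exact h2
      a3 := by rw [x₃.arr_eq 3 (by decide)]; exact h3
      a4 := by rw [x₃.arr_eq 4 (by decide)]; rfl
      pos := by rw [x₃.pos_eq (by decide)]; exact hpos }
  have hk := Nat.size_le_size hp.head_le
  have hloop : ∃ τ, Runs ω N (.loop (.reg 10) (levelProg B flag)) τ₃ τ
      ((n.size + 1) * (levelSteps B n + 1) + 1) ∧ τ.Bdd N ∧
      LevelView n s k S (finalState ω flag B n s k S (σ.arr 0) (σ.arr 4)) τ := by
    unfold finalState
    by_cases hc : actCount k 1 = 0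
    · rw [if_pos hc]
      refine ⟨τ₃, ⟨_, .loop_done (by rw [RamExpr.eval, b10, hc]), ?_⟩, y₃, hv⟩
      have hsm : (RamExpr.reg 10).Small N := ⟨by simp [RamExpr.nodes], by simp [RamExpr.ConstsLE]⟩
      have := hsm.cost_le hN y₃
      have hu : 1 + (RamExpr.reg 10).cost τ₃ ≤ stepUnit N := by unfold stepUnit; omega
      rw [add_mul, one_mul]; omega
    · rw [if_neg hc]
      have hk0 : k 0 ≠ 0 := by
        intro h0
        apply hc
        have := Nat.sInf_le (s := {i | k i < 1}) (m := 0) (by simp [h0])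
        unfold actCount; omega
      have hsz : 0 < (k 0).size := Nat.size_pos.2 (by omega)
      obtain ⟨τ, x, y, z⟩ := levelsLoop_spec (ω := ω) (B := B) hf hp hS (hthr hc) ((k 0).size - 1)
        _ τ₃ y₃ hv b9 (by rw [b10]; exact hc)
        ((Nat.lt_size.1 (by omega)).trans hp.head_le) (Nat.zero_le _) hA
      refine ⟨τ, x.mono ?_, y, z⟩
      gcongr; omega
  obtain ⟨τ₄, x₄, y₄, z₄⟩ := hloop
  obtain ⟨τ₅, x₅, y₅, z₅⟩ := copyProg_spec (ω := ω) hN y₄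
  rw [z₄.r0] at x₅ z₅
  rw [z₄.a0] at z₅
  refine ⟨τ₅, (x₁.seq (x₂.seq (x₃.seq (x₄.seq x₅)))).mono ?_, ?_, ?_, z₅⟩
  · unfold totalSteps; omega
  · rw [x₅.reg_eq 2 (by decide), z₄.r2]
  · rw [x₅.arr_eq 4 (by decide), z₄.a4]

end

/-! ### Collisions of uniformly random hash functions -/

/-- Resampling one coordinate preserves averages: `(g, c) ↦ (update g b c, g b)` is an involution.
-/
theorem sum_sum_update {ι W : Type*} [Fintype ι] [DecidableEq ι] [Fintype W] (b : ι) (F : (ι → W) → ℕ) :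
    ∑ g : ι → W, ∑ c : W, F (Function.update g b c) = Fintype.card W * ∑ g, F g := by
  have e : ∑ x : (ι → W) × W, F (Function.update x.1 b x.2) = ∑ x : (ι → W) × W, F x.1 := by
    refine Finset.sum_bij' (fun x _ => (Function.update x.1 b x.2, x.1 b))
      (fun x _ => (Function.update x.1 b x.2, x.1 b)) ?_ ?_ ?_ ?_ ?_ <;> simp
  rw [Fintype.sum_prod_type, Fintype.sum_prod_type] at e
  rw [e, Finset.mul_sum]
  simp

section
variable {ι W : Type*} [Fintype ι] [DecidableEq ι] [Fintype W] [DecidableEq W]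

/-- The members of `B` that share their cell with another member of `E`. -/
def collided (g : ι → W) (E B : Finset ι) : Finset ι := {b ∈ B | ∃ v ∈ E, v ≠ b ∧ g v = g b}

/-- After `E₀`, the members of `B` are exposed one at a time, and `Y` counts those landing in an
occupied cell. A landing makes at most two members of `B` newly collided: the newcomer and one that
was alone in its cell. Given the past, a landing has probability at most `1 / μ`, so each step
multiplies the mean of `μ ^ Y` by at most `1 + μ * (1 / μ) = 2`. -/
theorem exists_landings (μ : ℕ) (E₀ B : Finset ι) (hd : Disjoint E₀ B)
    (hW : μ * (E₀.card + B.card) ≤ Fintype.card W) (hW0 : 0 < Fintype.card W) :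
    ∃ Y : (ι → W) → ℕ, (∀ g g', (∀ v ∈ E₀ ∪ B, g v = g' v) → Y g = Y g') ∧
      (∀ g, (collided g (E₀ ∪ B) B).card ≤ 2 * Y g) ∧
      ∑ g, μ ^ Y g ≤ 2 ^ B.card * Fintype.card (ι → W) := by
  induction B using Finset.induction_on with
  | empty => exact ⟨fun _ => 0, by simp, by simp [collided], by simp⟩
  | insert b B hb ih =>
    rw [Finset.disjoint_insert_right] at hd
    rw [Finset.card_insert_of_notMem hb] at hW ⊢
    obtain ⟨Y, h1, h2, h3⟩ := ih hd.2 ((Nat.mul_le_mul_left _ (by omega)).trans hW)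
    have hbU : b ∉ E₀ ∪ B := by simp [hb, hd.1]
    refine ⟨fun g => Y g + if ∃ v ∈ E₀ ∪ B, g v = g b then 1 else 0, ?_, ?_, ?_⟩
    · intro g g' h
      have hU : ∀ v ∈ E₀ ∪ B, g v = g' v := fun v hv => h v (by
        simp only [Finset.mem_union, Finset.mem_insert] at hv ⊢; tauto)
      have hbb : g b = g' b := h b (by simp)
      have : (∃ v ∈ E₀ ∪ B, g v = g b) ↔ ∃ v ∈ E₀ ∪ B, g' v = g' b :=
        exists_congr fun v => and_congr_right fun hv => by rw [hU v hv, hbb]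
      simp only [h1 g g' hU, this]
    · intro g
      have hg := h2 g
      by_cases hl : ∃ v ∈ E₀ ∪ B, g v = g b
      · simp only [if_pos hl]
        -- The members of `B` in the cell of `b` that had not collided before; two of them would
        -- have collided with each other.
        set R : Finset ι := {b' ∈ B | g b' = g b ∧ b' ∉ collided g (E₀ ∪ B) B} with hR
        have hR1 : R.card ≤ 1 := by
          rw [Finset.card_le_one]
          intro x hx y hy
          by_contra hxy
          simp only [hR, Finset.mem_filter] at hx hy
          exact hx.2.2 (Finset.mem_filter.2 ⟨hx.1, y, Finset.mem_union_right _ hy.1, Ne.symm hxy,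
            by rw [hx.2.1, hy.2.1]⟩)
        have hsub : collided g (E₀ ∪ insert b B) (insert b B) ⊆
            insert b (collided g (E₀ ∪ B) B ∪ R) := by
          intro x hx
          simp only [collided, Finset.mem_filter] at hx
          obtain ⟨hx1, v, hv, hvx, hgv⟩ := hx
          rw [Finset.mem_insert] at hx1 ⊢
          rcases hx1 with rfl | hxB
          · exact .inl rfl
          · right
            rw [Finset.mem_union]
            by_cases hxc : x ∈ collided g (E₀ ∪ B) B
            · exact .inl hxc
            · right
              refine Finset.mem_filter.2 ⟨hxB, ?_, hxc⟩
              by_cases hvb : v = b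
              · rw [← hvb, hgv]
              · exact absurd (Finset.mem_filter.2 ⟨hxB, v, by
                  simp only [Finset.mem_union, Finset.mem_insert] at hv ⊢; tauto, hvx, hgv⟩) hxc
        have := Finset.card_le_card hsub
        have h4 := Finset.card_insert_le b (collided g (E₀ ∪ B) B ∪ R)
        have h5 := Finset.card_union_le (collided g (E₀ ∪ B) B) R
        omega
      · simp only [if_neg hl, add_zero]
        refine (Finset.card_le_card ?_).trans hg
        intro x hx
        simp only [collided, Finset.mem_filter] at hx ⊢
        obtain ⟨hx1, v, hv, hvx, hgv⟩ := hx
        rw [Finset.mem_insert] at hx1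
        rcases hx1 with rfl | hxB
        · exact absurd ⟨v, by simp only [Finset.mem_union, Finset.mem_insert] at hv ⊢; tauto, hgv⟩ hl
        · refine ⟨hxB, v, ?_, hvx, hgv⟩
          have : v ≠ b := by
            rintro rfl
            exact hl ⟨x, Finset.mem_union_right _ hxB, hgv.symm⟩
          simp only [Finset.mem_union, Finset.mem_insert] at hv ⊢; tauto
    · have key : Fintype.card W * ∑ g : ι → W,
          μ ^ (Y g + if ∃ v ∈ E₀ ∪ B, g v = g b then 1 else 0) ≤
          Fintype.card W * (2 * ∑ g, μ ^ Y g) := by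
        -- The value at `b` is resampled. It does not affect `Y`, which depends only on `E₀ ∪ B`.
        rw [← sum_sum_update b, mul_left_comm, Finset.mul_sum, Finset.mul_sum]
        refine Finset.sum_le_sum fun g _ => ?_
        have hupd : ∀ c, ∀ v ∈ E₀ ∪ B, Function.update g b c v = g v := fun c v hv =>
          Function.update_of_ne (by rintro rfl; exact hbU hv) _ _
        have hterm : ∀ c, μ ^ (Y (Function.update g b c) +
            if ∃ v ∈ E₀ ∪ B, Function.update g b c v = Function.update g b c b then 1 else 0) ≤
            μ ^ Y g * (1 + if c ∈ (E₀ ∪ B).image g then μ else 0) := by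
          intro c
          rw [h1 _ g (hupd c), pow_add]
          refine Nat.mul_le_mul_left _ ?_
          have : (∃ v ∈ E₀ ∪ B, Function.update g b c v = Function.update g b c b) ↔
              c ∈ (E₀ ∪ B).image g := by
            rw [Finset.mem_image]
            exact exists_congr fun v => and_congr_right fun hv => by
              rw [hupd c v hv, Function.update_self]
          simp only [this]
          split_ifs <;> simp
        refine (Finset.sum_le_sum fun c _ => hterm c).trans ?_
        rw [← Finset.mul_sum, Finset.sum_add_distrib]
        -- At most `E₀.card + B.card` cells are occupied, so the weight `μ` on them sums to at most
        -- the number of cells.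
        have himg : ∑ c : W, (if c ∈ (E₀ ∪ B).image g then μ else 0) ≤ Fintype.card W := by
          rw [Finset.sum_ite_mem, Finset.univ_inter, Finset.sum_const, smul_eq_mul, mul_comm]
          have h6 : ((E₀ ∪ B).image g).card ≤ E₀.card + B.card :=
            Finset.card_image_le.trans (Finset.card_union_le _ _)
          exact (Nat.mul_le_mul_left μ (by omega)).trans hW
        have : ∑ _c : W, 1 = Fintype.card W := by simp
        rw [this]
        nlinarith [Nat.mul_le_mul_left (μ ^ Y g) himg]
      have := Nat.le_of_mul_le_mul_left key hW0
      rw [pow_succ]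
      nlinarith

/-- The number of tables in which `b` shares its cell with another member of `E`. -/
def collCount {d : ℕ} (h : Fin d → ι → W) (E : Finset ι) (b : ι) : ℕ :=
  (Finset.univ.filter fun τ => ∃ v ∈ E, v ≠ b ∧ h τ v = h τ b).card

/-- If each of the `m` members collides in at least `2 * d` of the `4 * d` tables, the total number
of landings is at least `m * d`. Markov's inequality with base `2 ^ (G + 4)` applies to the product
of the moments of the tables, which is at most `2 ^ (4 * m * d)` on average. -/
theorem card_all_collided (d m G : ℕ) (E B : Finset ι) (hB : B.card = m)
    (hW : 2 ^ (G + 4) * (E.card + m) ≤ Fintype.card W) (hW0 : 0 < Fintype.card W) :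
    (Finset.univ.filter fun h : Fin (4 * d) → ι → W =>
      ∀ b ∈ B, 4 * d ≤ 2 * collCount h E b).card * 2 ^ (G * m * d) ≤
      Fintype.card (Fin (4 * d) → ι → W) := by
  obtain ⟨Y, -, h2, h3⟩ := exists_landings (W := W) (2 ^ (G + 4)) (E \ B) B
    Finset.sdiff_disjoint ((Nat.mul_le_mul_left _ (by
      have := Finset.card_le_card (Finset.sdiff_subset (s := E) (t := B)); omega)).trans hW) hW0
  have hpow : ∑ h : Fin (4 * d) → ι → W, ∏ τ, (2 ^ (G + 4)) ^ Y (h τ) ≤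
      (2 ^ m * Fintype.card (ι → W)) ^ (4 * d) := by
    rw [← Fintype.sum_pow (fun g : ι → W => (2 ^ (G + 4)) ^ Y g) (4 * d), ← hB]
    exact Nat.pow_le_pow_left h3 _
  have hlow : (Finset.univ.filter fun h : Fin (4 * d) → ι → W =>
      ∀ b ∈ B, 4 * d ≤ 2 * collCount h E b).card * (2 ^ (G + 4)) ^ (m * d) ≤
      ∑ h : Fin (4 * d) → ι → W, ∏ τ, (2 ^ (G + 4)) ^ Y (h τ) := by
    rw [← smul_eq_mul, ← Finset.sum_const]
    refine (Finset.sum_le_sum fun h hh => ?_).trans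
      (Finset.sum_le_sum_of_subset (Finset.filter_subset _ _))
    rw [Finset.prod_pow_eq_pow_sum]
    refine Nat.pow_le_pow_right (by positivity) ?_
    rw [Finset.mem_filter] at hh
    have hdc : ∑ b ∈ B, collCount h E b ≤ ∑ τ, (collided (h τ) (E \ B ∪ B) B).card := by
      simp only [collCount, collided, Finset.card_filter]
      rw [Finset.sum_comm]
      refine Finset.sum_le_sum fun τ _ => Finset.sum_le_sum fun b _ => ?_
      by_cases hx : ∃ v ∈ E, v ≠ b ∧ h τ v = h τ b
      · have : ∃ v ∈ E \ B ∪ B, v ≠ b ∧ h τ v = h τ b := by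
          obtain ⟨v, hv, hh⟩ := hx
          exact ⟨v, by simp [hv], hh⟩
        rw [if_pos hx, if_pos this]
      · rw [if_neg hx]; exact Nat.zero_le _
    have hsum : ∑ b ∈ B, 4 * d ≤ ∑ b ∈ B, 2 * collCount h E b := Finset.sum_le_sum hh.2
    rw [Finset.sum_const, smul_eq_mul, hB, ← Finset.mul_sum] at hsum
    have hY : ∑ τ, (collided (h τ) (E \ B ∪ B) B).card ≤ ∑ τ, 2 * Y (h τ) :=
      Finset.sum_le_sum fun τ _ => h2 _
    rw [← Finset.mul_sum] at hY
    have : m * (4 * d) = 4 * (m * d) := by ring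
    omega
  have hcard : Fintype.card (Fin (4 * d) → ι → W) = Fintype.card (ι → W) ^ (4 * d) := by simp
  rw [hcard]
  have hall := hlow.trans hpow
  rw [mul_pow] at hall
  -- The `4` in `G + 4` is exactly what the moments over `4 * d` tables cost; `G` is the net gain.
  have e1 : (2 ^ (G + 4)) ^ (m * d) = 2 ^ (G * m * d) * (2 ^ m) ^ (4 * d) := by
    rw [← pow_mul, ← pow_mul, ← pow_add]; congr 1; ring
  rw [e1, ← mul_assoc, mul_comm ((2 ^ m) ^ (4 * d))] at hall
  exact Nat.le_of_mul_le_mul_right hall (by positivity)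

/-- Union bound over the `m`-element subsets of `P`. -/
theorem card_many_collided (d m G : ℕ) (E P : Finset ι)
    (hW : 2 ^ (G + 4) * (E.card + m) ≤ Fintype.card W) (hW0 : 0 < Fintype.card W) :
    (Finset.univ.filter fun h : Fin (4 * d) → ι → W =>
      m ≤ (P.filter fun b => 4 * d ≤ 2 * collCount h E b).card).card * 2 ^ (G * m * d) ≤
      P.card.choose m * Fintype.card (Fin (4 * d) → ι → W) := by
  have hsub : (Finset.univ.filter fun h : Fin (4 * d) → ι → W =>
      m ≤ (P.filter fun b => 4 * d ≤ 2 * collCount h E b).card) ⊆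
      (P.powersetCard m).biUnion fun B => Finset.univ.filter fun h : Fin (4 * d) → ι → W =>
        ∀ b ∈ B, 4 * d ≤ 2 * collCount h E b := by
    intro h hh
    rw [Finset.mem_filter] at hh
    obtain ⟨B, hB, hBc⟩ := Finset.exists_subset_card_eq hh.2
    rw [Finset.mem_biUnion]
    exact ⟨B, Finset.mem_powersetCard.2 ⟨hB.trans (Finset.filter_subset _ _), hBc⟩,
      Finset.mem_filter.2 ⟨Finset.mem_univ _, fun b hb => (Finset.mem_filter.1 (hB hb)).2⟩⟩
  refine (Nat.mul_le_mul_right _ ((Finset.card_le_card hsub).trans Finset.card_biUnion_le)).trans ?_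
  rw [Finset.sum_mul, ← Finset.card_powersetCard, ← smul_eq_mul (a := (P.powersetCard m).card)]
  refine Finset.sum_le_card_nsmul _ _ _ fun B hB => ?_
  exact card_all_collided d m G E B (Finset.mem_powersetCard.1 hB).2 hW hW0

end

/-! ### Fresh coins -/

instance : IsProbabilityMeasure fairCoins := by unfold fairCoins; infer_instance

theorem coin_singleton (v : Bool) :
    (PMF.uniformOfFintype Bool).toMeasure {v} = (2 : ENNReal)⁻¹ := by
  rw [PMF.toMeasure_apply_singleton _ _ (measurableSet_singleton _)]
  simp

theorem fairCoins_preimage_card {α : Type} [Fintype α] (f : α → ℕ) (hf : Function.Injective f)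
    (Z : Finset (α → Bool)) :
    fairCoins {ω | (fun i => ω (f i)) ∈ Z} = Z.card * ((2 : ENNReal)⁻¹) ^ Fintype.card α := by
  classical
  have hm : Measurable fun (ω : ℕ → Bool) (i : α) => ω (f i) := by fun_prop
  have hmap := Measure.map_infinitePi_infinitePi_of_inj
    (P := fun _ : ℕ => (PMF.uniformOfFintype Bool).toMeasure) hf
  have hpre : {ω : ℕ → Bool | (fun i => ω (f i)) ∈ Z} =
      (fun (ω : ℕ → Bool) (i : α) => ω (f i)) ⁻¹' (Z : Set (α → Bool)) := rfl
  rw [hpre, ← Measure.map_apply hm Z.finite_toSet.measurableSet, fairCoins, hmap]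
  rw [← sum_measure_singleton]
  simp only [Measure.infinitePi_singleton_of_fintype, coin_singleton, Finset.prod_const,
    Finset.card_univ, Finset.sum_const, nsmul_eq_mul]

/-- An event about fresh coins is no more likely if it is chosen in the light of older coins. -/
theorem fairCoins_fresh {α : Type} [Finite α] (p q : ℕ) (F : (ℕ → Bool) → α)
    (hF : ∀ ω ω' : ℕ → Bool, (∀ i < p, ω i = ω' i) → F ω = F ω') (U : α → Set (ℕ → Bool))
    (hU : ∀ a (ω ω' : ℕ → Bool), (∀ i, p ≤ i → i < q → ω i = ω' i) → ω ∈ U a → ω' ∈ U a)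
    (ε : ENNReal) (hε : ∀ a, fairCoins (U a) ≤ ε) : fairCoins {ω | ω ∈ U (F ω)} ≤ ε := by
  classical
  have := Fintype.ofFinite α
  have hind : ProbabilityTheory.iIndepFun (fun (i : ℕ) (ω : ℕ → Bool) => ω i) fairCoins :=
    ProbabilityTheory.iIndepFun_infinitePi (X := fun _ ω => ω) (fun _ => measurable_id)
  have hdis : Disjoint (Finset.range p) (Finset.Ico p q) := by
    rw [Finset.disjoint_left]; intro i; simp; omega
  have hind2 := hind.indepFun_finset (Finset.range p) (Finset.Ico p q) hdis
    (fun i => measurable_pi_apply i)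
  -- Padding a finite block of coins by `false` exhibits the events as preimages of sets of finite
  -- coin blocks. This makes them measurable and lets independence of disjoint blocks apply.
  let ext : (T : Finset ℕ) → (T → Bool) → ℕ → Bool := fun T x i =>
    if h : i ∈ T then x ⟨i, h⟩ else false
  have hA : ∀ a, {ω | F ω = a} = (fun (ω : ℕ → Bool) (i : Finset.range p) => ω i) ⁻¹'
      {x | F (ext _ x) = a} := by
    intro a
    ext ω
    have : F ω = F (ext (Finset.range p) fun i => ω i) := hF _ _ fun i hi => by
      simp [ext, hi]
    simp only [Set.mem_preimage, Set.mem_ofPred_eq, this]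
  have hB : ∀ a, U a = (fun (ω : ℕ → Bool) (i : Finset.Ico p q) => ω i) ⁻¹'
      {x | ext _ x ∈ U a} := by
    intro a
    ext ω
    constructor
    · exact hU a _ _ fun i h1 h2 => by simp [ext, h1, h2]
    · exact hU a _ _ fun i h1 h2 => by simp [ext, h1, h2]
  have hAm : ∀ a, MeasurableSet {ω | F ω = a} := by
    intro a
    rw [hA a]
    exact (measurable_pi_lambda _ fun i => measurable_pi_apply _)
      (Set.toFinite _).measurableSet
  have hsplit : {ω | ω ∈ U (F ω)} = ⋃ a ∈ (Finset.univ : Finset α), ({ω | F ω = a} ∩ U a) := by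
    ext ω; simp
  rw [hsplit]
  calc fairCoins (⋃ a ∈ (Finset.univ : Finset α), ({ω | F ω = a} ∩ U a))
      ≤ ∑ a, fairCoins ({ω | F ω = a} ∩ U a) := measure_biUnion_finset_le _ _
    _ = ∑ a, fairCoins {ω | F ω = a} * fairCoins (U a) := by
        refine Finset.sum_congr rfl fun a _ => ?_
        rw [hA a, hB a]
        exact hind2.measure_inter_preimage_eq_mul _ _ (Set.toFinite _).measurableSet
          (Set.toFinite _).measurableSet
    _ ≤ ∑ a, fairCoins {ω | F ω = a} * ε := by
        refine Finset.sum_le_sum fun a _ => by gcongr; exact hε a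
    _ = fairCoins (⋃ a ∈ (Finset.univ : Finset α), {ω | F ω = a}) * ε := by
        rw [← Finset.sum_mul, measure_biUnion_finset]
        · intro a _ a' _ haa
          rw [Function.onFun, Set.disjoint_left]
          intro ω h h'
          exact haa (h.symm.trans h')
        · exact fun a _ => hAm a
    _ ≤ 1 * ε := by gcongr; exact prob_le_one
    _ = ε := one_mul _

theorem coinNum_congr {ω ω' : ℕ → Bool} {p p' b : ℕ}
    (h : ∀ i < b, ω (p + i) = ω' (p' + i)) : coinNum ω p b = coinNum ω' p' b := by
  induction b with
  | zero => rfl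
  | succ b ih => simp only [coinNum]; rw [ih fun i hi => h i (by omega), h b (by omega)]

/-- Equality of cell numbers is thereby equality of coin blocks, so the hash values may be treated
as uniform elements of `Fin b → Bool`. -/
theorem coinNum_inj {ω ω' : ℕ → Bool} {p p' b : ℕ} (h : coinNum ω p b = coinNum ω' p' b) :
    ∀ i < b, ω (p + i) = ω' (p' + i) := by
  induction b with
  | zero => intro i hi; omega
  | succ b ih =>
    simp only [coinNum] at h
    have h1 := Bool.toNat_le (ω (p + b))
    have h2 := Bool.toNat_le (ω' (p' + b))
    have h3 : (ω (p + b)).toNat = (ω' (p' + b)).toNat := by omega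
    have h4 : coinNum ω p b = coinNum ω' p' b := by omega
    intro i hi
    by_cases hib : i = b
    · subst hib
      revert h3
      cases ω (p + i) <;> cases ω' (p' + i) <;> simp
    · exact ih h4 i (by omega)

/-- The number of tables among `d` in which `j` shares its cell with another member of `E`. -/
def levelColl (ω : ℕ → Bool) {n : ℕ} (b mode p d : ℕ) (E : Finset (Fin n)) (j : Fin n) : ℕ :=
  (Finset.univ.filter fun τ : Fin d => ∃ v ∈ E, v ≠ j ∧
    hashVal ω b mode (p + τ * (n * b)) v = hashVal ω b mode (p + τ * (n * b)) j).card

theorem hashVal_congr {ω ω' : ℕ → Bool} {n b mode p d : ℕ}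
    (h : ∀ i, p ≤ i → i < p + d * (n * b) → ω i = ω' i) {τ : ℕ} (hτ : τ < d) {j : ℕ} (hj : j < n) :
    hashVal ω b mode (p + τ * (n * b)) j = hashVal ω' b mode (p + τ * (n * b)) j := by
  unfold hashVal
  rw [coinNum_congr (ω := ω) (ω' := ω') (p' := p + τ * (n * b) + j * b)]
  intro i hi
  apply h
  · omega
  · have h1 : (τ + 1) * (n * b) ≤ d * (n * b) := Nat.mul_le_mul_right _ hτ
    have h2 : (j + 1) * b ≤ n * b := Nat.mul_le_mul_right _ hj
    rw [add_mul] at h1 h2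
    omega

theorem levelColl_congr {ω ω' : ℕ → Bool} {n b mode p d : ℕ}
    (h : ∀ i, p ≤ i → i < p + d * (n * b) → ω i = ω' i) (E : Finset (Fin n)) (j : Fin n) :
    levelColl ω b mode p d E j = levelColl ω' b mode p d E j := by
  unfold levelColl
  congr 1
  refine Finset.filter_congr fun τ _ => exists_congr fun v => and_congr_right fun _ =>
    and_congr_right fun _ => ?_
  rw [hashVal_congr h τ.2 v.2, hashVal_congr h τ.2 j.2]

theorem levelColl_eq_collCount (ω : ℕ → Bool) {n : ℕ} (b p d : ℕ) (E : Finset (Fin n))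
    (j : Fin n) : levelColl ω b 0 p d E j = collCount
      (fun (τ : Fin d) (j : Fin n) (i : Fin b) => ω (p + (i + b * j + n * b * τ))) E j := by
  unfold levelColl collCount
  refine congrArg Finset.card (Finset.ext fun τ => ?_)
  simp only [Finset.mem_filter, Finset.mem_univ, true_and]
  refine exists_congr fun v => and_congr_right fun _ => and_congr_right fun _ => ?_
  simp only [hashVal, zero_mul, mul_zero, zero_add]
  have e : ∀ (v : Fin n) (i : ℕ), p + τ * (n * b) + v * b + i = p + (i + b * v + n * b * τ) := by
    intro v i; ring
  constructor
  · intro h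
    funext i
    have := coinNum_inj h i i.2
    rwa [e, e] at this
  · intro h
    refine coinNum_congr fun i hi => ?_
    rw [e, e]
    exact congrFun h ⟨i, hi⟩

/-- With fresh coins few positions collide in at least half of the tables. -/
theorem fairCoins_many_collided {n : ℕ} (b p d m G : ℕ) (E P : Finset (Fin n))
    (hW : 2 ^ (G + 4) * (E.card + m) ≤ 2 ^ b) :
    fairCoins {ω | m ≤ (P.filter fun j => 4 * d ≤ 2 * levelColl ω b 0 p (4 * d) E j).card} ≤
      (P.card.choose m : ENNReal) / 2 ^ (G * m * d) := by
  classical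
  set f : Fin (4 * d) × Fin n × Fin b → ℕ := fun x => p + (x.2.2 + b * x.2.1 + n * b * x.1) with hf
  have hinj : Function.Injective f := by
    -- The coins are numbered lexicographically by table, position and bit, so distinctness is the
    -- injectivity of `finProdFinEquiv`.
    have : f = fun x => p + (finProdFinEquiv (x.1, finProdFinEquiv x.2)).val := by
      funext x; simp [hf, finProdFinEquiv]
    rw [this]
    rintro ⟨τ, x⟩ ⟨τ', x'⟩ h
    have h2 := finProdFinEquiv.injective (Fin.ext (Nat.add_left_cancel h))
    rw [Prod.mk.injEq] at h2
    exact Prod.ext h2.1 (finProdFinEquiv.injective h2.2)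
  let Φ : (Fin (4 * d) × Fin n × Fin b → Bool) ≃ (Fin (4 * d) → Fin n → Fin b → Bool) :=
    (Equiv.curry _ _ _).trans (Equiv.piCongrRight fun _ => Equiv.curry _ _ _)
  set Z' := Finset.univ.filter fun h : Fin (4 * d) → Fin n → Fin b → Bool =>
      m ≤ (P.filter fun j => 4 * d ≤ 2 * collCount h E j).card with hZ'
  have hset : {ω | m ≤ (P.filter fun j => 4 * d ≤ 2 * levelColl ω b 0 p (4 * d) E j).card} =
      {ω | (fun i => ω (f i)) ∈ Z'.map Φ.symm.toEmbedding} := by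
    ext ω
    have hΦ : Φ (fun i => ω (f i)) = fun (τ : Fin (4 * d)) (j : Fin n) (i : Fin b) =>
        ω (p + (i + b * j + n * b * τ)) := rfl
    simp only [Set.mem_ofPred_eq, Finset.mem_map_equiv, Equiv.symm_symm, hΦ, hZ',
      Finset.mem_filter, Finset.mem_univ, true_and, levelColl_eq_collCount]
  rw [hset, fairCoins_preimage_card f hinj, Finset.card_map]
  have hcard := card_many_collided (W := Fin b → Bool) d m G E P (by simpa using hW) (by simp)
  rw [← hZ'] at hcard
  have hc : Fintype.card (Fin (4 * d) → Fin n → Fin b → Bool) =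
      2 ^ Fintype.card (Fin (4 * d) × Fin n × Fin b) := by
    rw [← Fintype.card_congr Φ, Fintype.card_fun, Fintype.card_bool]
  rw [hc] at hcard
  rw [ENNReal.le_div_iff_mul_le (.inl (by simp)) (.inl (by simp)), mul_right_comm, ← ENNReal.inv_pow,
    ← div_eq_mul_inv, ENNReal.div_le_iff (by simp) (by simp)]
  exact_mod_cast hcard

/-! ### Decoding -/

section
variable {ω : ℕ → Bool}

theorem toggle_of_forall_ne {n off b mode p c : ℕ} {z A : ℕ → ℕ} (hA : A c < 2)
    (h : ∀ j < n, off + hashVal ω b mode p j ≠ c) : toggle ω n off b mode p z A c = A c := by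
  unfold toggle
  rw [Finset.sum_eq_zero fun j hj => if_neg (h j (Finset.mem_range.1 hj)), add_zero,
    Nat.mod_eq_of_lt hA]

variable {n w b mode off p : ℕ} {z A : ℕ → ℕ}

theorem tableSeq_of_lt (hA : ∀ c, A c < 2) (d : ℕ) {c : ℕ} (hc : c < off) :
    tableSeq ω n w b mode off p z A d c = A c := by
  induction d with
  | zero => rfl
  | succ d ih =>
    rw [tableSeq, toggle_of_forall_ne (tableSeq_lt_two hA _ _), ih]
    intro j _; omega

theorem tableSeq_of_ge (hA : ∀ c, A c < 2)
    (hw : ∀ τ j, j < n → hashVal ω b mode (p + τ * (n * b)) j < w) (d : ℕ) {c : ℕ}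
    (hc : off + d * w ≤ c) : tableSeq ω n w b mode off p z A d c = A c := by
  induction d with
  | zero => rfl
  | succ d ih =>
    rw [add_mul, one_mul] at hc
    rw [tableSeq, toggle_of_forall_ne (tableSeq_lt_two hA _ _), ih (by omega)]
    intro j hj
    have := hw d j hj
    omega

/-- The tables occupy disjoint intervals of length `w`, so a cell changes only while its own table
is filled. -/
theorem tableSeq_cell (hA : ∀ c, A c < 2)
    (hw : ∀ τ j, j < n → hashVal ω b mode (p + τ * (n * b)) j < w) {d τ r : ℕ} (hτ : τ < d)
    (hr : r < w) : tableSeq ω n w b mode off p z A d (off + τ * w + r) =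
      (A (off + τ * w + r) + ∑ j ∈ Finset.range n,
        if hashVal ω b mode (p + τ * (n * b)) j = r then z j else 0) % 2 := by
  induction d with
  | zero => omega
  | succ d ih =>
    by_cases hd : τ = d
    · subst hd
      rw [tableSeq, toggle, tableSeq_of_ge hA hw τ (by omega)]
      simp only [Nat.add_left_cancel_iff]
    · have hlt : τ < d := by omega
      rw [tableSeq, toggle_of_forall_ne (tableSeq_lt_two hA _ _), ih hlt]
      intro j _
      have h1 : (τ + 1) * w ≤ d * w := Nat.mul_le_mul_right _ hlt
      rw [add_mul] at h1
      omega

end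

/-- For every table, the parity of `x + z` in the cell of `j`, summed over the tables. -/
def parityCount (ω : ℕ → Bool) (n b mode p : ℕ) (x z : ℕ → ℕ) (d j : ℕ) : ℕ :=
  ∑ τ ∈ Finset.range d, (∑ i ∈ Finset.range n,
    if hashVal ω b mode (p + τ * (n * b)) i = hashVal ω b mode (p + τ * (n * b)) j
    then x i + z i else 0) % 2

/-- Bob's new string after a level in which the table array holds the parities of Alice's. -/
noncomputable def decodeLevel (ω : ℕ → Bool) (n : ℕ) (S x : ℕ → ℕ) (P : LevelPar) (p : ℕ)
    (z : ℕ → ℕ) : ℕ → ℕ :=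
  flipBits S P.sig P.d (parityCount ω n P.b P.mode p x z P.d) z

open Classical in
/-- Bob's string at the end. -/
noncomputable def decodeRun (ω : ℕ → Bool) (B n : ℕ) (s k S x : ℕ → ℕ) :
    ℕ → ℕ → ℕ → (ℕ → ℕ) → ℕ → ℕ
  | 0, off, p, z => decodeLevel ω n S x (levelPar B n s k off 0) p z
  | e + 1, off, p, z =>
    if lastThr s k < (levelPar B n s k off (e + 1)).q then
      decodeRun ω B n s k S x e
        (off + (levelPar B n s k off (e + 1)).d * (levelPar B n s k off (e + 1)).w)
        (p + (levelPar B n s k off (e + 1)).d * (n * (levelPar B n s k off (e + 1)).b))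
        (decodeLevel ω n S x (levelPar B n s k off (e + 1)) p z)
    else decodeLevel ω n S x (levelPar B n s k off (e + 1)) p z

section
variable {ω : ℕ → Bool} {B n : ℕ} {s k S : ℕ → ℕ}

theorem hashVal_lt_width (off e τ p j : ℕ) (hj : j < n) :
    hashVal ω (levelPar B n s k off e).b (levelPar B n s k off e).mode
      (p + τ * (n * (levelPar B n s k off e).b)) j < (levelPar B n s k off e).w := by
  rcases levelPar_cases B n s k off e with ⟨-, h⟩ | ⟨-, h⟩ <;> rw [h] <;> simp only [hashVal]
  · simpa [coinNum] using hj
  · simpa using coinNum_lt _ _ _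

theorem runLevels_off_le (flag e : ℕ) (st : PState) :
    st.off ≤ (runLevels ω flag B n s k S e st).off := by
  induction e generalizing st with
  | zero => exact Nat.le_add_right _ _
  | succ e ih =>
    rw [runLevels]
    split_ifs
    · exact le_trans (b := (stepLevel ω flag n S (levelPar B n s k st.off (e + 1)) st).off)
        (Nat.le_add_right _ _) (ih _)
    · exact Nat.le_add_right _ _

theorem runLevels_A_lt_two (flag e : ℕ) (st : PState) (hA : ∀ c, st.A c < 2) (c : ℕ) :
    (runLevels ω flag B n s k S e st).A c < 2 := by
  induction e generalizing st with
  | zero => exact tableSeq_lt_two hA _ _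
  | succ e ih =>
    rw [runLevels]
    split_ifs
    · exact ih _ fun c => tableSeq_lt_two hA _ _
    · exact tableSeq_lt_two hA _ _

theorem runLevels_A_of_lt (flag e : ℕ) (st : PState) (hA : ∀ c, st.A c < 2) {c : ℕ}
    (hc : c < st.off) : (runLevels ω flag B n s k S e st).A c = st.A c := by
  induction e generalizing st with
  | zero => exact tableSeq_of_lt hA _ hc
  | succ e ih =>
    rw [runLevels]
    split_ifs
    · rw [ih _ (fun c => tableSeq_lt_two hA _ _) (hc.trans_le (Nat.le_add_right _ _))]
      exact tableSeq_of_lt hA _ hc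
    · exact tableSeq_of_lt hA _ hc

theorem flipBits_zero (S : ℕ → ℕ) (d : ℕ) (c z : ℕ → ℕ) : flipBits S 0 d c z = z := by
  funext j; simp [flipBits]

/-- One level of Bob, given that his table array holds the parities of Alice's. -/
theorem stepLevel_z (hS : ∀ i < actSum s k 1, S i < n) (hz : ∃ j, k j = 0) {off e : ℕ}
    {sta stb : PState} {Sa : ℕ → ℕ} (hoa : sta.off = off) (hob : stb.off = off)
    (hp : sta.pos = stb.pos) (hAa : ∀ c, sta.A c < 2) (hAb : ∀ c, stb.A c < 2)
    (hzero : ∀ c, off ≤ c → sta.A c = 0)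
    (hmsg : ∀ c, off ≤ c → c < off + (levelPar B n s k off e).d * (levelPar B n s k off e).w →
      stb.A c = (stepLevel ω 0 n Sa (levelPar B n s k off e) sta).A c) :
    (stepLevel ω 1 n S (levelPar B n s k off e) stb).z =
      decodeLevel ω n S sta.z (levelPar B n s k off e) stb.pos stb.z := by
  have hw := fun τ p j hj => hashVal_lt_width (ω := ω) (B := B) (n := n) (s := s) (k := k)
    off e τ p j hj
  have hsig : (levelPar B n s k off e).sig ≤ actSum s k 1 := by
    rcases levelPar_cases B n s k off e with ⟨-, h⟩ | ⟨-, h⟩ <;> rw [h]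
    exact actSum_le_one s hz Nat.one_le_two_pow
  set P := levelPar B n s k off e
  simp only [stepLevel, decodeLevel, mul_one]
  refine flipBits_congr (n := n) (fun i hi => hS i (by omega)) fun j hj => ?_
  unfold oddCount parityCount
  refine Finset.sum_congr rfl fun τ hτ => ?_
  rw [Finset.mem_range] at hτ
  have hr := hw τ stb.pos j hj
  have h1 : (τ + 1) * P.w ≤ P.d * P.w := Nat.mul_le_mul_right _ hτ
  rw [add_mul, one_mul] at h1
  -- Alice's cell holds the parity of her bits because it started at zero; Bob's toggling adds his
  -- own bits, leaving the parity of the sum.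
  rw [tableSeq_cell hAb (fun τ j hj => hw τ stb.pos j hj) (Nat.lt_succ_self τ) hr, hob,
    hmsg _ (by omega) (by omega)]
  simp only [stepLevel]
  rw [hoa, hp, tableSeq_cell hAa (fun τ j hj => hw τ stb.pos j hj) hτ hr, hzero _ (by omega),
    zero_add, Nat.mod_add_mod, ← Finset.sum_add_distrib]
  congr 1
  refine Finset.sum_congr rfl fun i _ => ?_
  split_ifs <;> rfl

/-- Bob's result when he starts from the table array that Alice ends with. -/
theorem runLevels_z (hS : ∀ i < actSum s k 1, S i < n) (hz : ∃ j, k j = 0) (Sa : ℕ → ℕ) (e : ℕ) :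
    ∀ sta stb : PState, sta.off = stb.off → sta.pos = stb.pos → (∀ c, sta.A c < 2) →
      (∀ c, stb.A c < 2) → (∀ c, stb.off ≤ c → sta.A c = 0) →
      (∀ c, stb.off ≤ c → c < (runLevels ω 0 B n s k Sa e sta).off →
        stb.A c = (runLevels ω 0 B n s k Sa e sta).A c) →
      (runLevels ω 1 B n s k S e stb).z =
        decodeRun ω B n s k S sta.z e stb.off stb.pos stb.z := by
  induction e with
  | zero =>
    intro sta stb ho hp hAa hAb hzero hmsg
    rw [runLevels, decodeRun, stepLevel_z (Sa := Sa) hS hz ho rfl hp hAa hAb hzero]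
    intro c h1 h2
    have := hmsg c h1
    rw [runLevels, ho] at this
    exact this (by simpa only [stepLevel, ho] using h2)
  | succ e ih =>
    intro sta stb ho hp hAa hAb hzero hmsg
    rw [runLevels, decodeRun]
    rw [runLevels, ho] at hmsg
    have hw := fun τ j hj => hashVal_lt_width (ω := ω) (B := B) (n := n) (s := s) (k := k)
      stb.off (e + 1) τ stb.pos j hj
    by_cases hq : lastThr s k < (levelPar B n s k stb.off (e + 1)).q
    · rw [if_pos hq] at hmsg ⊢
      rw [if_pos hq]
      set P := levelPar B n s k stb.off (e + 1) with hP
      have hAa' : ∀ c, (stepLevel ω 0 n Sa P sta).A c < 2 := fun c => tableSeq_lt_two hAa _ _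
      have hoff' := runLevels_off_le (ω := ω) (B := B) (n := n) (s := s) (k := k) (S := Sa) 0 e
        (stepLevel ω 0 n Sa P sta)
      have hoa : (stepLevel ω 0 n Sa P sta).off = stb.off + P.d * P.w := by
        simp only [stepLevel, ho]
      rw [hoa] at hoff'
      -- With flag `0` no position is flipped, so Alice's string is the same at all levels.
      have hza : (stepLevel ω 0 n Sa P sta).z = sta.z := by
        simp only [stepLevel, mul_zero, flipBits_zero]
      -- Later levels write only beyond the new offset, so the cells of this level already have
      -- their final contents in Alice's array.
      have hstep := stepLevel_z (ω := ω) (B := B) (e := e + 1) (Sa := Sa) hS hz ho rfl hp hAa hAb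
        hzero
        (fun c h1 h2 => by
          have h2' : c < stb.off + P.d * P.w := h2
          rw [hmsg c h1 (by omega)]
          exact runLevels_A_of_lt _ _ _ hAa' (by rw [hoa]; exact h2'))
      rw [← hP] at hstep
      rw [ih (stepLevel ω 0 n Sa P sta) (stepLevel ω 1 n S P stb) (by simp only [stepLevel, ho])
        (by simp only [stepLevel, hp]) hAa' (fun c => tableSeq_lt_two hAb _ _), hza, hstep]
      · rfl
      · intro c hc
        have hc' : stb.off + P.d * P.w ≤ c := hc
        simp only [stepLevel, ho]
        rw [tableSeq_of_ge hAa (by rw [hp]; exact hw) _ hc']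
        exact hzero c (by omega)
      · intro c h1 h2
        have h1' : stb.off + P.d * P.w ≤ c := h1
        rw [← hmsg c (by omega) h2]
        exact tableSeq_of_ge hAb hw _ h1'
    · rw [if_neg hq] at hmsg ⊢
      rw [if_neg hq]
      refine stepLevel_z (Sa := Sa) hS hz ho rfl hp hAa hAb hzero fun c h1 h2 =>
        hmsg c h1 (by simpa only [stepLevel, ho] using h2)

end

/-- The positions where `z` differs from `x`. -/
def errSet (n : ℕ) (x z : ℕ → ℕ) : Finset (Fin n) := {j | z j ≠ x j}

open Classical in
/-- The positions among the first `m` entries of `S`. -/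
noncomputable def listed (n : ℕ) (S : ℕ → ℕ) (m : ℕ) : Finset (Fin n) := {j | ∃ i < m, S i = j}

theorem listed_mono {n : ℕ} {S : ℕ → ℕ} {m m' : ℕ} (h : m ≤ m') :
    listed n S m ⊆ listed n S m' := by
  intro j hj
  simp only [listed, Finset.mem_filter, Finset.mem_univ, true_and] at hj ⊢
  obtain ⟨i, hi, h'⟩ := hj
  exact ⟨i, by omega, h'⟩

theorem card_listed_le (n : ℕ) (S : ℕ → ℕ) (m : ℕ) : (listed n S m).card ≤ m := by
  calc (listed n S m).card ≤ ((Finset.range m).image S).card := by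
        rw [← Finset.card_map Fin.valEmbedding]
        refine Finset.card_le_card fun j hj => ?_
        simp only [listed, Finset.mem_map, Finset.mem_filter, Finset.mem_univ, true_and,
          Fin.valEmbedding_apply] at hj
        obtain ⟨j, ⟨i, hi, h⟩, rfl⟩ := hj
        exact Finset.mem_image.2 ⟨i, Finset.mem_range.2 hi, h⟩
    _ ≤ m := Finset.card_image_le.trans (by simp)

section
variable {ω : ℕ → Bool} {n : ℕ} {x z : ℕ → ℕ}

/-- A cell that `j` shares with no other error shows whether `j` is an error. -/
theorem cell_parity (hx : ∀ j, x j < 2) (hz : ∀ j, z j < 2) (h : ℕ → ℕ) (j : Fin n)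
    (hc : ¬ ∃ v ∈ errSet n x z, v ≠ j ∧ h v = h j) :
    (∑ i ∈ Finset.range n, if h i = h j then x i + z i else 0) % 2 =
      if j ∈ errSet n x z then 1 else 0 := by
  rw [Finset.sum_range, ← Finset.sum_erase_add _ _ (Finset.mem_univ j), if_pos rfl]
  -- The other positions in the cell are correct, so each contributes `x i + z i = 2 * x i`, an even
  -- number.
  have h0 : (∑ i ∈ Finset.univ.erase j, if h (i : Fin n) = h j then x i + z i else 0) % 2 = 0 := by
    rw [Finset.sum_nat_mod, Finset.sum_eq_zero, Nat.zero_mod]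
    intro i hi
    by_cases hij : h i = h j
    · rw [if_pos hij]
      have hne : i ≠ j := Finset.ne_of_mem_erase hi
      have : i ∉ errSet n x z := fun hm => hc ⟨i, hm, hne, hij⟩
      have : z i = x i := by simpa [errSet] using this
      omega
    · rw [if_neg hij, Nat.zero_mod]
  have h1 := hx j
  have h2 := hz j
  by_cases hj : j ∈ errSet n x z
  · rw [if_pos hj]
    have : z j ≠ x j := by simpa [errSet] using hj
    omega
  · rw [if_neg hj]
    have : z j = x j := by simpa [errSet] using hj
    omega

/-- A table in which `j` does not collide tells the truth about `j` by `cell_parity`; each collided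
table can falsify the count by at most one. -/
theorem parityCount_bounds (hx : ∀ j, x j < 2) (hz : ∀ j, z j < 2) (b mode p d : ℕ) (j : Fin n) :
    (j ∈ errSet n x z → d ≤ parityCount ω n b mode p x z d j +
      levelColl ω b mode p d (errSet n x z) j) ∧
    (j ∉ errSet n x z → parityCount ω n b mode p x z d j ≤
      levelColl ω b mode p d (errSet n x z) j) := by
  classical
  have hcoll : levelColl ω b mode p d (errSet n x z) j = ∑ τ ∈ Finset.range d,
      if ∃ v ∈ errSet n x z, v ≠ j ∧ hashVal ω b mode (p + τ * (n * b)) v =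
        hashVal ω b mode (p + τ * (n * b)) j then 1 else 0 := by
    unfold levelColl
    rw [Finset.card_filter, Finset.sum_range]
  rw [hcoll, parityCount]
  constructor
  · intro hj
    rw [← Finset.sum_add_distrib]
    calc d = ∑ _τ ∈ Finset.range d, 1 := by simp
      _ ≤ _ := Finset.sum_le_sum fun τ _ => ?_
    by_cases hc : ∃ v ∈ errSet n x z, v ≠ j ∧ hashVal ω b mode (p + τ * (n * b)) v =
        hashVal ω b mode (p + τ * (n * b)) j
    · rw [if_pos hc]; omega
    · rw [cell_parity hx hz (hashVal ω b mode (p + τ * (n * b))) j hc, if_pos hj]; omega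
  · intro hj
    refine Finset.sum_le_sum fun τ _ => ?_
    by_cases hc : ∃ v ∈ errSet n x z, v ≠ j ∧ hashVal ω b mode (p + τ * (n * b)) v =
        hashVal ω b mode (p + τ * (n * b)) j
    · rw [if_pos hc]; omega
    · rw [cell_parity hx hz (hashVal ω b mode (p + τ * (n * b))) j hc, if_neg hj]; omega

/-- After a level, a listed position is wrong only if it collided in half of the tables. -/
theorem errSet_decodeLevel (hx : ∀ j, x j < 2) (hz : ∀ j, z j < 2) (S : ℕ → ℕ) (P : LevelPar)
    (p : ℕ) {j : Fin n} (hj : j ∈ errSet n x (decodeLevel ω n S x P p z)) :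
    (j ∈ listed n S P.sig ∧ P.d ≤ 2 * levelColl ω P.b P.mode p P.d (errSet n x z) j) ∨
    (j ∉ listed n S P.sig ∧ j ∈ errSet n x z) := by
  obtain ⟨h1, h2⟩ := parityCount_bounds (ω := ω) hx hz P.b P.mode p P.d j
  have hx' := hx j
  have hz' := hz j
  by_cases hl : j ∈ listed n S P.sig
  · refine .inl ⟨hl, ?_⟩
    have hl' : ∃ i < P.sig, S i = j := by simpa [listed] using hl
    have hne : decodeLevel ω n S x P p z j ≠ x j := by simpa [errSet] using hj
    unfold decodeLevel flipBits at hne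
    simp only [hl', true_and] at hne
    -- A missed error has `2 * count ≤ d` and a wrongly flipped position has `2 * count > d`. In
    -- both cases at least half of the tables are collided; a tie leaves the bit unchanged.
    by_cases he : j ∈ errSet n x z
    · have h3 := h1 he
      have : z j ≠ x j := by simpa [errSet] using he
      split_ifs at hne <;> omega
    · have h3 := h2 he
      have : z j = x j := by simpa [errSet] using he
      split_ifs at hne <;> omega
  · refine .inr ⟨hl, ?_⟩
    have hl' : ¬ ∃ i < P.sig, S i = j := by simpa [listed] using hl
    have hne : decodeLevel ω n S x P p z j ≠ x j := by simpa [errSet] using hj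
    unfold decodeLevel flipBits at hne
    simp only [hl', false_and, if_false] at hne
    simpa [errSet] using hne

end

/-! ### Error probability -/

/-- The values of `F` may range over an infinite type, such as strings indexed by `ℕ`, because `F`
factors through the finitely many possible blocks of the first `p` coins. -/
theorem fairCoins_fresh' {α : Type*} (p q : ℕ) (F : (ℕ → Bool) → α)
    (hF : ∀ ω ω' : ℕ → Bool, (∀ i < p, ω i = ω' i) → F ω = F ω') (U : α → Set (ℕ → Bool))
    (hU : ∀ a (ω ω' : ℕ → Bool), (∀ i, p ≤ i → i < q → ω i = ω' i) → ω ∈ U a → ω' ∈ U a)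
    (ε : ENNReal) (hε : ∀ a, fairCoins (U a) ≤ ε) : fairCoins {ω | ω ∈ U (F ω)} ≤ ε := by
  let ext : (Fin p → Bool) → ℕ → Bool := fun x i => if h : i < p then x ⟨i, h⟩ else false
  have key := fairCoins_fresh p q (fun (ω : ℕ → Bool) (i : Fin p) => ω i)
    (fun ω ω' h => funext fun i => h i i.2) (fun x => U (F (ext x)))
    (fun x => hU _) ε (fun x => hε _)
  have : ∀ ω : ℕ → Bool, F (ext fun i => ω i) = F ω := fun ω => hF _ _ fun i hi => by
    simp [ext, hi]
  simpa only [this] using key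

theorem actCount_anti {k : ℕ → ℕ} (h : ∃ j, k j = 0) {q q' : ℕ} (hq : 1 ≤ q) (hqq : q ≤ q') :
    actCount k q' ≤ actCount k q := by
  apply Nat.sInf_le
  have : k (actCount k q) < q := Nat.sInf_mem (s := {i | k i < q}) (by
    obtain ⟨j, hj⟩ := h; exact ⟨j, by simp [hj]; omega⟩)
  simp only [Set.mem_ofPred_eq]; omega

theorem actSum_anti (s : ℕ → ℕ) {k : ℕ → ℕ} (h : ∃ j, k j = 0) {q q' : ℕ} (hq : 1 ≤ q)
    (hqq : q ≤ q') : actSum s k q' ≤ actSum s k q :=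
  Finset.sum_le_sum_of_subset (Finset.range_mono (actCount_anti h hq hqq))

/-- What is used about an instance of document exchange to analyse the error probability:
`x` and `y` are the strings, and `S` lists the sets one after the other. -/
structure DecodeSetting (n : ℕ) (s k S x y : ℕ → ℕ) : Prop where
  bit : ∀ j, x j < 2
  zero : ∃ j, k j = 0
  count_pos : 1 ≤ actCount k 1
  card_le : ∀ q, 1 ≤ q →
    (errSet n x y \ listed n S (actSum s k q)).card ≤ actCount k 1 * q
  sub : errSet n x y ⊆ listed n S (actSum s k 1)
  last : ∀ q, 1 ≤ q → q ≤ lastThr s k → actSum s k q = actSum s k 1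

/-- Before level `2 ^ e` at most `2 ^ (e + 1)` of the positions decoded so far are wrong. -/
def LevelInv (n : ℕ) (s k S x y : ℕ → ℕ) (e : ℕ) (z : ℕ → ℕ) : Prop :=
  (∀ j, z j < 2) ∧
  (errSet n x z ∩ listed n S (actSum s k (2 ^ (e + 1)))).card ≤ 2 ^ (e + 1) ∧
  ∀ j ∈ errSet n x z, j ∉ listed n S (actSum s k (2 ^ (e + 1))) → j ∈ errSet n x y

/-- Bound for the probability that level `2 ^ e` leaves more than `2 ^ e` errors. -/
noncomputable def levelErr (G : ℕ) (s k : ℕ → ℕ) (e : ℕ) : ENNReal :=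
  ((actSum s k (2 ^ e)).choose (2 ^ e + 1) : ENNReal) /
    2 ^ (G * (2 ^ e + 1) * (actSum s k (2 ^ e) / 2 ^ e).size)

/-- Bound for the probability that the last level leaves an error. -/
noncomputable def lastErr (G : ℕ) (s k : ℕ → ℕ) : ENNReal :=
  (actSum s k 1 : ENNReal) / 2 ^ (G * sumSize s k)

section
variable {n G : ℕ} {s k S x y : ℕ → ℕ}

/-- At most `2 ^ (e + 1)` errors lie among the decoded positions and at most `actCount k 1 * 2 ^ (e
+ 1)` elsewhere. With the extra `2 ^ e + 1` this is at most `4 * 2 ^ (actCount k 1).size * 2 ^ e`;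
the factor `4` turns `G + 4` into the constant `G + 6` used for `B`. -/
theorem LevelInv.card_errSet_le (h : DecodeSetting n s k S x y) {e : ℕ} {z : ℕ → ℕ}
    (hz : LevelInv n s k S x y e z) :
    2 ^ (G + 4) * ((errSet n x z).card + (2 ^ e + 1)) ≤ 2 ^ cellBits (G + 6) k e := by
  have h1 : (errSet n x z \ listed n S (actSum s k (2 ^ (e + 1)))).card ≤
      actCount k 1 * 2 ^ (e + 1) := by
    refine (Finset.card_le_card fun j hj => ?_).trans (h.card_le _ Nat.one_le_two_pow)
    rw [Finset.mem_sdiff] at hj ⊢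
    exact ⟨hz.2.2 j hj.1 hj.2, hj.2⟩
  have h2 := hz.2.1
  have h3 := Finset.card_inter_add_card_sdiff (errSet n x z)
    (listed n S (actSum s k (2 ^ (e + 1))))
  have h4 : actCount k 1 < 2 ^ (actCount k 1).size := Nat.lt_size_self _
  have h5 : 1 ≤ 2 ^ e := Nat.one_le_two_pow
  have h6 : (errSet n x z).card + (2 ^ e + 1) ≤ 2 ^ 2 * 2 ^ (actCount k 1).size * 2 ^ e := by
    have h7 : 2 ^ (e + 1) = 2 * 2 ^ e := by ring
    generalize (errSet n x z ∩ listed n S (actSum s k (2 ^ (e + 1)))).card = a at *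
    generalize (errSet n x z \ listed n S (actSum s k (2 ^ (e + 1)))).card = b at *
    rw [h7] at h1 h2
    nlinarith [Nat.mul_le_mul_right (2 ^ e) h4]
  calc 2 ^ (G + 4) * ((errSet n x z).card + (2 ^ e + 1))
      ≤ 2 ^ (G + 4) * (2 ^ 2 * 2 ^ (actCount k 1).size * 2 ^ e) := Nat.mul_le_mul_left _ h6
    _ = 2 ^ cellBits (G + 6) k e := by
        rw [← pow_add, ← pow_add, ← pow_add, cellBits]; congr 1; ring

theorem decodeLevel_lt_two {ω : ℕ → Bool} {P : LevelPar} {p : ℕ} {z : ℕ → ℕ}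
    (hz : ∀ j, z j < 2) (j : ℕ) : decodeLevel ω n S x P p z j < 2 := flipBits_lt_two hz j

/-- If the invariant breaks, at least `2 ^ (e + 1) + 1` listed positions collided in half of the
tables. The string `F ω` depends only on coins before `p`, so the estimate for fresh coins applies.
The fallback is excluded by `hq`, since its `q` is zero. -/
theorem fairCoins_level (h : DecodeSetting n s k S x y) (e off p : ℕ)
    (F : (ℕ → Bool) → ℕ → ℕ) (hF : ∀ ω ω' : ℕ → Bool, (∀ i < p, ω i = ω' i) → F ω = F ω')
    (hq : lastThr s k < (levelPar (G + 6) n s k off (e + 1)).q) :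
    fairCoins {ω | LevelInv n s k S x y (e + 1) (F ω) ∧ ¬ LevelInv n s k S x y e
      (decodeLevel ω n S x (levelPar (G + 6) n s k off (e + 1)) p (F ω))} ≤
      levelErr G s k (e + 1) := by
  rcases levelPar_cases (G + 6) n s k off (e + 1) with ⟨-, hP⟩ | ⟨-, hP⟩
  · rw [hP] at hq; simp at hq
  rw [hP] at hq ⊢
  simp only at hq
  set b := cellBits (G + 6) k (e + 1) with hb
  set d := (actSum s k (2 ^ (e + 1)) / 2 ^ (e + 1)).size with hd
  have htc : tableCount s k (e + 1) = 4 * d := by rw [tableCount, if_pos hq]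
  set Pl := listed n S (actSum s k (2 ^ (e + 1))) with hPl
  refine (measure_mono ?_).trans (fairCoins_fresh' p (p + 4 * d * (n * b)) F hF
    (fun z => {ω | LevelInv n s k S x y (e + 1) z ∧ 2 ^ (e + 1) + 1 ≤ (Pl.filter fun j =>
      4 * d ≤ 2 * levelColl ω b 0 p (4 * d) (errSet n x z) j).card}) ?_ _ ?_)
  · rintro ω ⟨hinv, hbad⟩
    refine ⟨hinv, ?_⟩
    by_contra hcon
    apply hbad
    refine ⟨decodeLevel_lt_two hinv.1, ?_, ?_⟩
    · refine (Finset.card_le_card fun j hj => ?_).trans (Nat.lt_succ_iff.1 (not_le.1 hcon))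
      rw [Finset.mem_inter] at hj
      rcases errSet_decodeLevel h.bit hinv.1 S _ p hj.1 with ⟨h1, h2⟩ | ⟨h1, -⟩
      · rw [Finset.mem_filter]
        simp only [htc] at h2
        exact ⟨h1, h2⟩
      · exact absurd hj.2 h1
    · intro j hj hjl
      rcases errSet_decodeLevel h.bit hinv.1 S _ p hj with ⟨h1, -⟩ | ⟨-, h2⟩
      · exact absurd h1 hjl
      -- Positions decoded at a higher threshold remain listed at the lower one, so an unlisted
      -- error was not decoded before either and is an original one.
      · refine hinv.2.2 j h2 fun hj2 => hjl (listed_mono ?_ hj2)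
        exact actSum_anti s h.zero Nat.one_le_two_pow
          (Nat.pow_le_pow_right (by norm_num) (by omega))
  · rintro z ω ω' hag ⟨h1, h2⟩
    refine ⟨h1, ?_⟩
    simpa only [levelColl_congr hag] using h2
  · intro z
    by_cases hinv : LevelInv n s k S x y (e + 1) z
    · refine (measure_mono fun ω hω => hω.2).trans
        ((fairCoins_many_collided b p d _ G _ _ (hinv.card_errSet_le h)).trans ?_)
      unfold levelErr
      gcongr
      exact card_listed_le _ _ _
    · refine le_of_eq_of_le ?_ zero_le
      simp [hinv]

/-- The identity hash of the fallback has no collisions and never fails. Otherwise `2 ^ e ≤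
lastThr`, so all positions that can be wrong are listed, and a union bound over single positions (`m
= 1`) suffices. -/
theorem fairCoins_last (h : DecodeSetting n s k S x y) (e off p : ℕ)
    (F : (ℕ → Bool) → ℕ → ℕ) (hF : ∀ ω ω' : ℕ → Bool, (∀ i < p, ω i = ω' i) → F ω = F ω')
    (hq : ¬ lastThr s k < (levelPar (G + 6) n s k off e).q) :
    fairCoins {ω | LevelInv n s k S x y e (F ω) ∧ (errSet n x
      (decodeLevel ω n S x (levelPar (G + 6) n s k off e) p (F ω))).Nonempty} ≤
      lastErr G s k := by
  have hnone : ∀ z, LevelInv n s k S x y e z → ∀ j ∈ errSet n x z,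
      j ∉ listed n S (actSum s k 1) → False := by
    intro z hinv j hj hjl
    exact hjl (h.sub (hinv.2.2 j hj fun hj2 => hjl (listed_mono
      (actSum_le_one s h.zero Nat.one_le_two_pow) hj2)))
  rcases levelPar_cases (G + 6) n s k off e with ⟨-, hP⟩ | ⟨-, hP⟩
  · rw [hP]
    refine le_of_eq_of_le ?_ zero_le
    convert measure_empty (μ := fairCoins)
    rw [Set.eq_empty_iff_forall_notMem]
    rintro ω ⟨hinv, j, hj⟩
    rcases errSet_decodeLevel h.bit hinv.1 S _ p hj with ⟨-, h2⟩ | ⟨h1, h2⟩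
    · have : levelColl ω 0 1 p 1 (errSet n x (F ω)) j = 0 := by
        unfold levelColl
        rw [Finset.card_eq_zero, Finset.filter_eq_empty_iff]
        rintro τ - ⟨v, -, hv, hh⟩
        simp only [hashVal, coinNum, pow_zero, one_mul, add_zero] at hh
        exact hv (Fin.ext hh)
      simp only [this] at h2
      omega
    · exact hnone _ hinv j h2 h1
  · rw [hP] at hq ⊢
    simp only at hq
    have hlast := h.last (2 ^ e) Nat.one_le_two_pow (not_lt.1 hq)
    set b := cellBits (G + 6) k e with hb
    set d := sumSize s k with hd
    have htc : tableCount s k e = 4 * d := by rw [tableCount, if_neg hq]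
    set Pl := listed n S (actSum s k 1) with hPl
    refine (measure_mono ?_).trans (fairCoins_fresh' p (p + 4 * d * (n * b)) F hF
      (fun z => {ω | LevelInv n s k S x y e z ∧ 1 ≤ (Pl.filter fun j =>
        4 * d ≤ 2 * levelColl ω b 0 p (4 * d) (errSet n x z) j).card}) ?_ _ ?_)
    · rintro ω ⟨hinv, j, hj⟩
      refine ⟨hinv, Finset.card_pos.2 ⟨j, ?_⟩⟩
      rcases errSet_decodeLevel h.bit hinv.1 S _ p hj with ⟨h1, h2⟩ | ⟨h1, h2⟩
      · rw [Finset.mem_filter]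
        simp only [htc] at h2
        simp only [hlast] at h1
        exact ⟨h1, h2⟩
      · simp only [hlast] at h1
        exact (hnone _ hinv j h2 h1).elim
    · rintro z ω ω' hag ⟨h1, h2⟩
      refine ⟨h1, ?_⟩
      simpa only [levelColl_congr hag] using h2
    · intro z
      by_cases hinv : LevelInv n s k S x y e z
      · have hcard := hinv.card_errSet_le (G := G) h
        have : 2 ^ (G + 4) * ((errSet n x z).card + 1) ≤ 2 ^ b := by
          exact le_trans (Nat.mul_le_mul_left _ (Nat.add_le_add_left (Nat.le_add_left _ _) _)) hcard
        refine (measure_mono fun ω hω => hω.2).trans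
          ((fairCoins_many_collided b p d 1 G _ _ this).trans ?_)
        unfold lastErr
        rw [Nat.choose_one_right, mul_one]
        gcongr
        exact card_listed_le _ _ _
      · refine le_of_eq_of_le ?_ zero_le
        simp [hinv]

theorem decodeLevel_congr {ω ω' : ℕ → Bool} {P : LevelPar} {p : ℕ} {z : ℕ → ℕ}
    (hS : ∀ i < P.sig, S i < n) (h : ∀ i, p ≤ i → i < p + P.d * (n * P.b) → ω i = ω' i) :
    decodeLevel ω n S x P p z = decodeLevel ω' n S x P p z := by
  unfold decodeLevel
  refine flipBits_congr hS fun j hj => ?_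
  unfold parityCount
  refine Finset.sum_congr rfl fun τ hτ => ?_
  congr 1
  refine Finset.sum_congr rfl fun i hi => ?_
  rw [hashVal_congr h (Finset.mem_range.1 hτ) (Finset.mem_range.1 hi),
    hashVal_congr h (Finset.mem_range.1 hτ) hj]

/-- Generalised over the string `F` reached so far as a function of the coins. The offset and the
coin position do not depend on the coins, so after each level the new string depends on an initial
block and the next coins are fresh. The failure probabilities of the levels then add up. -/
theorem fairCoins_decodeRun (h : DecodeSetting n s k S x y) (hthr : 1 ≤ lastThr s k)
    (hS : ∀ i < actSum s k 1, S i < n) (e : ℕ) :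
    ∀ (off p : ℕ) (F : (ℕ → Bool) → ℕ → ℕ)
      (_ : ∀ ω ω' : ℕ → Bool, (∀ i < p, ω i = ω' i) → F ω = F ω'),
      fairCoins {ω | LevelInv n s k S x y e (F ω) ∧
        (errSet n x (decodeRun ω (G + 6) n s k S x e off p (F ω))).Nonempty} ≤
      (∑ i ∈ Finset.range (e + 1), if lastThr s k < 2 ^ i then levelErr G s k i else 0) +
        lastErr G s k := by
  induction e with
  | zero =>
    intro off p F hF
    refine (fairCoins_last h 0 off p F hF ?_).trans le_add_self
    rcases levelPar_cases (G + 6) n s k off 0 with ⟨-, hP⟩ | ⟨-, hP⟩ <;> rw [hP] <;> simp only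
    · omega
    · rw [pow_zero]; omega
  | succ e ih =>
    intro off p F hF
    by_cases hq : lastThr s k < (levelPar (G + 6) n s k off (e + 1)).q
    · simp only [decodeRun, if_pos hq]
      have hsig : (levelPar (G + 6) n s k off (e + 1)).sig ≤ actSum s k 1 := by
        rcases levelPar_cases (G + 6) n s k off (e + 1) with ⟨-, h'⟩ | ⟨-, h'⟩ <;> rw [h']
        exact actSum_le_one s h.zero Nat.one_le_two_pow
      have hq2 : lastThr s k < 2 ^ (e + 1) := by
        rcases levelPar_cases (G + 6) n s k off (e + 1) with ⟨-, h'⟩ | ⟨-, h'⟩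
        · rw [h'] at hq; simp at hq
        · rw [h'] at hq; exact hq
      have h1 := fairCoins_level h e off p F hF hq
      set P := levelPar (G + 6) n s k off (e + 1) with hP
      have h2 := ih (off + P.d * P.w) (p + P.d * (n * P.b))
        (fun ω => decodeLevel ω n S x P p (F ω)) (fun ω ω' hag => by
          simp only [hF ω ω' fun i hi => hag i (by omega)]
          exact decodeLevel_congr (fun i hi => hS i (by omega)) fun i _ hi => hag i hi)
      rw [Finset.sum_range_succ, if_pos hq2]
      calc _ ≤ fairCoins ({ω | LevelInv n s k S x y e (decodeLevel ω n S x P p (F ω)) ∧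
            (errSet n x (decodeRun ω (G + 6) n s k S x e (off + P.d * P.w) (p + P.d * (n * P.b))
              (decodeLevel ω n S x P p (F ω)))).Nonempty} ∪
            {ω | LevelInv n s k S x y (e + 1) (F ω) ∧
              ¬ LevelInv n s k S x y e (decodeLevel ω n S x P p (F ω))}) := by
            refine measure_mono ?_
            rintro ω ⟨ha, hb⟩
            by_cases hc : LevelInv n s k S x y e (decodeLevel ω n S x P p (F ω))
            · exact .inl ⟨hc, hb⟩
            · exact .inr ⟨ha, hc⟩
        _ ≤ _ := measure_union_le _ _
        _ ≤ _ := add_le_add h2 h1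
        _ = _ := by ring
    · simp only [decodeRun, if_neg hq]
      exact (fairCoins_last h (e + 1) off p F hF hq).trans le_add_self

end

/-! ### Size of the error probability -/

/-- The binomial coefficient is at most `(e * σ / (q + 1)) ^ (q + 1)`, where `e < 3` and `σ / (q +
1) ≤ 2 ^ d`; finally `3 * 2 ^ d ≤ 2 ^ (3 * d)` as `d ≥ 1`. -/
theorem choose_le_two_pow {σ q d : ℕ} (hq : 1 ≤ q) (hd : 1 ≤ d) (h : σ < q * 2 ^ d) :
    σ.choose (q + 1) ≤ 2 ^ (3 * d * (q + 1)) := by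
  have h1 : (σ.choose (q + 1) : ℝ) ≤ (σ : ℝ) ^ (q + 1) / (q + 1).factorial :=
    Nat.choose_le_pow_div _ _
  have h2 := Real.pow_div_factorial_le_exp (x := ((q + 1 : ℕ) : ℝ)) (by positivity) (q + 1)
  have h3 : Real.exp ((q + 1 : ℕ) : ℝ) ≤ 3 ^ (q + 1) := by
    rw [← mul_one ((q + 1 : ℕ) : ℝ), Real.exp_nat_mul]
    exact pow_le_pow_left₀ (Real.exp_pos _).le Real.exp_one_lt_three.le _
  have h4 : (σ : ℝ) ≤ ((q + 1 : ℕ) : ℝ) * 2 ^ d := by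
    have : σ ≤ (q + 1) * 2 ^ d := h.le.trans (Nat.mul_le_mul_right _ (Nat.le_succ q))
    exact_mod_cast this
  have h5 : (3 * 2 ^ d : ℝ) ≤ 2 ^ (3 * d) := by
    calc (3 * 2 ^ d : ℝ) ≤ 2 ^ (2 * d) * 2 ^ d := by
          gcongr
          calc (3 : ℝ) ≤ 2 ^ 2 := by norm_num
            _ ≤ 2 ^ (2 * d) := pow_le_pow_right₀ (by norm_num) (by omega)
      _ = 2 ^ (3 * d) := by rw [← pow_add]; congr 1; ring
  have : (σ.choose (q + 1) : ℝ) ≤ 2 ^ (3 * d * (q + 1)) :=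
    calc (σ.choose (q + 1) : ℝ) ≤ (σ : ℝ) ^ (q + 1) / (q + 1).factorial := h1
      _ ≤ (((q + 1 : ℕ) : ℝ) * 2 ^ d) ^ (q + 1) / (q + 1).factorial := by gcongr
      _ = ((q + 1 : ℕ) : ℝ) ^ (q + 1) / (q + 1).factorial * (2 ^ d) ^ (q + 1) := by
          rw [mul_pow]; ring
      _ ≤ 3 ^ (q + 1) * (2 ^ d) ^ (q + 1) := by gcongr; exact h2.trans h3
      _ = (3 * 2 ^ d) ^ (q + 1) := by rw [mul_pow]
      _ ≤ (2 ^ (3 * d)) ^ (q + 1) := by gcongr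
      _ = 2 ^ (3 * d * (q + 1)) := by rw [← pow_mul]
  exact_mod_cast this

theorem ENNReal.div_two_pow_le {c u v : ℕ} (h : c * 2 ^ u ≤ 2 ^ v) :
    (c : ENNReal) / 2 ^ v ≤ 2⁻¹ ^ u := by
  rw [ENNReal.div_le_iff (by positivity) (by finiteness), ← ENNReal.inv_pow, mul_comm,
    ← div_eq_mul_inv, ENNReal.le_div_iff_mul_le (.inl (by positivity)) (.inl (by finiteness))]
  exact_mod_cast h

/-- Of the exponent `(Y + 5) * d * (q + 1)`, the binomial coefficient uses `3 * d * (q + 1)`, and `d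
≥ 1` leaves `(Y + 2) * (q + 1)`. If `σ ≤ q` the coefficient vanishes, so `d = 0` does no harm. -/
theorem levelErr_le (Y : ℕ) (s k : ℕ → ℕ) (e : ℕ) :
    levelErr (Y + 5) s k e ≤ 2⁻¹ ^ ((Y + 2) * (2 ^ e + 1)) := by
  unfold levelErr
  apply ENNReal.div_two_pow_le
  set σ := actSum s k (2 ^ e)
  set q := 2 ^ e with hq
  have h1 : 1 ≤ q := Nat.one_le_two_pow
  rcases lt_or_ge σ (q + 1) with h | h
  · simp [Nat.choose_eq_zero_of_lt h]
  set d := (σ / q).size with hd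
  have hd1 : 1 ≤ d := Nat.size_pos.2 (Nat.div_pos (by omega) h1)
  have hσ : σ < q * 2 ^ d := by
    have : σ / q < 2 ^ d := Nat.lt_size_self _
    rw [Nat.div_lt_iff_lt_mul h1] at this
    rwa [mul_comm] at this
  calc σ.choose (q + 1) * 2 ^ ((Y + 2) * (q + 1))
      ≤ 2 ^ (3 * d * (q + 1)) * 2 ^ ((Y + 2) * (q + 1)) :=
        Nat.mul_le_mul_right _ (choose_le_two_pow h1 hd1 hσ)
    _ = 2 ^ (3 * d * (q + 1) + (Y + 2) * (q + 1)) := (pow_add _ _ _).symm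
    _ ≤ _ := Nat.pow_le_pow_right (by norm_num) (by
        have : (3 * d + (Y + 2)) * (q + 1) ≤ (Y + 5) * d * (q + 1) := by
          gcongr; nlinarith
        nlinarith)

/-- The `+ 1` in the exponent is kept so that two such terms add up to `2⁻¹ ^ (Y * sumSize s k)`. -/
theorem lastErr_le {Y : ℕ} {s k : ℕ → ℕ} (h : 1 ≤ sumSize s k) :
    lastErr (Y + 5) s k ≤ 2⁻¹ ^ (Y * sumSize s k + 1) := by
  unfold lastErr
  apply ENNReal.div_two_pow_le
  have h1 : actSum s k 1 < 2 ^ sumSize s k := Nat.lt_size_self _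
  calc actSum s k 1 * 2 ^ (Y * sumSize s k + 1)
      ≤ 2 ^ sumSize s k * 2 ^ (Y * sumSize s k + 1) := Nat.mul_le_mul_right _ h1.le
    _ = 2 ^ (sumSize s k + (Y * sumSize s k + 1)) := (pow_add _ _ _).symm
    _ ≤ _ := Nat.pow_le_pow_right (by norm_num) (by nlinarith)

/-- Above the threshold the surplus exponent at level `2 ^ i` exceeds `i`, which makes the sum
geometric. -/
theorem sum_levelErr_le (Y : ℕ) (s k : ℕ → ℕ) (e : ℕ) :
    (∑ i ∈ Finset.range e, if lastThr s k < 2 ^ i then levelErr (Y + 5) s k i else 0) ≤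
      2⁻¹ ^ (Y * lastThr s k + 1) := by
  have hhalf : (2⁻¹ : ENNReal) ≤ 1 := ENNReal.inv_le_one.2 (by norm_num)
  have key : (∑ i ∈ Finset.range e, if lastThr s k < 2 ^ i then levelErr (Y + 5) s k i else 0) ≤
      ∑ i ∈ Finset.range e, 2⁻¹ ^ (Y * lastThr s k + 1) * 2⁻¹ ^ (i + 1) := by
    refine Finset.sum_le_sum fun i _ => ?_
    split_ifs with h
    · refine (levelErr_le Y s k i).trans ?_
      rw [← pow_add]
      refine pow_le_pow_right_of_le_one' hhalf ?_
      have h1 : i < 2 ^ i := Nat.lt_two_pow_self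
      nlinarith [Nat.mul_le_mul_left Y h.le]
    · exact zero_le
  refine key.trans ?_
  rw [← Finset.mul_sum]
  have : (∑ i ∈ Finset.range e, (2⁻¹ : ENNReal) ^ (i + 1)) ≤ 1 :=
    (ENNReal.sum_le_tsum _).trans_eq (by
      rw [ENNReal.tsum_geometric_add_one, ENNReal.one_sub_inv_two, inv_inv]
      exact ENNReal.inv_mul_cancel (by norm_num) (by norm_num))
  exact mul_le_of_le_one_right' this

/-- If the minimum in `lastThr` is the last active `k`, the levels are charged to the first term and
the last step to the second. Otherwise both are at most half of the second term. -/
theorem totalErr_le {Y : ℕ} (hY : 1 ≤ Y) {s k : ℕ → ℕ} (h : 1 ≤ sumSize s k) (e : ℕ) :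
    (∑ i ∈ Finset.range e, if lastThr s k < 2 ^ i then levelErr (Y + 5) s k i else 0) +
      lastErr (Y + 5) s k ≤ 2⁻¹ ^ k (actCount k 1 - 1) + 2⁻¹ ^ (Y * sumSize s k) := by
  have hhalf : (2⁻¹ : ENNReal) ≤ 1 := ENNReal.inv_le_one.2 (by norm_num)
  have htwo : (2⁻¹ : ENNReal) ^ (Y * sumSize s k) =
      2⁻¹ ^ (Y * sumSize s k + 1) + 2⁻¹ ^ (Y * sumSize s k + 1) := by
    rw [pow_succ, ← mul_add, ENNReal.inv_two_add_inv_two, mul_one]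
  have h1 := sum_levelErr_le Y s k e
  have h2 := lastErr_le (Y := Y) h
  rcases le_total (k (actCount k 1 - 1)) (sumSize s k) with hc | hc
  · refine add_le_add (h1.trans (pow_le_pow_right_of_le_one' hhalf ?_))
      (h2.trans (pow_le_pow_right_of_le_one' hhalf (Nat.le_succ _)))
    rw [lastThr, min_eq_left hc]
    nlinarith
  · rw [lastThr, min_eq_right hc] at h1
    rw [lastThr, min_eq_right hc]
    rw [htwo]
    exact (add_le_add h1 h2).trans le_add_self

theorem two_inv_pow_le_rpow {a : ℝ} {Y L S : ℕ} (hY : a ≤ Y) (hS : 1 ≤ S)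
    (hL : S < 2 ^ L) : (2⁻¹ : ENNReal) ^ (Y * L) ≤ ENNReal.ofReal ((S : ℝ) ^ (-a)) := by
  have hS' : (1 : ℝ) ≤ S := by exact_mod_cast hS
  have h1 : (S : ℝ) ^ a ≤ 2 ^ (Y * L) :=
    calc (S : ℝ) ^ a ≤ (S : ℝ) ^ (Y : ℝ) := Real.rpow_le_rpow_of_exponent_le hS' hY
      _ = (S : ℝ) ^ Y := Real.rpow_natCast _ _
      _ ≤ (2 ^ L) ^ Y := by
          refine pow_le_pow_left₀ (by positivity) ?_ _
          exact_mod_cast hL.le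
      _ = 2 ^ (Y * L) := by rw [← pow_mul, mul_comm]
  have h2 : (2⁻¹ : ENNReal) ^ (Y * L) = ENNReal.ofReal ((2 ^ (Y * L))⁻¹) := by
    rw [ENNReal.ofReal_inv_of_pos (by positivity), ENNReal.ofReal_pow (by norm_num),
      ENNReal.inv_pow]
    simp
  rw [h2, Real.rpow_neg (by positivity)]
  apply ENNReal.ofReal_le_ofReal
  gcongr

/-! ### Instances of document exchange as contents of arrays -/

theorem listArray_eq (l : List ℕ) (i : ℕ) : listArray l i = if h : i < l.length then l[i] else 0 := by
  unfold listArray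
  split_ifs with h
  · exact List.getD_eq_getElem _ _ h
  · exact List.getD_eq_default _ _ (not_lt.1 h)

theorem listArray_ofFn_fin {t : ℕ} (f : Fin t → ℕ) (i : Fin t) :
    listArray (List.ofFn f) i = f i := by
  simp [listArray_eq]

theorem listArray_of_ge {l : List ℕ} {i : ℕ} (h : l.length ≤ i) : listArray l i = 0 := by
  rw [listArray_eq, dif_neg (not_lt.2 h)]

theorem listArray_le {l : List ℕ} {N : ℕ} (h : ∀ a ∈ l, a ≤ N) (i : ℕ) : listArray l i ≤ N := by
  rw [listArray_eq]
  split_ifs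
  · exact h _ (List.getElem_mem _)
  · exact Nat.zero_le _

theorem antitone_listArray_ofFn {t : ℕ} {k : Fin t → ℕ} (hk : Antitone k) :
    Antitone (listArray (List.ofFn k)) := by
  intro i j hij
  rcases lt_or_ge j t with h | h
  · have h1 := listArray_ofFn_fin k ⟨j, h⟩
    have h2 := listArray_ofFn_fin k ⟨i, by omega⟩
    simp only at h1 h2
    rw [h1, h2]
    exact hk hij
  · rw [listArray_of_ge (i := j) (by simpa)]
    exact Nat.zero_le _

/-- Here the monotonicity of `k` enters: the sets with `k i ≥ q` form an initial segment, of length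
`actCount k q`. -/
theorem lt_actCount_iff {k : ℕ → ℕ} (hk : Antitone k) (hz : ∃ j, k j = 0) {q : ℕ} (hq : 1 ≤ q)
    (i : ℕ) : i < actCount k q ↔ q ≤ k i := by
  constructor
  · intro h
    by_contra hc
    exact absurd (Nat.sInf_le (s := {i | k i < q}) (not_le.1 hc)) (not_le.2 h)
  · intro h
    by_contra hc
    have : k (actCount k q) < q := Nat.sInf_mem (s := {i | k i < q}) (by
      obtain ⟨j, hj⟩ := hz; exact ⟨j, by simp [hj]; omega⟩)
    have := hk (not_lt.1 hc)
    omega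

section
variable {n t : ℕ} {s k : Fin t → ℕ}

theorem exists_listArray_eq_zero (k : Fin t → ℕ) : ∃ j, listArray (List.ofFn k) j = 0 :=
  ⟨t, listArray_of_ge (by simp)⟩

theorem actCount_le_length (hk : Antitone k) {q : ℕ} (hq : 1 ≤ q) :
    actCount (listArray (List.ofFn k)) q ≤ t := by
  by_contra hc
  have := (lt_actCount_iff (antitone_listArray_ofFn hk) (exists_listArray_eq_zero k) hq t).1
    (not_le.1 hc)
  rw [listArray_of_ge (by simp)] at this
  omega

theorem actSum_eq_sum (hk : Antitone k) {q : ℕ} (hq : 1 ≤ q) :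
    actSum (listArray (List.ofFn s)) (listArray (List.ofFn k)) q =
      ∑ i, if q ≤ k i then s i else 0 := by
  have h1 := Fin.sum_univ_eq_sum_range (fun i => if q ≤ listArray (List.ofFn k) i then
    listArray (List.ofFn s) i else 0) t
  simp only [listArray_ofFn_fin] at h1
  rw [h1, actSum, ← Finset.sum_filter]
  refine Finset.sum_congr (Finset.ext fun i => ?_) fun _ _ => rfl
  rw [Finset.mem_filter, Finset.mem_range, Finset.mem_range,
    lt_actCount_iff (antitone_listArray_ofFn hk) (exists_listArray_eq_zero k) hq]
  refine ⟨fun h => ⟨?_, h⟩, fun h => h.2⟩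
  have := (lt_actCount_iff (antitone_listArray_ofFn hk) (exists_listArray_eq_zero k) hq i).2 h
  exact this.trans_le (actCount_le_length hk hq)

theorem paramBounds_of_input (hk : Antitone k) (h2 : ∀ i, 2 * k i ≤ s i) (hs : ∑ i, s i ≤ n) :
    ParamBounds n (listArray (List.ofFn s)) (listArray (List.ofFn k)) where
  zero := exists_listArray_eq_zero k
  sum_le := by
    rw [actSum_eq_sum hk le_rfl]
    refine (Finset.sum_le_sum fun i _ => ?_).trans hs
    split_ifs <;> omega
  -- Every active set has at least two elements because `s i ≥ 2 * k i`, so there are at most `∑ i,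
  -- s i ≤ n` of them.
  count_le := by
    refine le_trans ?_ ((actSum_eq_sum (s := s) hk le_rfl).trans_le
      ((Finset.sum_le_sum (g := s) fun i _ => ?_).trans hs))
    · unfold actSum
      refine le_trans (by simp) (Finset.card_nsmul_le_sum _ _ 1 fun i hi => ?_)
      rw [Finset.mem_range] at hi
      have h3 : i < t := hi.trans_le (actCount_le_length hk le_rfl)
      have h4 := (lt_actCount_iff (antitone_listArray_ofFn hk) (exists_listArray_eq_zero k)
        le_rfl i).1 hi
      have h5 := listArray_ofFn_fin k ⟨i, h3⟩
      have h6 := listArray_ofFn_fin s ⟨i, h3⟩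
      have h7 := h2 ⟨i, h3⟩
      simp only at h5 h6
      omega
    · split_ifs <;> omega
  head_le := by
    refine listArray_le (fun a ha => ?_) 0
    obtain ⟨i, rfl⟩ := (List.mem_ofFn' k a).1 ha
    have := Finset.single_le_sum (f := s) (fun i _ => Nat.zero_le _) (Finset.mem_univ i)
    have := h2 i
    omega

theorem one_le_lastThr (hk : Antitone k) (h2 : ∀ i, 2 * k i ≤ s i)
    (h : actCount (listArray (List.ofFn k)) 1 ≠ 0) :
    1 ≤ lastThr (listArray (List.ofFn s)) (listArray (List.ofFn k)) := by
  have hact := lt_actCount_iff (antitone_listArray_ofFn hk) (exists_listArray_eq_zero k) le_rfl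
  refine le_min ((hact _).1 (by omega)) (Nat.size_pos.2 ?_)
  have h3 := (hact 0).1 (by omega)
  have h0 : 0 < t := (Nat.pos_of_ne_zero h).trans_le (actCount_le_length hk le_rfl)
  have h5 := listArray_ofFn_fin k ⟨0, h0⟩
  simp only at h5
  rw [h5] at h3
  rw [actSum_eq_sum hk le_rfl]
  have := Finset.single_le_sum (f := fun i => if 1 ≤ k i then s i else 0)
    (fun i _ => Nat.zero_le _) (Finset.mem_univ ⟨0, h0⟩)
  simp only [if_pos h3] at this
  have := h2 ⟨0, h0⟩
  omega

theorem bitArray_lt_two (x : Fin n → Bool) (j : ℕ) : bitArray x j < 2 := by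
  refine Nat.lt_succ_of_le (listArray_le (fun a ha => ?_) j)
  obtain ⟨i, rfl⟩ := (List.mem_ofFn' _ a).1 ha
  exact Bool.toNat_le _

theorem bitArray_fin (x : Fin n → Bool) (j : Fin n) : bitArray x j = (x j).toNat :=
  listArray_ofFn_fin _ j

theorem mem_errSet_bitArray (x y : Fin n → Bool) (j : Fin n) :
    j ∈ errSet n (bitArray x) (bitArray y) ↔ x j ≠ y j := by
  rw [errSet, Finset.mem_filter, bitArray_fin, bitArray_fin]
  cases x j <;> cases y j <;> simp

theorem setsArray_lt (S : Fin t → Finset (Fin n)) (hn : 0 < n) (i : ℕ) : setsArray S i < n := by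
  refine (Nat.lt_succ_iff.2 (listArray_le (N := n - 1) (fun a ha => ?_) i)).trans_eq (by omega)
  simp only [List.mem_flatten, List.mem_ofFn, exists_exists_eq_and, List.mem_map] at ha
  obtain ⟨_, b, -, rfl⟩ := ha
  have := b.2
  omega

theorem sum_range_listArray (l : List ℕ) (c : ℕ) :
    ∑ i ∈ Finset.range c, listArray l i = (l.take c).sum := by
  induction l generalizing c with
  | nil => simp [listArray]
  | cons a l ih =>
    cases c with
    | zero => simp
    | succ c =>
      rw [Finset.sum_range_succ', List.take_succ_cons, List.sum_cons, ← ih, add_comm]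
      rfl

theorem mem_listed_listArray {l : List ℕ} {m : ℕ} (hm : m ≤ l.length) (j : Fin n) :
    j ∈ listed n (listArray l) m ↔ (j : ℕ) ∈ l.take m := by
  rw [listed, Finset.mem_filter, List.mem_take_iff_getElem]
  simp only [Finset.mem_univ, true_and, min_eq_left hm]
  constructor
  · rintro ⟨i, hi, h⟩
    rw [listArray_eq, dif_pos (hi.trans_le hm)] at h
    exact ⟨i, hi, h⟩
  · rintro ⟨i, hi, h⟩
    refine ⟨i, hi, ?_⟩
    rw [listArray_eq, dif_pos (hi.trans_le hm)]
    exact h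

/-- The sets with `k i ≥ q` come first in the concatenated list, and `actSum` is the sum of their
lengths, so cutting there cuts between two sets. -/
theorem mem_listed_setsArray (hk : Antitone k) {S : Fin t → Finset (Fin n)}
    (hS : ∀ i, (S i).card = s i) {q : ℕ} (hq : 1 ≤ q) (j : Fin n) :
    j ∈ listed n (setsArray S) (actSum (listArray (List.ofFn s)) (listArray (List.ofFn k)) q) ↔
      ∃ i, q ≤ k i ∧ j ∈ S i := by
  set L : List (List ℕ) := List.ofFn fun i => ((S i).sort (· ≤ ·)).map Fin.val with hL
  have hlen : L.map List.length = List.ofFn s := by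
    rw [hL, List.map_ofFn]
    congr 1
    funext i
    simp [hS]
  have hsum : actSum (listArray (List.ofFn s)) (listArray (List.ofFn k)) q =
      ((L.map List.length).take (actCount (listArray (List.ofFn k)) q)).sum := by
    rw [actSum, sum_range_listArray, hlen]
  have htake : L.flatten.take (actSum (listArray (List.ofFn s)) (listArray (List.ofFn k)) q) =
      (L.take (actCount (listArray (List.ofFn k)) q)).flatten := by
    rw [hsum, List.take_sum_flatten]
  have hle : actSum (listArray (List.ofFn s)) (listArray (List.ofFn k)) q ≤ L.flatten.length := by
    rw [hsum, List.length_flatten]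
    exact (List.take_sublist _ _).sum_le_sum fun _ _ => Nat.zero_le _
  have hact := lt_actCount_iff (antitone_listArray_ofFn hk) (exists_listArray_eq_zero k) hq
  rw [setsArray, mem_listed_listArray hle, htake, List.mem_flatten]
  simp only [List.mem_take_iff_getElem, hL]
  constructor
  · rintro ⟨_, ⟨i, hi, rfl⟩, hj⟩
    rw [lt_min_iff, List.length_ofFn] at hi
    rw [List.getElem_ofFn] at hj
    refine ⟨⟨i, hi.2⟩, ?_, by simpa [Fin.val_inj] using hj⟩
    rw [← listArray_ofFn_fin k ⟨i, hi.2⟩]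
    exact (hact i).1 hi.1
  · rintro ⟨i, hi, hj⟩
    rw [← listArray_ofFn_fin k i] at hi
    refine ⟨_, ⟨i, lt_min ((hact i).2 hi) (by simp), rfl⟩, ?_⟩
    rw [List.getElem_ofFn]
    simpa [Fin.val_inj] using hj

theorem decodeSetting_of_input (hk : Antitone k) (ht : 0 < t) (h1 : ∀ i, 1 ≤ k i)
    {x y : Fin n → Bool} {S : Fin t → Finset (Fin n)} (hc : DEConsistent s k x y S) :
    DecodeSetting n (listArray (List.ofFn s)) (listArray (List.ofFn k)) (setsArray S)
      (bitArray x) (bitArray y) := by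
  have hact := fun q (hq : 1 ≤ q) =>
    lt_actCount_iff (antitone_listArray_ofFn hk) (exists_listArray_eq_zero k) hq
  have hcount : actCount (listArray (List.ofFn k)) 1 = t := by
    refine le_antisymm (actCount_le_length hk le_rfl) ?_
    by_contra h
    have h3 := (hact 1 le_rfl (t - 1)).2 (by
      have := h1 ⟨t - 1, by omega⟩
      rwa [← listArray_ofFn_fin k] at this)
    omega
  refine ⟨bitArray_lt_two x, exists_listArray_eq_zero k, by omega, fun q hq => ?_, fun j hj => ?_,
    fun q hq hql => ?_⟩
  · have hsub : errSet n (bitArray x) (bitArray y) \ listed n (setsArray S)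
        (actSum (listArray (List.ofFn s)) (listArray (List.ofFn k)) q) ⊆
        Finset.univ.biUnion fun i : Fin t =>
          if q ≤ k i then ∅ else (S i).filter fun j => x j ≠ y j := by
      intro j hj
      rw [Finset.mem_sdiff, mem_errSet_bitArray, mem_listed_setsArray hk hc.card_eq hq] at hj
      obtain ⟨i, hi⟩ := hc.diff_subset j hj.1
      rw [Finset.mem_biUnion]
      refine ⟨i, Finset.mem_univ _, ?_⟩
      rw [if_neg fun hqk => hj.2 ⟨i, hqk, hi⟩]
      exact Finset.mem_filter.2 ⟨hi, hj.1⟩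
    refine (Finset.card_le_card hsub).trans (Finset.card_biUnion_le.trans ?_)
    -- An unlisted error lies in one of at most `t` sets with `k i < q`, each containing fewer than
    -- `q` errors.
    refine (Finset.sum_le_card_nsmul _ _ q fun i _ => ?_).trans (by simp [hcount])
    split_ifs with h
    · simp
    · exact (hc.dist_le i).trans (by omega)
  · rw [mem_errSet_bitArray] at hj
    obtain ⟨i, hi⟩ := hc.diff_subset j hj
    exact (mem_listed_setsArray hk hc.card_eq le_rfl j).2 ⟨i, h1 i, hi⟩
  · unfold actSum
    congr 2
    refine le_antisymm (actCount_le_one (exists_listArray_eq_zero k) hq) ?_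
    -- Since `q ≤ lastThr`, even the last active set has `k i ≥ q`, so lowering the threshold to `1`
    -- activates no further set.
    have h3 := (hact q hq (actCount (listArray (List.ofFn k)) 1 - 1)).2 (hql.trans (min_le_left _ _))
    omega

/-- At the top level `2 ^ (e + 1) > k 0`, so no position counts as decoded yet. -/
theorem levelInv_start (hk : Antitone k) (s' S : ℕ → ℕ) (x y : Fin n → Bool) :
    LevelInv n s' (listArray (List.ofFn k)) S (bitArray x) (bitArray y)
      ((listArray (List.ofFn k) 0).size - 1) (bitArray y) := by
  have h0 : actSum s' (listArray (List.ofFn k))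
      (2 ^ ((listArray (List.ofFn k) 0).size - 1 + 1)) = 0 := by
    have h1 : actCount (listArray (List.ofFn k))
        (2 ^ ((listArray (List.ofFn k) 0).size - 1 + 1)) = 0 := by
      by_contra hc
      have h2 := (lt_actCount_iff (antitone_listArray_ofFn hk) (exists_listArray_eq_zero k)
        Nat.one_le_two_pow 0).1 (Nat.pos_of_ne_zero hc)
      have h3 := Nat.lt_size_self (listArray (List.ofFn k) 0)
      have h4 := Nat.pow_le_pow_right (n := 2) (by norm_num)
        (show (listArray (List.ofFn k) 0).size ≤ (listArray (List.ofFn k) 0).size - 1 + 1 by omega)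
      omega
    rw [actSum, h1, Finset.sum_range_zero]
  refine ⟨bitArray_lt_two y, ?_, fun j hj _ => hj⟩
  rw [h0]
  refine (Finset.card_le_card Finset.inter_subset_right).trans ((card_listed_le _ _ _).trans ?_)
  exact Nat.zero_le _

end

/-! ### The protocol as a pair of programs -/

section
variable {n t : ℕ} {s k : Fin t → ℕ} {ω : ℕ → Bool} {B : ℕ}

/-- Alice's final state. -/
noncomputable def aliceFinal (ω : ℕ → Bool) (B : ℕ) {n t : ℕ} (s k : Fin t → ℕ)
    (x : Fin n → Bool) : PState :=
  finalState ω 0 B n (listArray (List.ofFn s)) (listArray (List.ofFn k)) (fun _ => 0) (bitArray x)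
    fun _ => 0

/-- Bob's final state when he received `msg`. -/
noncomputable def bobFinal (ω : ℕ → Bool) (B : ℕ) {n t : ℕ} (s k : Fin t → ℕ) (y : Fin n → Bool)
    (S : Fin t → Finset (Fin n)) (msg : List Bool) : PState :=
  finalState ω 1 B n (listArray (List.ofFn s)) (listArray (List.ofFn k)) (setsArray S) (bitArray y)
    (listArray (msg.map Bool.toNat))

/-- The first cells of the table array, as a message. -/
def PState.message (st : PState) : List Bool :=
  (List.range st.off).map fun j => decide (st.A j ≠ 0)

theorem listArray_ofFn_le {f : Fin t → ℕ} {N : ℕ} (h : ∀ i, f i ≤ N) (j : ℕ) :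
    listArray (List.ofFn f) j ≤ N := by
  refine listArray_le (fun a ha => ?_) j
  obtain ⟨i, rfl⟩ := (List.mem_ofFn' _ a).1 ha
  exact h i

theorem le_of_input (h2 : ∀ i, 2 * k i ≤ s i) (hs : ∑ i, s i ≤ n) (i : Fin t) :
    s i ≤ n ∧ k i ≤ n := by
  have := Finset.single_le_sum (f := s) (fun i _ => Nat.zero_le _) (Finset.mem_univ i)
  have := h2 i
  omega

theorem alice_spec (hk : Antitone k) (h2 : ∀ i, 2 * k i ≤ s i) (hs : ∑ i, s i ≤ n)
    (x : Fin n → Bool) :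
    ∃ τ, Runs ω (numBound B n) (partyProg B 0) (aliceStart s k x) τ (totalSteps B n) ∧
      τ.message = (aliceFinal ω B s k x).message := by
  have hnN : 2 * n + 2 ≤ numBound B n := two_mul_le_numBound B n
  have hp := paramBounds_of_input hk h2 hs
  have hin := le_of_input h2 hs
  have hσ : (((aliceStart s k x).setReg 2 0).setReg 1 0).Bdd (numBound B n) := by
    refine ⟨fun v => ?_, fun b i => ?_⟩
    · match v with
      | 0 => exact (by omega : n ≤ numBound B n)
      | 1 => exact Nat.zero_le _
      | 2 => exact Nat.zero_le _
      | v + 3 => exact Nat.zero_le _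
    · match b with
      | 0 => exact (bitArray_lt_two x i).le.trans (by omega)
      | 1 => exact listArray_ofFn_le (fun i => (hin i).1.trans (by omega)) i
      | 2 => exact listArray_ofFn_le (fun i => (hin i).2.trans (by omega)) i
      | v + 3 => exact Nat.zero_le _
  obtain ⟨τ, h, hr, ha, -⟩ := partyProg_spec (ω := ω) (B := B) (flag := 0) (by norm_num) hp
    (one_le_lastThr hk h2) (S := fun _ => 0) (σ := aliceStart s k x)
    (fun i hi => (Nat.zero_le _).trans_lt (hi.trans_le hp.sum_le)) hσ
    rfl rfl rfl rfl (fun _ => by simp [aliceStart]) rfl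
  · refine ⟨τ, h, ?_⟩
    unfold RamState.message PState.message
    rw [hr, ha]
    rfl

theorem listArray_toNat_lt_two (msg : List Bool) (c : ℕ) : listArray (msg.map Bool.toNat) c < 2 := by
  refine Nat.lt_succ_of_le (listArray_le (fun a ha => ?_) c)
  obtain ⟨i, -, rfl⟩ := List.mem_map.1 ha
  exact Bool.toNat_le _

theorem setsArray_le (S : Fin t → Finset (Fin n)) (i : ℕ) : setsArray S i ≤ n := by
  refine listArray_le (fun a ha => ?_) i
  simp only [List.mem_flatten, List.mem_ofFn, exists_exists_eq_and, List.mem_map] at ha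
  obtain ⟨_, b, -, rfl⟩ := ha
  exact b.2.le

theorem bob_spec (hk : Antitone k) (h2 : ∀ i, 2 * k i ≤ s i) (hs : ∑ i, s i ≤ n)
    (y : Fin n → Bool) (S : Fin t → Finset (Fin n)) (msg : List Bool) :
    ∃ τ, Runs ω (numBound B n) (partyProg B 1) (bobStart s k y S msg) τ (totalSteps B n) ∧
      ∀ j < n, τ.arr 5 j = (bobFinal ω B s k y S msg).z j := by
  have hnN : 2 * n + 2 ≤ numBound B n := two_mul_le_numBound B n
  have hp := paramBounds_of_input hk h2 hs
  have hin := le_of_input h2 hs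
  have hσ : (((bobStart s k y S msg).setReg 2 0).setReg 1 0).Bdd (numBound B n) := by
    refine ⟨fun v => ?_, fun b i => ?_⟩
    · match v with
      | 0 => exact (by omega : n ≤ numBound B n)
      | 1 => exact Nat.zero_le _
      | 2 => exact Nat.zero_le _
      | v + 3 => exact Nat.zero_le _
    · match b with
      | 0 => exact (bitArray_lt_two y i).le.trans (by omega)
      | 1 => exact listArray_ofFn_le (fun i => (hin i).1.trans (by omega)) i
      | 2 => exact listArray_ofFn_le (fun i => (hin i).2.trans (by omega)) i
      | 3 => exact (setsArray_le S i).trans (by omega)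
      | 4 => exact (listArray_toNat_lt_two msg i).le.trans (by omega)
      | v + 5 => exact Nat.zero_le _
  obtain ⟨τ, h, -, -, hz⟩ := partyProg_spec (ω := ω) (B := B) (flag := 1) (by norm_num) hp
    (one_le_lastThr hk h2) (S := setsArray S) (σ := bobStart s k y S msg)
    (fun i hi => setsArray_lt S ((Nat.zero_le _).trans_lt (hi.trans_le hp.sum_le)) i)
    hσ
    rfl rfl rfl rfl (listArray_toNat_lt_two msg) rfl
  · exact ⟨τ, h, hz⟩

theorem PState.listArray_message (st : PState) (hA : ∀ c, st.A c < 2) {c : ℕ} (hc : c < st.off) :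
    listArray (st.message.map Bool.toNat) c = st.A c := by
  have := hA c
  rw [listArray_eq, dif_pos (by simpa [PState.message] using hc)]
  simp only [PState.message, List.getElem_map, List.getElem_range]
  by_cases h : st.A c = 0
  · simp [h]
  · simp [h]; omega

theorem bobFinal_z (hk : Antitone k) (h2 : ∀ i, 2 * k i ≤ s i) (hs : ∑ i, s i ≤ n)
    (h0 : actCount (listArray (List.ofFn k)) 1 ≠ 0) (x y : Fin n → Bool)
    (S : Fin t → Finset (Fin n)) :
    (bobFinal ω B s k y S (aliceFinal ω B s k x).message).z =
      decodeRun ω B n (listArray (List.ofFn s)) (listArray (List.ofFn k)) (setsArray S) (bitArray x)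
        ((listArray (List.ofFn k) 0).size - 1) 0 0 (bitArray y) := by
  have hp := paramBounds_of_input hk h2 hs
  have hA : ∀ c, (aliceFinal ω B s k x).A c < 2 := by
    intro c
    rw [aliceFinal, finalState, if_neg h0]
    exact runLevels_A_lt_two _ _ _ (fun _ => by simp) c
  rw [bobFinal, finalState, if_neg h0]
  refine runLevels_z (fun i hi => setsArray_lt S ((Nat.zero_le _).trans_lt
    (hi.trans_le hp.sum_le)) i) hp.zero (fun _ => 0) _ ⟨0, 0, bitArray x, fun _ => 0⟩ _
    rfl rfl (fun _ => by simp) (listArray_toNat_lt_two _) (fun _ _ => rfl) fun c _ hc => ?_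
  have h := PState.listArray_message (aliceFinal ω B s k x) hA (c := c) (by
    rwa [aliceFinal, finalState, if_neg h0])
  rw [aliceFinal, finalState, if_neg h0] at h
  simp only [aliceFinal, finalState, if_neg h0]
  exact h

theorem Runs.aliceSends {x : Fin n → Bool} {τ : RamState} {N m : ℕ} {p : RamProg}
    (h : Runs ω N p (aliceStart s k x) τ m) :
    ∃ U, AliceSends p s k x ω τ.message U ∧ U ≤ m * stepUnit N := by
  obtain ⟨U, hU, hle⟩ := h
  exact ⟨U, ⟨τ, hU, rfl⟩, hle⟩

theorem error_le_of_input {a : ℝ} {Y : ℕ} (hY : 1 ≤ Y) (haY : a ≤ Y) (ht : 0 < t)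
    (hk : Antitone k) (h2 : ∀ i, 2 * k i ≤ s i) (hs : ∑ i, s i ≤ n)
    {x y : Fin n → Bool} {S : Fin t → Finset (Fin n)} (hc : DEConsistent s k x y S) :
    fairCoins {ω | ¬ ∃ msg U V, AliceSends (partyProg (Y + 5 + 6) 0) s k x ω msg U ∧
      BobOutputs (partyProg (Y + 5 + 6) 1) s k y S msg ω (fun j => (x j).toNat) V} ≤
    ENNReal.ofReal ((2 : ℝ) ^ (-(1 * (k ⟨t - 1, Nat.sub_lt ht Nat.one_pos⟩ : ℝ))) +
      ((∑ i, s i : ℕ) : ℝ) ^ (-a)) := by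
  -- If `k_t = 0`, the claimed bound is at least `2 ^ 0 = 1`. Afterwards all sets are active, so the
  -- counts in the analysis are the true `t` and `∑ i, s i`.
  rcases Nat.eq_zero_or_pos (k ⟨t - 1, Nat.sub_lt ht Nat.one_pos⟩) with h0 | hpos
  · refine prob_le_one.trans ?_
    rw [← ENNReal.ofReal_one]
    apply ENNReal.ofReal_le_ofReal
    rw [h0]
    have : (0 : ℝ) ≤ ((∑ i, s i : ℕ) : ℝ) ^ (-a) := by positivity
    simp only [Nat.cast_zero, mul_zero, neg_zero, Real.rpow_zero]
    linarith
  have hall : ∀ i, 1 ≤ k i := fun i => hpos.trans_le (hk (Fin.le_def.2 (by simp only; omega)))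
  have hset := decodeSetting_of_input hk ht hall hc
  have hp := paramBounds_of_input hk h2 hs
  have hact : actCount (listArray (List.ofFn k)) 1 ≠ 0 := by have := hset.count_pos; omega
  have hthr := one_le_lastThr hk h2 hact
  have hS : ∀ i < actSum (listArray (List.ofFn s)) (listArray (List.ofFn k)) 1,
      setsArray S i < n := fun i hi =>
    setsArray_lt S ((Nat.zero_le _).trans_lt (hi.trans_le hp.sum_le)) i
  have hcount : actCount (listArray (List.ofFn k)) 1 = t := by
    refine le_antisymm (actCount_le_length hk le_rfl) ?_
    by_contra h
    have h3 := (lt_actCount_iff (antitone_listArray_ofFn hk) (exists_listArray_eq_zero k) le_rfl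
      (t - 1)).2 (by rwa [← listArray_ofFn_fin k] at hpos)
    omega
  have hsum : actSum (listArray (List.ofFn s)) (listArray (List.ofFn k)) 1 = ∑ i, s i := by
    rw [actSum_eq_sum hk le_rfl]
    exact Finset.sum_congr rfl fun i _ => if_pos (hall i)
  have hlast : listArray (List.ofFn k) (actCount (listArray (List.ofFn k)) 1 - 1) =
      k ⟨t - 1, Nat.sub_lt ht Nat.one_pos⟩ := by
    rw [hcount, ← listArray_ofFn_fin k]
  have hss : 1 ≤ sumSize (listArray (List.ofFn s)) (listArray (List.ofFn k)) :=
    hthr.trans (min_le_right _ _)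
  have hrun := (fairCoins_decodeRun (G := Y + 5) hset hthr hS
    ((listArray (List.ofFn k) 0).size - 1) 0 0 (fun _ => bitArray y) (fun _ _ _ => rfl)).trans
    (totalErr_le hY hss _)
  calc _ ≤ _ := measure_mono ?_
    _ ≤ _ := hrun
    _ ≤ _ := ?_
  · intro ω hω
    refine ⟨levelInv_start hk _ _ x y, ?_⟩
    by_contra hne
    apply hω
    obtain ⟨τ, hτ, hm⟩ := alice_spec (ω := ω) (B := Y + 5 + 6) hk h2 hs x
    obtain ⟨U, hU, -⟩ := hτ.aliceSends
    rw [hm] at hU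
    obtain ⟨ρ, ⟨V, hV, -⟩, hz⟩ := bob_spec (ω := ω) (B := Y + 5 + 6) hk h2 hs y S
      (aliceFinal ω (Y + 5 + 6) s k x).message
    refine ⟨_, U, V, hU, ρ, hV, funext fun j => ?_⟩
    rw [hz j j.2, bobFinal_z hk h2 hs hact]
    rw [Finset.not_nonempty_iff_eq_empty] at hne
    have := (Finset.ext_iff.1 hne j).not
    simp only [errSet, Finset.mem_filter, Finset.mem_univ, true_and, Finset.notMem_empty,
      not_false_eq_true, iff_true, not_not] at this
    rw [this, bitArray_fin]
  · rw [ENNReal.ofReal_add (by positivity) (by positivity), hlast]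
    refine add_le_add ?_ (two_inv_pow_le_rpow haY ?_ ?_)
    · rw [one_mul, Real.rpow_neg (by norm_num), Real.rpow_natCast,
        ENNReal.ofReal_inv_of_pos (by positivity), ENNReal.ofReal_pow (by norm_num),
        ENNReal.inv_pow]
      simp
    · rw [← hsum]
      exact Nat.size_pos.1 hss
    · rw [← hsum]
      exact Nat.lt_size_self _

end

/-! ### Length of the message -/

section
variable {B n : ℕ} {s k S : ℕ → ℕ} {ω : ℕ → Bool}

/-- The factor `2` covers the fallback: it is used only if `n` is less than the offset a regular
level would reach, and it adds `n` to the old offset. -/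
theorem stepLevel_off_le (flag e : ℕ) (st : PState) :
    (stepLevel ω flag n S (levelPar B n s k st.off e) st).off ≤
      2 * (st.off + tableCount s k e * 2 ^ cellBits B k e) := by
  simp only [stepLevel]
  rcases levelPar_cases B n s k st.off e with ⟨h, h'⟩ | ⟨h, h'⟩ <;> rw [h'] <;> simp only <;> omega

/-- Only the final level can be a fallback, so the doubling happens once. A regular final level has
`2 ^ i ≤ lastThr`, which bounds the width of its tables. -/
theorem runLevels_off_bound (hthr : 1 ≤ lastThr s k) (flag e : ℕ) (st : PState) :
    (runLevels ω flag B n s k S e st).off ≤ 2 * (st.off +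
      ∑ i ∈ Finset.range (e + 1), (4 * (actSum s k (2 ^ i) / 2 ^ i).size) * 2 ^ cellBits B k i +
      4 * sumSize s k * (2 ^ (B + (actCount k 1).size) * lastThr s k)) := by
  have hlast : ∀ i, 2 ^ i ≤ lastThr s k → tableCount s k i * 2 ^ cellBits B k i ≤
      4 * sumSize s k * (2 ^ (B + (actCount k 1).size) * lastThr s k) := by
    intro i hi
    rw [tableCount, if_neg (not_lt.2 hi), cellBits, pow_add]
    gcongr
  induction e generalizing st with
  | zero =>
    have h := stepLevel_off_le (ω := ω) (B := B) (n := n) (s := s) (k := k) (S := S) flag 0 st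
    have h2 := hlast 0 (by simpa using hthr)
    rw [runLevels]
    omega
  | succ e ih =>
    rw [runLevels]
    have h := stepLevel_off_le (ω := ω) (B := B) (n := n) (s := s) (k := k) (S := S) flag (e + 1) st
    split_ifs with hq
    · have h3 := ih (stepLevel ω flag n S (levelPar B n s k st.off (e + 1)) st)
      rw [Finset.sum_range_succ]
      rcases levelPar_cases B n s k st.off (e + 1) with ⟨-, h'⟩ | ⟨-, h'⟩
      · rw [h'] at hq; simp at hq
      have h4 : (stepLevel ω flag n S (levelPar B n s k st.off (e + 1)) st).off = st.off +
          4 * (actSum s k (2 ^ (e + 1)) / 2 ^ (e + 1)).size * 2 ^ cellBits B k (e + 1) := by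
        rw [h'] at hq ⊢
        simp only at hq
        simp only [stepLevel, tableCount, if_pos hq]
      rw [h4] at h3
      omega
    · rw [Finset.sum_range_succ]
      by_cases hq2 : lastThr s k < 2 ^ (e + 1)
      · rw [tableCount, if_pos hq2] at h
        omega
      · have := hlast (e + 1) (not_lt.1 hq2)
        omega

end

/-! ### Comparison of the table sizes with the entropy -/

theorem Nat.size_le_one_add_logb {m : ℕ} (hm : 1 ≤ m) : (m.size : ℝ) ≤ 1 + Real.logb 2 m := by
  have h1 : 2 ^ (m.size - 1) ≤ m := Nat.lt_size.1 (by have := Nat.size_pos.2 hm; omega)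
  have h2 : (2 : ℝ) ^ ((m.size - 1 : ℕ) : ℝ) ≤ m := by
    rw [Real.rpow_natCast]; exact_mod_cast h1
  have h3 := (Real.le_logb_iff_rpow_le (by norm_num) (by positivity)).2 h2
  rw [Nat.cast_sub (Nat.size_pos.2 hm)] at h3
  push_cast at h3
  linarith

/-- A sum of numbers that are at least `2` is at most their product. -/
theorem logb_sum_le_sum_logb {ι : Type*} {I : Finset ι} (hI : I.Nonempty) {x : ι → ℝ}
    (hx : ∀ i ∈ I, 2 ≤ x i) : Real.logb 2 (∑ i ∈ I, x i) ≤ ∑ i ∈ I, Real.logb 2 (x i) := by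
  have key : (∑ i ∈ I, x i ≤ ∏ i ∈ I, x i) ∧ 2 ≤ ∑ i ∈ I, x i := by
    induction hI using Finset.Nonempty.cons_induction with
    | singleton a => simpa using hx
    | cons a I ha hI ih =>
      obtain ⟨h1, h2⟩ := ih fun i hi => hx i (Finset.mem_cons_of_mem hi)
      have h3 := hx a (Finset.mem_cons_self _ _)
      rw [Finset.sum_cons, Finset.prod_cons]
      constructor <;> nlinarith
  rw [← Real.logb_prod _ _ fun i hi => by have := hx i hi; positivity]
  exact Real.logb_le_logb_of_le (by norm_num) (by linarith) key.1

/-- From `f` to `f + 1` the right-hand side grows by exactly the new summand, so only `f = 0` is an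
estimate. -/
theorem sum_two_pow_mul_logb_le {x : ℝ} (hx : 1 ≤ x) (f : ℕ) :
    ∑ i ∈ Finset.range (f + 1), (2 : ℝ) ^ i * Real.logb 2 (x / 2 ^ i) ≤
      2 ^ (f + 1) * (Real.logb 2 (x / 2 ^ f) + 1) := by
  have hlog : ∀ i : ℕ, Real.logb 2 (x / 2 ^ i) = Real.logb 2 x - i := fun i => by
    rw [Real.logb_div (by positivity) (by positivity), Real.logb_pow]; simp
  have h0 : 0 ≤ Real.logb 2 x := Real.logb_nonneg (by norm_num) hx
  simp only [hlog]
  induction f with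
  | zero => simp; linarith
  | succ f ih =>
    rw [Finset.sum_range_succ]
    refine (add_le_add_left ih _).trans (le_of_eq ?_)
    push_cast
    ring

theorem logb_two_le_self {x : ℝ} (hx : 0 < x) : Real.logb 2 x ≤ x := by
  rcases le_total x 1 with h | h
  · exact (Real.logb_nonpos (by norm_num) hx.le h).trans hx.le
  rw [Real.logb_le_iff_le_rpow (by norm_num) hx]
  have := one_add_mul_self_le_rpow_one_add (s := 1) (by norm_num) h
  norm_num at this
  linarith

/-- Induction by the absorption identity `(s + 1) * s.choose k = (s + 1).choose (k + 1) * (k + 1)`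
and `(s + 1) / (k + 1) ≤ s / k`. -/
theorem div_pow_le_choose (k : ℕ) : ∀ s : ℕ, k ≤ s → ((s : ℝ) / k) ^ k ≤ s.choose k := by
  induction k with
  | zero => simp
  | succ k ih =>
    rintro (_ | s) hs
    · omega
    have h1 : ((s : ℝ) + 1) * s.choose k = (s + 1).choose (k + 1) * (k + 1) := by
      exact_mod_cast Nat.add_one_mul_choose_eq s k
    have h2 : ((s : ℝ) + 1) / (k + 1) ≤ s / k ∨ k = 0 := by
      rcases Nat.eq_zero_or_pos k with h | h
      · exact .inr h
      · left
        have hks : (k : ℝ) ≤ s := by exact_mod_cast Nat.succ_le_succ_iff.1 hs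
        rw [div_le_div_iff₀ (by positivity) (by positivity)]
        nlinarith
    have h3 : (((s : ℝ) + 1) / (k + 1)) ^ k ≤ s.choose k := by
      rcases h2 with h2 | rfl
      · exact (pow_le_pow_left₀ (by positivity) h2 _).trans (ih s (by omega))
      · simp
    push_cast
    rw [pow_succ, ← mul_div_assoc, div_le_iff₀ (by positivity), ← h1, mul_comm]
    gcongr

theorem mul_logb_le_logb_choose {s k : ℕ} (hk : 1 ≤ k) (hs : k ≤ s) :
    (k : ℝ) * Real.logb 2 (s / k) ≤ Real.logb 2 (∑ j ∈ Finset.range (k + 1), (s.choose j : ℝ)) := by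
  have h0 : (0 : ℝ) < s / k := by
    have : 0 < s := by omega
    positivity
  rw [← Real.logb_pow]
  refine Real.logb_le_logb_of_le (by norm_num) (by positivity) ((div_pow_le_choose k s hs).trans ?_)
  exact Finset.single_le_sum (f := fun j => (s.choose j : ℝ)) (fun j _ => by positivity)
    (Finset.self_mem_range_succ k)

section
variable {n t : ℕ} {s k : Fin t → ℕ}

theorem one_le_logb_div {s k q : ℕ} (h2 : 2 * k ≤ s) (hq : 1 ≤ q) (hqk : q ≤ k) :
    1 ≤ Real.logb 2 ((s : ℝ) / q) := by
  rw [Real.le_logb_iff_rpow_le (by norm_num), Real.rpow_one, le_div_iff₀ (by positivity)]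
  · have : 2 * q ≤ s := by omega
    exact_mod_cast this
  · have : 0 < s := by omega
    positivity

theorem entropy_term_nonneg (s k : ℕ) :
    0 ≤ Real.logb 2 (∑ j ∈ Finset.range (k + 1), (s.choose j : ℝ)) := by
  refine Real.logb_nonneg (by norm_num) ?_
  have := Finset.single_le_sum (f := fun j => (s.choose j : ℝ)) (fun j _ => by positivity)
    (Finset.mem_range.2 (Nat.succ_pos k))
  simpa using this

theorem sum_mul_logb_le_entropyH (h2 : ∀ i, 2 * k i ≤ s i) :
    ∑ i with 1 ≤ k i, (k i : ℝ) * Real.logb 2 (s i / k i) ≤ entropyH s k := by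
  refine (Finset.sum_le_sum fun i hi => ?_).trans
    (Finset.sum_le_sum_of_subset_of_nonneg (Finset.filter_subset _ _)
      fun i _ _ => entropy_term_nonneg (s i) (k i))
  exact mul_logb_le_logb_choose (Finset.mem_filter.1 hi).2 (by have := h2 i; omega)

/-- Every active `s i / q` is at least `2`, so the logarithm of their sum is at most the sum of
logarithms. That sum is at least `1`, which absorbs the `1` from rounding up to the bit length. -/
theorem size_level_le (hk : Antitone k) (h2 : ∀ i, 2 * k i ≤ s i) {q : ℕ} (hq : 1 ≤ q)
    (hne : ∃ i, q ≤ k i) :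
    ((actSum (listArray (List.ofFn s)) (listArray (List.ofFn k)) q / q).size : ℝ) ≤
      2 * ∑ i with q ≤ k i, Real.logb 2 ((s i : ℝ) / q) := by
  rw [actSum_eq_sum hk hq, ← Finset.sum_filter]
  set I : Finset (Fin t) := {i | q ≤ k i} with hI
  have hIne : I.Nonempty := by
    obtain ⟨i, hi⟩ := hne
    exact ⟨i, by simp [hI, hi]⟩
  have hlow : ∀ i ∈ I, 1 ≤ Real.logb 2 ((s i : ℝ) / q) := fun i hi =>
    one_le_logb_div (h2 i) hq (Finset.mem_filter.1 hi).2
  have hpos : 1 ≤ (∑ i ∈ I, s i) / q := by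
    obtain ⟨i, hi⟩ := hIne
    rw [Nat.le_div_iff_mul_le hq, one_mul]
    have := Finset.single_le_sum (f := s) (fun i _ => Nat.zero_le _) hi
    have := h2 i
    have := (Finset.mem_filter.1 hi).2
    omega
  have h1 := Nat.size_le_one_add_logb hpos
  have h3 : Real.logb 2 (((∑ i ∈ I, s i) / q : ℕ) : ℝ) ≤ ∑ i ∈ I, Real.logb 2 ((s i : ℝ) / q) := by
    refine (Real.logb_le_logb_of_le (by norm_num) (by exact_mod_cast hpos)
      Nat.cast_div_le).trans ?_
    push_cast
    rw [Finset.sum_div]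
    refine logb_sum_le_sum_logb hIne fun i hi => ?_
    rw [le_div_iff₀ (by positivity)]
    have := h2 i
    have := (Finset.mem_filter.1 hi).2
    have : 2 * q ≤ s i := by omega
    exact_mod_cast this
  have h4 : 1 ≤ ∑ i ∈ I, Real.logb 2 ((s i : ℝ) / q) := by
    obtain ⟨i, hi⟩ := hIne
    exact (hlow i hi).trans (Finset.single_le_sum (f := fun i => Real.logb 2 ((s i : ℝ) / q))
      (fun j hj => zero_le_one.trans (hlow j hj)) hi)
  linarith

/-- The sum is dominated by its last term, where `2 ^ f ≤ k < 2 ^ (f + 1)`. Replacing `2 ^ f` by `k`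
inside the logarithm costs at most `1`, and `log (s / k) ≥ 1` absorbs the additive constants. -/
theorem sum_levels_le {s k : ℕ} (hk : 1 ≤ k) (h2 : 2 * k ≤ s) (e : ℕ) :
    ∑ i ∈ Finset.range e, (if 2 ^ i ≤ k then (2 : ℝ) ^ i * Real.logb 2 ((s : ℝ) / 2 ^ i) else 0) ≤
      6 * (k * Real.logb 2 ((s : ℝ) / k)) := by
  have hsz := Nat.size_pos.2 hk
  set f := k.size - 1 with hf
  have hf1 : 2 ^ f ≤ k := Nat.lt_size.1 (by omega)
  have hf2 : k < 2 ^ (f + 1) := by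
    have := Nat.lt_size_self k
    rwa [hf, Nat.sub_add_cancel hsz]
  have hfr1 : (2 : ℝ) ^ f ≤ k := by exact_mod_cast hf1
  have hfr2 : (k : ℝ) ≤ 2 ^ (f + 1) := by exact_mod_cast hf2.le
  have hs1 : (1 : ℝ) ≤ s := by
    have : 1 ≤ s := by omega
    exact_mod_cast this
  have hk0 : (0 : ℝ) < k := by positivity
  have hsub : ∑ i ∈ Finset.range e,
      (if 2 ^ i ≤ k then (2 : ℝ) ^ i * Real.logb 2 ((s : ℝ) / 2 ^ i) else 0) ≤
      ∑ i ∈ Finset.range (f + 1), (2 : ℝ) ^ i * Real.logb 2 ((s : ℝ) / 2 ^ i) := by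
    rw [← Finset.sum_filter]
    refine Finset.sum_le_sum_of_subset_of_nonneg (fun i hi => ?_) fun i hi _ => ?_
    · have h3 := (Finset.mem_filter.1 hi).2
      rw [Finset.mem_range]
      exact (Nat.pow_lt_pow_iff_right (by norm_num)).1 (h3.trans_lt hf2)
    · have h3 : 2 ^ i ≤ k := (Nat.pow_le_pow_right (by norm_num)
        (Nat.lt_succ_iff.1 (Finset.mem_range.1 hi))).trans hf1
      have := one_le_logb_div h2 (Nat.one_le_two_pow (n := i)) h3
      push_cast at this
      have : 0 ≤ Real.logb 2 ((s : ℝ) / 2 ^ i) := by linarith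
      positivity
  have h3 : Real.logb 2 ((s : ℝ) / 2 ^ f) ≤ Real.logb 2 ((s : ℝ) / k) + 1 := by
    have : Real.logb 2 ((s : ℝ) / k) + 1 = Real.logb 2 ((s : ℝ) / k * 2) := by
      rw [Real.logb_mul (by positivity) (by norm_num), Real.logb_self_eq_one (by norm_num)]
    rw [this]
    refine Real.logb_le_logb_of_le (by norm_num) (by positivity) ?_
    rw [div_mul_eq_mul_div, div_le_div_iff₀ (by positivity) hk0]
    rw [pow_succ] at hfr2
    nlinarith
  have h4 := one_le_logb_div h2 hk le_rfl
  calc _ ≤ _ := hsub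
    _ ≤ 2 ^ (f + 1) * (Real.logb 2 ((s : ℝ) / 2 ^ f) + 1) := sum_two_pow_mul_logb_le hs1 f
    _ ≤ (2 * k) * (3 * Real.logb 2 ((s : ℝ) / k)) := by
        rw [pow_succ]
        refine mul_le_mul (by linarith) (by linarith) ?_ (by positivity)
        have : 0 ≤ Real.logb 2 ((s : ℝ) / 2 ^ f) := by
          have := one_le_logb_div h2 (Nat.one_le_two_pow (n := f)) hf1
          push_cast at this
          linarith
        positivity
    _ = _ := by ring

theorem sum_tables_le (hk : Antitone k) (h2 : ∀ i, 2 * k i ≤ s i) {e : ℕ}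
    (he : ∀ i < e, ∃ j, 2 ^ i ≤ k j) :
    ∑ i ∈ Finset.range e, (2 : ℝ) ^ i *
      ((actSum (listArray (List.ofFn s)) (listArray (List.ofFn k)) (2 ^ i) / 2 ^ i).size : ℝ) ≤
      12 * entropyH s k := by
  calc _ ≤ ∑ i ∈ Finset.range e, 2 * ∑ j with 1 ≤ k j,
        if 2 ^ i ≤ k j then (2 : ℝ) ^ i * Real.logb 2 ((s j : ℝ) / 2 ^ i) else 0 := by
        refine Finset.sum_le_sum fun i hi => ?_
        have h3 := size_level_le hk h2 (Nat.one_le_two_pow (n := i)) (he i (Finset.mem_range.1 hi))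
        refine (mul_le_mul_of_nonneg_left h3 (by positivity)).trans_eq ?_
        rw [← Finset.sum_filter, Finset.filter_filter, mul_left_comm, Finset.mul_sum]
        congr 1
        refine Finset.sum_congr (Finset.ext fun j => ?_) fun j _ => by push_cast; rfl
        simp only [Finset.mem_filter, Finset.mem_univ, true_and]
        exact ⟨fun h => ⟨Nat.one_le_two_pow.trans h, h⟩, fun h => h.2⟩
    _ = 2 * ∑ j with 1 ≤ k j, ∑ i ∈ Finset.range e,
        if 2 ^ i ≤ k j then (2 : ℝ) ^ i * Real.logb 2 ((s j : ℝ) / 2 ^ i) else 0 := by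
        rw [← Finset.mul_sum, Finset.sum_comm]
    _ ≤ 2 * ∑ j with 1 ≤ k j, 6 * (k j * Real.logb 2 ((s j : ℝ) / k j)) := by
        gcongr with j hj
        exact sum_levels_le (Finset.mem_filter.1 hj).2 (h2 j) e
    _ ≤ 2 * (6 * entropyH s k) := by
        rw [← Finset.mul_sum]
        gcongr
        exact sum_mul_logb_le_entropyH h2
    _ = _ := by ring

end

section
variable {n t : ℕ} {s k : Fin t → ℕ}

theorem entropyH_nonneg (s k : Fin t → ℕ) : 0 ≤ entropyH s k :=
  Finset.sum_nonneg fun i _ => entropy_term_nonneg (s i) (k i)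

theorem mul_logb_le_of_sq_le {Q k : ℝ} (hQ : 0 ≤ Q) (hk : 0 < k) (h : Q ^ 2 ≤ k) :
    Q * Real.logb 2 k ≤ 2 * k := by
  have h1 : Real.logb 2 k = 2 * Real.logb 2 (√k) := by
    conv_lhs => rw [← Real.sq_sqrt hk.le]
    rw [Real.logb_pow]
    norm_num
  have h2 := logb_two_le_self (Real.sqrt_pos.2 hk)
  have h3 : Q ≤ √k := Real.le_sqrt_of_sq_le h
  have h4 := Real.mul_self_sqrt hk.le
  calc Q * Real.logb 2 k ≤ Q * (2 * √k) := by rw [h1]; gcongr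
    _ ≤ √k * (2 * √k) := by gcongr
    _ = 2 * k := by linarith

/-- From `log (L / 8) ≤ L / 8` one has `log L ≤ L / 8 + 3`. The small coefficient `1 / 4` of `Q * L`
matters: it allows this term to be absorbed later. -/
theorem mul_logb_le_of_lt_sq {Q k L : ℝ} (hQ : 0 < Q) (hk : 0 < k) (h : k ≤ Q ^ 2) (hL : Q ≤ L) :
    Q * Real.logb 2 k ≤ Q * L / 4 + 6 * Q := by
  have h0 : 0 < L := hQ.trans_le hL
  have h1 : Real.logb 2 k ≤ 2 * Real.logb 2 L := by
    have : Real.logb 2 (L ^ 2) = 2 * Real.logb 2 L := by rw [Real.logb_pow]; norm_num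
    rw [← this]
    exact Real.logb_le_logb_of_le (by norm_num) hk (h.trans (by gcongr))
  have h2 : Real.logb 2 L ≤ L / 8 + 3 := by
    have h3 := logb_two_le_self (x := L / 8) (by positivity)
    have h8 : Real.logb 2 8 = 3 := by
      rw [show (8 : ℝ) = 2 ^ 3 by norm_num, Real.logb_pow, Real.logb_self_eq_one (by norm_num)]
      norm_num
    rw [Real.logb_div (by positivity) (by norm_num), h8] at h3
    linarith
  calc Q * Real.logb 2 k ≤ Q * (2 * (L / 8 + 3)) := by gcongr; linarith
    _ = _ := by ring

/-- Let `s j` be the largest active set. The bit length `L` is at most `1 + I.card + log (s j / k j)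
+ log (k j)`. Multiplied by `Q`, each of the first three terms is at most the entropy, since `Q` is
at most every active `k i`. The last term is `O(k j)` if `Q ^ 2 ≤ k j`; otherwise `Q ≤ L` bounds it
by `Q * L / 4 + 6 * Q`, whose first part moves to the left. -/
theorem lastThr_mul_sumSize_le (hk : Antitone k) (h2 : ∀ i, 2 * k i ≤ s i)
    (h0 : actCount (listArray (List.ofFn k)) 1 ≠ 0) :
    (lastThr (listArray (List.ofFn s)) (listArray (List.ofFn k)) : ℝ) *
      sumSize (listArray (List.ofFn s)) (listArray (List.ofFn k)) ≤ 12 * entropyH s k := by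
  have hthr := one_le_lastThr hk h2 h0
  have hact := lt_actCount_iff (antitone_listArray_ofFn hk) (exists_listArray_eq_zero k) le_rfl
  set Q := lastThr (listArray (List.ofFn s)) (listArray (List.ofFn k)) with hQ
  set I : Finset (Fin t) := {i | 1 ≤ k i} with hI
  have hQk : ∀ i ∈ I, Q ≤ k i := by
    intro i hi
    have h3 := (hact i).2 (by rw [listArray_ofFn_fin]; exact (Finset.mem_filter.1 hi).2)
    rw [← listArray_ofFn_fin k i]
    exact (min_le_left _ _).trans (antitone_listArray_ofFn hk (by omega))
  have hIne : I.Nonempty := by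
    have h3 : 0 < t := (Nat.pos_of_ne_zero h0).trans_le (actCount_le_length hk le_rfl)
    refine ⟨⟨0, h3⟩, Finset.mem_filter.2 ⟨Finset.mem_univ _, ?_⟩⟩
    rw [← listArray_ofFn_fin k]
    exact (hact 0).1 (by omega)
  have hsum : actSum (listArray (List.ofFn s)) (listArray (List.ofFn k)) 1 = ∑ i ∈ I, s i := by
    rw [actSum_eq_sum hk le_rfl, ← Finset.sum_filter]
  have hsz : sumSize (listArray (List.ofFn s)) (listArray (List.ofFn k)) =
      (∑ i ∈ I, s i).size := by rw [sumSize, hsum]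
  have hQL : Q ≤ (∑ i ∈ I, s i).size := hsz ▸ min_le_right _ _
  rw [hsz]
  set L := (∑ i ∈ I, s i).size with hL
  obtain ⟨j, hj, hmax⟩ := Finset.exists_max_image I s hIne
  have hkj : 1 ≤ k j := (Finset.mem_filter.1 hj).2
  have hsj : 2 ≤ s j := by have := h2 j; omega
  have hsle : ∑ i ∈ I, s i ≤ I.card * s j := by
    simpa using Finset.sum_le_card_nsmul I s (s j) hmax
  have hspos : 1 ≤ ∑ i ∈ I, s i :=
    (Finset.single_le_sum (f := s) (fun i _ => Nat.zero_le _) hj).trans' (by omega)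
  have hcard : 1 ≤ I.card := Finset.card_pos.2 hIne
  have hkjr : (0 : ℝ) < k j := by positivity
  have hL1 : (L : ℝ) ≤ 1 + I.card + (Real.logb 2 ((s j : ℝ) / k j) + Real.logb 2 (k j)) := by
    have h3 := Nat.size_le_one_add_logb hspos
    have h4 : Real.logb 2 ((∑ i ∈ I, s i : ℕ) : ℝ) ≤ Real.logb 2 ((I.card : ℝ) * s j) :=
      Real.logb_le_logb_of_le (by norm_num) (by exact_mod_cast hspos) (by exact_mod_cast hsle)
    rw [Real.logb_mul (by positivity) (by positivity)] at h4
    have h5 := logb_two_le_self (x := (I.card : ℝ)) (by positivity)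
    have h6 : Real.logb 2 ((s j : ℝ) / k j) + Real.logb 2 (k j) = Real.logb 2 (s j) := by
      rw [← Real.logb_mul (by positivity) (by positivity), div_mul_cancel₀ _ (by positivity)]
    linarith
  have hH := sum_mul_logb_le_entropyH h2
  rw [← hI] at hH
  have hterm : ∀ i ∈ I, (k i : ℝ) ≤ k i * Real.logb 2 ((s i : ℝ) / k i) := fun i hi =>
    le_mul_of_one_le_right (by positivity)
      (one_le_logb_div (h2 i) (Finset.mem_filter.1 hi).2 le_rfl)
  have hHk : (I.card : ℝ) * Q ≤ entropyH s k := by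
    refine le_trans ?_ hH
    have : (I.card : ℝ) * Q = I.card • (Q : ℝ) := by simp
    rw [this]
    refine Finset.card_nsmul_le_sum _ _ _ fun i hi => le_trans ?_ (hterm i hi)
    exact_mod_cast hQk i hi
  have hHj : (k j : ℝ) * Real.logb 2 ((s j : ℝ) / k j) ≤ entropyH s k := by
    refine le_trans ?_ hH
    exact Finset.single_le_sum (f := fun i => (k i : ℝ) * Real.logb 2 ((s i : ℝ) / k i))
      (fun i hi => (Nat.cast_nonneg _).trans (hterm i hi)) hj
  have hQr : (1 : ℝ) ≤ Q := by exact_mod_cast hthr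
  have hcr : (1 : ℝ) ≤ I.card := by exact_mod_cast hcard
  have hlogj := one_le_logb_div (h2 j) hkj le_rfl
  have hQj : (Q : ℝ) ≤ k j := by exact_mod_cast hQk j hj
  have hQLr : (Q : ℝ) ≤ L := by exact_mod_cast hQL
  have h7 : (Q : ℝ) * Real.logb 2 ((s j : ℝ) / k j) ≤ entropyH s k :=
    (mul_le_mul_of_nonneg_right hQj (by linarith)).trans hHj
  have h8 : (Q : ℝ) ≤ entropyH s k := by nlinarith
  have h9 : (Q : ℝ) * L ≤ Q + I.card * Q + Q * Real.logb 2 ((s j : ℝ) / k j) +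
      Q * Real.logb 2 (k j) := by
    have := mul_le_mul_of_nonneg_left hL1 (by linarith : (0 : ℝ) ≤ Q)
    linarith
  rcases le_total ((Q : ℝ) ^ 2) (k j) with hc | hc
  · have := mul_logb_le_of_sq_le (by linarith) hkjr hc
    have := (hterm j hj).trans hHj
    linarith
  · have := mul_logb_le_of_lt_sq (by linarith) hkjr hc hQLr
    linarith

/-- The `8` combines four tables per unit with the doubling for the fallback, `2 ^ c.size ≤ 2 * t`
is the room for errors in undecoded sets, and the two sums contribute `12` entropies each. This is
even linear in `t`; the square comes from `1 ≤ t`. -/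
theorem length_le (B : ℕ) (hk : Antitone k) (h2 : ∀ i, 2 * k i ≤ s i) (ω : ℕ → Bool)
    (x : Fin n → Bool) :
    ((aliceFinal ω B s k x).message.length : ℝ) ≤ 384 * 2 ^ B * (t : ℝ) ^ 2 * entropyH s k := by
  have hH := entropyH_nonneg s k
  simp only [PState.message, List.length_map, List.length_range]
  rw [aliceFinal, finalState]
  split_ifs with h0
  · simp only [Nat.cast_zero]
    positivity
  have hthr := one_le_lastThr hk h2 h0
  have hact := lt_actCount_iff (antitone_listArray_ofFn hk) (exists_listArray_eq_zero k) le_rfl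
  have ht := actCount_le_length hk le_rfl
  set c := actCount (listArray (List.ofFn k)) 1 with hc
  have hk0 := (hact 0).1 (by omega)
  have hsz := Nat.size_pos.2 hk0
  have hbound := runLevels_off_bound (ω := ω) (B := B) (n := n) (S := fun _ => 0) hthr 0
    ((listArray (List.ofFn k) 0).size - 1) ⟨0, 0, bitArray x, fun _ => 0⟩
  rw [Nat.sub_add_cancel hsz, ← hc] at hbound
  have h1 := sum_tables_le hk h2 (e := (listArray (List.ofFn k) 0).size) fun i hi =>
    ⟨⟨0, by omega⟩, by
      rw [← listArray_ofFn_fin k]; exact Nat.lt_size.1 hi⟩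
  have h3 := lastThr_mul_sumSize_le hk h2 h0
  have h4 : 2 ^ c.size ≤ 2 * t := by
    have h5 : 2 ^ (c.size - 1) ≤ c := Nat.lt_size.1 (by
      have := Nat.size_pos.2 (Nat.pos_of_ne_zero h0); omega)
    have h6 : 2 ^ c.size = 2 * 2 ^ (c.size - 1) := by
      rw [← pow_succ', Nat.sub_add_cancel (Nat.size_pos.2 (Nat.pos_of_ne_zero h0))]
    omega
  have h4r : (2 : ℝ) ^ c.size ≤ 2 * t := by exact_mod_cast h4
  have ht1 : (1 : ℝ) ≤ t := by
    have : 1 ≤ t := by omega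
    exact_mod_cast this
  set Q := lastThr (listArray (List.ofFn s)) (listArray (List.ofFn k)) with hQ
  set L := sumSize (listArray (List.ofFn s)) (listArray (List.ofFn k)) with hL
  have hb : ((runLevels ω 0 B n (listArray (List.ofFn s)) (listArray (List.ofFn k)) (fun _ => 0)
      ((listArray (List.ofFn k) 0).size - 1) ⟨0, 0, bitArray x, fun _ => 0⟩).off : ℝ) ≤
      8 * 2 ^ B * 2 ^ c.size * ((∑ i ∈ Finset.range (listArray (List.ofFn k) 0).size, (2 : ℝ) ^ i *
      ((actSum (listArray (List.ofFn s)) (listArray (List.ofFn k)) (2 ^ i) / 2 ^ i).size : ℝ)) +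
      (Q : ℝ) * L) := by
    refine (Nat.cast_le.2 hbound).trans (le_of_eq ?_)
    push_cast
    rw [mul_add, zero_add, Finset.mul_sum, mul_add, Finset.mul_sum]
    congr 1
    · refine Finset.sum_congr rfl fun i _ => ?_
      rw [cellBits, ← hc, pow_add, pow_add]
      ring
    · rw [pow_add]
      ring
  calc _ ≤ _ := hb
    _ ≤ 8 * 2 ^ B * (2 * t) * (12 * entropyH s k + 12 * entropyH s k) := by gcongr
    _ = 384 * 2 ^ B * (t * 1) * entropyH s k := by ring
    _ ≤ 384 * 2 ^ B * (t * t) * entropyH s k := by gcongr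
    _ = _ := by ring

end

/-! ### Lower bound -/

/-- With Bob's input fixed, the output is determined by the leaf reached. -/
theorem CommTree.exists_outputs {X Y Z : Type} (P : CommTree X Y Z) (y : Y) :
    ∃ O : Finset Z, O.card ≤ 2 ^ P.depth ∧ ∀ x, P.run x y ∈ O := by
  classical
  induction P with
  | leaf out => exact ⟨{out y}, by simp [depth], fun x => by simp [run]⟩
  | alice f p q ihp ihq =>
    obtain ⟨O₁, h₁, m₁⟩ := ihp
    obtain ⟨O₂, h₂, m₂⟩ := ihq
    refine ⟨O₁ ∪ O₂, (Finset.card_union_le _ _).trans ?_, fun x => ?_⟩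
    · have h3 := Nat.pow_le_pow_right (n := 2) (by norm_num) (le_max_left p.depth q.depth)
      have h4 := Nat.pow_le_pow_right (n := 2) (by norm_num) (le_max_right p.depth q.depth)
      rw [depth, pow_succ]
      omega
    · rw [run, Finset.mem_union]
      split_ifs
      · exact .inr (m₂ x)
      · exact .inl (m₁ x)
  | bob g p q ihp ihq =>
    obtain ⟨O₁, h₁, m₁⟩ := ihp
    obtain ⟨O₂, h₂, m₂⟩ := ihq
    refine ⟨O₁ ∪ O₂, (Finset.card_union_le _ _).trans ?_, fun x => ?_⟩
    · have h3 := Nat.pow_le_pow_right (n := 2) (by norm_num) (le_max_left p.depth q.depth)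
      have h4 := Nat.pow_le_pow_right (n := 2) (by norm_num) (le_max_right p.depth q.depth)
      rw [depth, pow_succ]
      omega
    · rw [run, Finset.mem_union]
      split_ifs
      · exact .inr (m₂ x)
      · exact .inl (m₁ x)

theorem card_filter_card_le (m k : ℕ) :
    (Finset.univ.filter fun T : Finset (Fin m) => T.card ≤ k).card =
      ∑ j ∈ Finset.range (k + 1), m.choose j := by
  rw [Finset.card_eq_sum_card_fiberwise (f := Finset.card) (t := Finset.range (k + 1))]
  · refine Finset.sum_congr rfl fun j hj => ?_
    rw [Finset.mem_range] at hj
    have h : ((Finset.univ.filter fun T : Finset (Fin m) => T.card ≤ k).filter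
        fun T => T.card = j) = Finset.powersetCard j Finset.univ := by
      ext T
      simp only [Finset.mem_filter, Finset.mem_univ, true_and, Finset.mem_powersetCard,
        Finset.subset_univ]
      omega
    rw [h, Finset.card_powersetCard, Finset.card_univ, Fintype.card_fin]
  · intro T hT
    have := (Finset.mem_filter.1 hT).2
    simp only [Finset.coe_range, Set.mem_Iio]
    omega

section
variable {n t : ℕ} {s k : Fin t → ℕ}

/-- Many strings of Alice are consistent with one input of Bob. -/
theorem exists_many_consistent (hs : ∑ i, s i ≤ n) :
    ∃ (W : Finset (Fin n → Bool)) (y : Fin n → Bool) (S : Fin t → Finset (Fin n)),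
      W.card = ∏ i, ∑ j ∈ Finset.range (k i + 1), (s i).choose j ∧
      ∀ x ∈ W, DEConsistent s k x y S := by
  classical
  obtain ⟨f⟩ : Nonempty ((Σ i, Fin (s i)) ↪ Fin n) := by
    apply Function.Embedding.nonempty_of_card_le
    simpa using hs
  let enc : (∀ i, Finset (Fin (s i))) → Fin n → Bool := fun T j =>
    decide (∃ p : Σ i, Fin (s i), f p = j ∧ p.2 ∈ T p.1)
  have henc : ∀ T (p : Σ i, Fin (s i)), enc T (f p) = true ↔ p.2 ∈ T p.1 := by
    intro T p
    simp only [enc, decide_eq_true_eq]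
    refine ⟨?_, fun h => ⟨p, rfl, h⟩⟩
    rintro ⟨p', h, h'⟩
    rwa [f.injective h] at h'
  have hinj : Function.Injective enc := by
    intro T T' h
    funext i
    ext a
    rw [← henc T ⟨i, a⟩, h, henc]
  refine ⟨(Fintype.piFinset fun i => Finset.univ.filter fun T : Finset (Fin (s i)) =>
    T.card ≤ k i).image enc, fun _ => false,
    fun i => Finset.univ.image fun a => f ⟨i, a⟩, ?_, ?_⟩
  · rw [Finset.card_image_of_injective _ hinj, Fintype.card_piFinset]
    exact Finset.prod_congr rfl fun i _ => card_filter_card_le _ _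
  · intro x hx
    obtain ⟨T, hT, rfl⟩ := Finset.mem_image.1 hx
    rw [Fintype.mem_piFinset] at hT
    refine ⟨fun i j hij => ?_, fun i => ?_, fun i => ?_, fun j hj => ?_⟩
    · rw [Finset.disjoint_left]
      intro a ha hb
      obtain ⟨u, -, rfl⟩ := Finset.mem_image.1 ha
      obtain ⟨v, -, h⟩ := Finset.mem_image.1 hb
      have := congrArg Sigma.fst (f.injective h)
      exact hij this.symm
    · rw [Finset.card_image_of_injective, Finset.card_univ, Fintype.card_fin]
      intro a b h
      simpa using f.injective h
    · refine le_trans ?_ (Finset.mem_filter.1 (hT i)).2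
      refine le_trans (Finset.card_le_card fun j hj => ?_)
        (Finset.card_image_le (s := T i) (f := fun a => f ⟨i, a⟩))
      obtain ⟨h1, h2⟩ := Finset.mem_filter.1 hj
      obtain ⟨a, -, rfl⟩ := Finset.mem_image.1 h1
      rw [Bool.ne_false_iff, henc] at h2
      exact Finset.mem_image_of_mem _ h2
    · rw [Bool.ne_false_iff] at hj
      simp only [enc, decide_eq_true_eq] at hj
      obtain ⟨p, rfl, -⟩ := hj
      exact ⟨p.1, Finset.mem_image.2 ⟨p.2, Finset.mem_univ _, rfl⟩⟩

/-- For each random seed at most `2 ^ D` strings of `W` are output correctly, as Bob's input is the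
same for all of them; on average at least half of `W` is. -/
theorem card_le_of_randomizedDEPossible {D : ℕ} (h : RandomizedDEPossible n s k D)
    {W : Finset (Fin n → Bool)} {y : Fin n → Bool} {S : Fin t → Finset (Fin n)}
    (hW : ∀ x ∈ W, DEConsistent s k x y S) : W.card ≤ 2 * 2 ^ D := by
  classical
  obtain ⟨Ω, _, μ, P, hμ, hD, hP⟩ := h
  have h1 : ∀ ω, ∑ x ∈ W, {ω | (P ω).run x (y, S) = x}.indicator (1 : Ω → ENNReal) ω ≤
      2 ^ D := by
    intro ω
    obtain ⟨O, hO, hm⟩ := (P ω).exists_outputs (y, S)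
    have h2 : ∑ x ∈ W, {ω | (P ω).run x (y, S) = x}.indicator (1 : Ω → ENNReal) ω =
        ((W.filter fun x => (P ω).run x (y, S) = x).card : ENNReal) := by
      rw [Finset.card_filter]
      push_cast
      exact Finset.sum_congr rfl fun x _ => by simp [Set.indicator_apply]
    rw [h2]
    have h3 : (W.filter fun x => (P ω).run x (y, S) = x).card ≤ 2 ^ D := by
      refine (Finset.card_le_card fun x hx => ?_).trans
        (hO.trans (Nat.pow_le_pow_right (by norm_num) (hD ω)))
      have := hm x
      rwa [(Finset.mem_filter.1 hx).2] at this
    exact_mod_cast h3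
  have h2 : (W.card : ENNReal) * (1 / 2) ≤ 2 ^ D :=
    calc (W.card : ENNReal) * (1 / 2) = ∑ x ∈ W, (1 / 2 : ENNReal) := by simp
      _ ≤ ∑ x ∈ W, μ {ω | (P ω).run x (y, S) = x} :=
          Finset.sum_le_sum fun x hx => (hP x y S (hW x hx)).2
      _ = ∑ x ∈ W, ∫⁻ ω, {ω | (P ω).run x (y, S) = x}.indicator 1 ω ∂μ :=
          Finset.sum_congr rfl fun x hx =>
            (lintegral_indicator_one (hP x y S (hW x hx)).1).symm
      _ = ∫⁻ ω, ∑ x ∈ W, {ω | (P ω).run x (y, S) = x}.indicator 1 ω ∂μ :=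
          (lintegral_finsetSum' _ fun x hx => (measurable_one.indicator
            (hP x y S (hW x hx)).1).aemeasurable).symm
      _ ≤ ∫⁻ _, 2 ^ D ∂μ := lintegral_mono h1
      _ = 2 ^ D := by simp
  rw [mul_one_div, ENNReal.div_le_iff (by norm_num) (by norm_num), mul_comm] at h2
  exact_mod_cast h2

theorem entropyH_le_of_possible (h2 : ∀ i, 2 * k i ≤ s i) (hs : ∑ i, s i ≤ n) {D : ℕ}
    (h : RandomizedDEPossible n s k D) : entropyH s k ≤ 2 * D := by
  obtain ⟨W, y, S, hcard, hW⟩ := exists_many_consistent (k := k) hs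
  have hle := card_le_of_randomizedDEPossible h hW
  have hone : ∀ i, 1 ≤ ∑ j ∈ Finset.range (k i + 1), (s i).choose j := fun i => by
    have := Finset.single_le_sum (f := fun j => (s i).choose j) (fun j _ => Nat.zero_le _)
      (Finset.mem_range.2 (Nat.succ_pos (k i)))
    simpa using this
  have hlog : entropyH s k = Real.logb 2 W.card := by
    rw [hcard]
    push_cast
    rw [Real.logb_prod]
    · rfl
    · intro i _
      have := hone i
      have : (0 : ℝ) < ((∑ j ∈ Finset.range (k i + 1), (s i).choose j : ℕ) : ℝ) := by positivity
      push_cast at this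
      exact this.ne'
  have hWpos : 0 < W.card := by
    rw [hcard]
    exact Finset.prod_pos fun i _ => hone i
  have hup : entropyH s k ≤ 1 + D := by
    rw [hlog, Real.logb_le_iff_le_rpow (by norm_num) (by exact_mod_cast hWpos),
      Real.rpow_add (by norm_num), Real.rpow_one, Real.rpow_natCast]
    exact_mod_cast hle
  -- The additive `1` is absorbed when `D ≥ 1`. For `D = 0` only two strings could be possible, but
  -- some `k i ≥ 1` would already give `1 + s i ≥ 3`; so all `k i` vanish and the entropy is zero.
  rcases Nat.eq_zero_or_pos D with rfl | hD
  · have hk0 : ∀ i, k i = 0 := by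
      intro i
      by_contra hc
      have h3 : 3 ≤ ∑ j ∈ Finset.range (k i + 1), (s i).choose j := by
        have := Finset.sum_le_sum_of_subset (f := fun j => (s i).choose j)
          (Finset.range_mono (show 2 ≤ k i + 1 by omega))
        simp only [Finset.sum_range_succ, Finset.range_zero, Finset.sum_empty, Nat.choose_zero_right,
          Nat.choose_one_right] at this
        have := h2 i
        rw [Finset.sum_range_succ]
        omega
      have h4 := Finset.single_le_prod' (f := fun i => ∑ j ∈ Finset.range (k i + 1),
        (s i).choose j) (fun i _ => hone i) (Finset.mem_univ i)
      rw [← hcard] at h4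
      omega
    simp [entropyH, hk0]
  · have : (1 : ℝ) ≤ D := by exact_mod_cast hD
    linarith

end

/-! ### Running time -/

theorem Nat.size_le_mul_log (n : ℕ) : (n.size : ℝ) ≤ 4 * Real.log (n + 2) := by
  have h2 : 1 / 2 ≤ Real.log 2 := by have := Real.log_two_gt_d9; linarith
  have h3 : Real.log 2 ≤ Real.log (n + 2) :=
    Real.log_le_log (by norm_num) (by linarith [Nat.cast_nonneg (α := ℝ) n])
  rcases Nat.eq_zero_or_pos n with rfl | hn
  · simp only [Nat.size_zero, Nat.cast_zero] at *
    linarith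
  have h1 := Nat.size_le_one_add_logb hn
  have h4 : Real.logb 2 n ≤ 2 * Real.log (n + 2) := by
    rw [Real.logb, div_le_iff₀ (by linarith)]
    have : Real.log n ≤ Real.log (n + 2) := Real.log_le_log (by positivity) (by linarith)
    nlinarith
  linarith

/-- The four logarithms come from the number of levels, the tables per level, the coins per position
and the bit length of the numbers. -/
theorem time_le (B n : ℕ) : ((totalSteps B n * stepUnit (numBound B n) : ℕ) : ℝ) ≤
    16 * ((1242 + 153 * B) * (300 * (B + 12))) * ((n : ℝ) + 2) * Real.log ((n : ℝ) + 2) ^ 4 := by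
  have h2 : 1 / 2 ≤ Real.log 2 := by have := Real.log_two_gt_d9; linarith
  have h3 : Real.log 2 ≤ Real.log ((n : ℝ) + 2) :=
    Real.log_le_log (by norm_num) (by linarith [Nat.cast_nonneg (α := ℝ) n])
  have hsz := Nat.size_le_mul_log n
  set u := 2 * Real.log ((n : ℝ) + 2) with hu
  have hu1 : 1 ≤ u := by linarith
  have hσ : (n.size : ℝ) ≤ 2 * u := by linarith
  have hpow : 16 * Real.log ((n : ℝ) + 2) ^ 4 = u ^ 4 := by rw [hu]; ring
  set m := (n : ℝ) + 2 with hm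
  have hn : (n : ℝ) ≤ m := by linarith
  have hm1 : 1 ≤ m := by linarith [Nat.cast_nonneg (α := ℝ) n]
  set σ := n.size with hσdef
  have hB : (0 : ℝ) ≤ B := Nat.cast_nonneg _
  have hσ0 : (0 : ℝ) ≤ σ := Nat.cast_nonneg _
  have hn0 : (0 : ℝ) ≤ n := Nat.cast_nonneg _
  have hu2 : u ≤ u ^ 2 := by nlinarith
  have hu3 : u ≤ u ^ 3 := by nlinarith [sq_nonneg u]
  have hmu2 : m ≤ m * u ^ 2 := le_mul_of_one_le_right (by linarith) (by linarith)
  have humu2 : u ≤ m * u ^ 2 := by nlinarith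
  have hlevel : (levelSteps B n : ℝ) ≤ (386 + 51 * B) * (m * u ^ 2) := by
    have h4 : (n : ℝ) * (4 * (B + 2 * σ) + 10) + 7 ≤ m * ((4 * B + 33) * u) := by
      have : (n : ℝ) * (4 * (B + 2 * σ) + 10) ≤ m * ((4 * B + 26) * u) := by
        gcongr
        nlinarith
      nlinarith
    have h5 : (4 * (σ : ℝ) + 1) * (n * (4 * (B + 2 * σ) + 10) + 7) ≤
        (9 * u) * (m * ((4 * B + 33) * u)) := by
      gcongr
      linarith
    unfold levelSteps paramSteps
    push_cast
    rw [← hσdef]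
    have h6 : (B : ℝ) ≤ B * (m * u ^ 2) := le_mul_of_one_le_right hB (by linarith)
    nlinarith
  have htotal : (totalSteps B n : ℝ) ≤ (1242 + 153 * B) * (m * u ^ 3) := by
    have h4 : (levelSteps B n : ℝ) + 1 ≤ (387 + 51 * B) * (m * u ^ 2) := by linarith
    have h5 : ((σ : ℝ) + 1) * (levelSteps B n + 1) ≤ (3 * u) * ((387 + 51 * B) * (m * u ^ 2)) := by
      gcongr
      linarith
    have h6 : m ≤ m * u ^ 3 := le_mul_of_one_le_right (by linarith) (by linarith)
    have h7 : u ≤ m * u ^ 3 := hu3.trans (le_mul_of_one_le_left (by positivity) hm1)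
    unfold totalSteps
    push_cast
    rw [← hσdef]
    linarith
  have hunit : (stepUnit (numBound B n) : ℝ) ≤ 300 * (B + 12) * u := by
    unfold stepUnit numBound
    rw [Nat.size_pow, ← hσdef]
    push_cast
    have : (B : ℝ) ≤ B * u := le_mul_of_one_le_right hB hu1
    linarith
  push_cast
  calc (totalSteps B n : ℝ) * stepUnit (numBound B n)
      ≤ ((1242 + 153 * B) * (m * u ^ 3)) * (300 * (B + 12) * u) := by gcongr
    _ = ((1242 + 153 * B) * (300 * (B + 12))) * m * u ^ 4 := by ring
    _ = _ := by rw [← hpow]; ring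

theorem mainTheorem7 (a : ℝ) (ha : 0 < a) :
    ∃ (alice bob : RamProg) (C c K : ℝ) (b : ℕ), 0 < C ∧ 0 < c ∧ 0 < K ∧
      ∀ (n t : ℕ) (ht : 0 < t) (s k : Fin t → ℕ),
        Antitone k → (∀ i, 2 * k i ≤ s i) → ∑ i, s i ≤ n →
          OneRoundSolves alice bob n s k
            (C * (t : ℝ) ^ 2 * entropyH s k)
            (C * ((n : ℝ) + 2) * Real.log ((n : ℝ) + 2) ^ b)
            ((2 : ℝ) ^ (-(c * (k ⟨t - 1, Nat.sub_lt ht Nat.one_pos⟩ : ℝ))) +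
              ((∑ i, s i : ℕ) : ℝ) ^ (-a)) ∧
          ∀ D : ℕ, RandomizedDEPossible n s k D →
            C * (t : ℝ) ^ 2 * entropyH s k ≤ K * (t : ℝ) ^ 2 * (D : ℝ) := by
  obtain ⟨Y, hY⟩ := exists_nat_ge (max a 1)
  have haY : a ≤ Y := (le_max_left _ _).trans hY
  have hY1 : 1 ≤ Y := by exact_mod_cast (le_max_right a 1).trans hY
  -- `G = Y + 5` gives the error exponent `Y ≥ a`; the further `6` is what the cell numbers need in
  -- `LevelInv.card_errSet_le`.
  set B := Y + 5 + 6 with hB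
  set C₁ : ℝ := 384 * 2 ^ B with hC₁
  set C₂ : ℝ := 16 * ((1242 + 153 * B) * (300 * (B + 12))) with hC₂
  have hC₁0 : 0 < C₁ := by positivity
  have hC₂0 : 0 < C₂ := by positivity
  refine ⟨partyProg B 0, partyProg B 1, C₁ + C₂, 1, 2 * (C₁ + C₂), 4, by positivity, one_pos,
    by positivity, fun n t ht s k hk h2 hs => ?_⟩
  have hH := entropyH_nonneg s k
  have hlog : 0 ≤ Real.log ((n : ℝ) + 2) :=
    Real.log_nonneg (by linarith [Nat.cast_nonneg (α := ℝ) n])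
  have htime : ∀ U : ℕ, U ≤ totalSteps B n * stepUnit (numBound B n) →
      (U : ℝ) ≤ (C₁ + C₂) * ((n : ℝ) + 2) * Real.log ((n : ℝ) + 2) ^ 4 := by
    intro U hU
    refine (Nat.cast_le.2 hU).trans ((time_le B n).trans ?_)
    gcongr
    linarith
  refine ⟨⟨fun x ω => ?_, fun x y S _ ω msg U _ => ?_, fun x y S hc =>
    error_le_of_input hY1 haY ht hk h2 hs hc⟩, fun D hD => ?_⟩
  · obtain ⟨τ, hτ, hm⟩ := alice_spec (ω := ω) (B := B) hk h2 hs x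
    obtain ⟨U, hU, hle⟩ := hτ.aliceSends
    refine ⟨_, U, hU, ?_, htime U hle⟩
    rw [hm]
    refine (length_le B hk h2 ω x).trans ?_
    gcongr
    linarith
  · obtain ⟨τ, ⟨V, hV, hle⟩, -⟩ := bob_spec (ω := ω) (B := B) hk h2 hs y S msg
    exact ⟨_, V, ⟨τ, hV, rfl⟩, htime V hle⟩
  · have := entropyH_le_of_possible h2 hs hD
    calc (C₁ + C₂) * (t : ℝ) ^ 2 * entropyH s k ≤ (C₁ + C₂) * (t : ℝ) ^ 2 * (2 * D) := by gcongr
      _ = _ := by ring
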